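/- Let $\Bbbk$ be an algebraically closed field of characteristic zero, let $A$ be an associative commutative unital $\Bbbk$-algebra, and let $\mathfrak g$ be either $\mathfrak{sl}(n,n)$ with $n\ge 2$ or a finite-dimensional simple Lie superalgebra over $\Bbbk$ not of type $\mathfrak q(n)$. If $\mathfrak g$ is of Cartan type (i.e. $W(n)$, $S(n)$, $\tilde S(n)$ or $H(n)$) let $\mathfrak r=\mathfrak g_0$ be the subalgebra of elements of degree zero (the elements mapping the span of the generators $\xi_1,\dots,\xi_n$ of the exterior algebra to itself); otherwise let $\mathfrak r=\mathfrak g_{\bar 0}$. All modules are $\mathbb Z/2$-graded and all homomorphisms are even. **Triangular decomposition.** Let $\mathfrak h$ be a Cartan subalgebra of $\mathfrak r$ such that $\mathfrak g=\mathfrak h\oplus\bigoplus_{\alpha\in R}\mathfrak g_\alpha$, where $\mathfrak g_\alpha=\{x : [h,x]=\alpha(h)x \ \forall h\in\mathfrak h\}$ and $R=\{\alpha\in\mathfrak h^*\setminus\{0\} : \mathfrak g_\alpha\ne 0\}$. Let $R=R^+\sqcup R^-$, where $R^{+}=\{\alpha\in R: f(\alpha)>0\}$ and $R^-=\{\alpha\in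 R: f(\alpha)<0\}$ for some additive map $f:\mathfrak h^*\to\mathbb R$ that does not vanish on $R$. Put $\mathfrak n^\pm=\bigoplus_{\alpha\in R^\pm}\mathfrak g_\alpha$. Then $\mathfrak h^*$ is partially ordered by: $\mu\le\lambda$ if and only if $\lambda-\mu$ is a finite sum of elements of $R^+$. Assume $(\mathfrak C1)$: $\mathfrak n^-\cap\mathfrak g_{\bar 0}\subseteq\mathfrak r$. Let $\Delta_{\mathfrak r}$ be the set of simple roots of $\mathfrak r$ for the positive system given by $R^+$. **Weyl modules.** Let $X^+$ be the set of $\lambda\in\mathfrak h^*$ for which there is a finite-dimensional irreducible $\mathfrak g$-module with a highest-weight vector of weight $\lambda$, and fix $\lambda\in X^+$. The generalized Kac module $K(\lambda)$ is the quotient of $U(\mathfrak g)$ by the left ideal generated by $\mathfrak n^+$, $h-\lambda(h)$ for $h\in\mathfrak h$, and $(x_\alpha^-)^{\lambda(h_\alpha)+1}$ for $\alpha\in\Delta_{\mathfrak r}$, where $x_\alpha\in\mathfrak r_\alpha$, $x_\alpha^-\in\mathfrak r_{-\alpha}$, $h_\alpha\in\mathfrak h$ is an $\mathfrak{sl}(2)$-triple.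 Let $P_A(V)=U(\mathfrak g\otimes A)\otimes_{U(\mathfrak g)}V$. For a $\mathfrak g\otimes A$-module $M$ let $M_\mu=\{m : (h\otimes 1)m=\mu(h)m \ \forall h\in\mathfrak h\}$ and $M^\lambda=M/\sum_{\mu\not\le\lambda}U(\mathfrak g\otimes A)M_\mu$. Let $\mathcal C_A^\lambda$ be the category of $\mathfrak g\otimes A$-modules $M$ that are sums of finite-dimensional irreducible $\mathfrak r$-submodules and satisfy $M^\lambda=M$. The global Weyl module is $W_A(\lambda)=P_A(K(\lambda))^\lambda$, with generator $w_\lambda$ the image of $1\otimes 1$. Let $\mathbf A_\lambda=U(\mathfrak h\otimes A)/\{u : u\,w_\lambda=0\}$, a purely even algebra. **Proposition.** The ideal $\{u\in U(\mathfrak h\otimes A): u\,w_\lambda=0\}$ acts by zero on $M_\lambda$ for every $M$ in $\mathcal C_A^\lambda$; the formula $(u\,w_\lambda)u'=u\,u'w_\lambda$ $(u\in U(\mathfrak g\otimes A),\ u'\in U(\mathfrak h\otimes A))$ defines a right action of $\mathbf A_\lambda$ on $W_A(\lambda)$; and $W_A(\lambda)\otimes_{\mathbf A_\lambda}M$ belongs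 to $\mathcal C_A^\lambda$ for every graded $\mathbf A_\lambda$-module $M$. Hence there are functors $$\mathbf R_A^\lambda:\mathcal C_A^\lambda\to\mathbf A_\lambda\text{-mod},\ M\mapsto M_\lambda,\qquad \mathbf W_A^\lambda:\mathbf A_\lambda\text{-mod}\to\mathcal C_A^\lambda,\ M\mapsto W_A(\lambda)\otimes_{\mathbf A_\lambda}M,\ f\mapsto\mathrm{id}\otimes f,$$ where $\mathbf A_\lambda\text{-mod}$ is the category of $\mathbb Z/2$-graded $\mathbf A_\lambda$-modules, and: 1. $\mathbf R_A^\lambda\mathbf W_A^\lambda$ is naturally isomorphic to the identity functor. 2. $\mathbf W_A^\lambda$ is left adjoint to $\mathbf R_A^\lambda$. 3. $\mathbf W_A^\lambda$ is fully faithful. 4. If $M$ is a projective $\mathbf A_\lambda$-module, then $\mathbf W_A^\lambda M$ is a projective object of $\mathcal C_A^\lambda$. -/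

import Mathlib

open CategoryTheory TensorProduct

set_option linter.unusedSectionVars false

universe u

namespace SuperWeyl

/-! ### `ℤ/2`-graded vector spaces -/

/-- The Koszul sign `(-1)^(i * j)`. -/
def sgn (k : Type u) [Field k] (i j : ZMod 2) : k := if i = 1 ∧ j = 1 then -1 else 1

theorem zmod_two_cases : ∀ i : ZMod 2, i = 0 ∨ i = 1 := by decide

theorem sgn_zero_one (k : Type u) [Field k] : sgn k 0 1 = 1 := by simp [sgn]

theorem sgn_one_one (k : Type u) [Field k] : sgn k 1 1 = -1 := by simp [sgn]

theorem sgn_add (k : Type u) [Field k] (i j : ZMod 2) :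
    sgn k (i + j) 1 = sgn k i 1 * sgn k j 1 := by
  have h : (1 : ZMod 2) + 1 = 0 := rfl
  rcases zmod_two_cases i with rfl | rfl <;> rcases zmod_two_cases j with rfl | rfl <;>
    simp [sgn, h]

/-- A `ℤ/2`-grading `V = V₀ ⊕ V₁` of a vector space. -/
structure Z2Grading (k V : Type u) [Field k] [AddCommGroup V] [Module k V] where
  /-- the even part `gr 0` and the odd part `gr 1` -/
  gr : ZMod 2 → Submodule k V
  isCompl : IsCompl (gr 0) (gr 1)

namespace Z2Grading

variable {k V : Type u} [Field k] [AddCommGroup V] [Module k V]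

/-- The parity operator of a grading: `1` on the even part and `-1` on the odd part. -/
noncomputable def parity (G : Z2Grading k V) : V →ₗ[k] V :=
  LinearMap.ofIsCompl G.isCompl (G.gr 0).subtype (-(G.gr 1).subtype)

theorem parity_of_mem (G : Z2Grading k V) {i : ZMod 2} {v : V} (hv : v ∈ G.gr i) :
    G.parity v = sgn k i 1 • v := by
  rcases zmod_two_cases i with rfl | rfl
  · have := LinearMap.ofIsCompl_apply_left G.isCompl (φ := (G.gr 0).subtype)
      (ψ := -(G.gr 1).subtype) ⟨v, hv⟩
    simpa [parity, sgn] using this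
  · have := LinearMap.ofIsCompl_apply_right G.isCompl (φ := (G.gr 0).subtype)
      (ψ := -(G.gr 1).subtype) ⟨v, hv⟩
    simpa [parity, sgn] using this

theorem exists_add (G : Z2Grading k V) (v : V) :
    ∃ a ∈ G.gr 0, ∃ b ∈ G.gr 1, a + b = v := by
  have h : v ∈ G.gr 0 ⊔ G.gr 1 := by rw [G.isCompl.sup_eq_top]; trivial
  obtain ⟨a, ha, b, hb, e⟩ := Submodule.mem_sup.1 h
  exact ⟨a, ha, b, hb, e⟩

theorem parity_parity (G : Z2Grading k V) (v : V) : G.parity (G.parity v) = v := by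
  obtain ⟨a, ha, b, hb, rfl⟩ := G.exists_add v
  simp [G.parity_of_mem ha, G.parity_of_mem hb, sgn]

theorem mem_of_parity [CharZero k] (G : Z2Grading k V) {i : ZMod 2} {v : V}
    (hv : G.parity v = sgn k i 1 • v) : v ∈ G.gr i := by
  obtain ⟨a, ha, b, hb, rfl⟩ := G.exists_add v
  rw [map_add, G.parity_of_mem ha, G.parity_of_mem hb] at hv
  have h2 : (2 : k) ≠ 0 := two_ne_zero
  rcases zmod_two_cases i with rfl | rfl
  · have hb0 : (2 : k) • b = 0 := by
      simp [sgn] at hv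
      rw [two_smul]; nth_rewrite 1 [← hv]; simp
    have : b = 0 := (smul_eq_zero.1 hb0).resolve_left h2
    simpa [this] using ha
  · have ha0 : (2 : k) • a = 0 := by
      simp [sgn] at hv
      rw [two_smul]; nth_rewrite 1 [hv]; simp
    have : a = 0 := (smul_eq_zero.1 ha0).resolve_left h2
    simpa [this] using hb

/-- The grading by the eigenspaces, for the eigenvalues `1` and `-1`, of a linear involution. -/
def ofInvolution [CharZero k] (σ : V →ₗ[k] V) (hσ : ∀ v, σ (σ v) = v) : Z2Grading k V where
  gr i := LinearMap.ker (σ - sgn k i 1 • LinearMap.id)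
  isCompl := by
    have h2 : (2 : k) ≠ 0 := two_ne_zero
    constructor
    · rw [Submodule.disjoint_def]
      intro x h0 h1
      simp only [LinearMap.mem_ker, LinearMap.sub_apply, LinearMap.id_apply,
        LinearMap.add_apply, sgn_zero_one, sgn_one_one, one_smul, neg_smul, sub_neg_eq_add] at h0 h1
      rw [sub_eq_zero.1 h0, ← two_smul k] at h1
      exact (smul_eq_zero.1 h1).resolve_left h2
    · rw [codisjoint_iff, eq_top_iff]
      intro x _
      refine Submodule.mem_sup.2 ⟨(2 : k)⁻¹ • (x + σ x), ?_, (2 : k)⁻¹ • (x - σ x), ?_, ?_⟩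
      · simp [LinearMap.mem_ker, hσ, sgn, add_comm]
      · simp [LinearMap.mem_ker, hσ, sgn]
      · rw [← smul_add, add_add_sub_cancel, ← two_smul k, smul_smul, inv_mul_cancel₀ h2, one_smul]

theorem mem_ofInvolution [CharZero k] (σ : V →ₗ[k] V) (hσ : ∀ v, σ (σ v) = v) {i : ZMod 2}
    {v : V} : v ∈ (ofInvolution σ hσ).gr i ↔ σ v = sgn k i 1 • v := by
  simp [ofInvolution, LinearMap.mem_ker, sub_eq_zero]

end Z2Grading

/-! ### Lie superalgebras -/

/-- A Lie superalgebra over a field of characteristic zero. -/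
class LieSuperalgebra (k g : Type u) [Field k] [AddCommGroup g] [Module k g] where
  grading : Z2Grading k g
  /-- the superbracket -/
  br : g →ₗ[k] g →ₗ[k] g
  br_mem : ∀ {i j : ZMod 2} {x y : g}, x ∈ grading.gr i → y ∈ grading.gr j →
    br x y ∈ grading.gr (i + j)
  br_skew : ∀ {i j : ZMod 2} {x y : g}, x ∈ grading.gr i → y ∈ grading.gr j →
    br x y = -(sgn k i j • br y x)
  jacobi : ∀ {i j : ZMod 2} {x y : g} (z : g), x ∈ grading.gr i → y ∈ grading.gr j →
    br x (br y z) = br (br x y) z + sgn k i j • br y (br x z)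

section LieSuperalgebra

variable (k g : Type u) [Field k] [AddCommGroup g] [Module k g] [LieSuperalgebra k g]

/-- The homogeneous component `g_i` of a Lie superalgebra. -/
def gr (i : ZMod 2) : Submodule k g := (LieSuperalgebra.grading (k := k) (g := g)).gr i

/-- The superbracket. -/
def br : g →ₗ[k] g →ₗ[k] g := LieSuperalgebra.br

variable {g} in
/-- The parity operator of a Lie superalgebra. -/
noncomputable def par : g →ₗ[k] g := (LieSuperalgebra.grading (k := k) (g := g)).parity

/-- A Lie superalgebra is simple if its bracket is not zero and it has no graded ideals other than
`0` and itself. -/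
def IsSimple : Prop :=
  (∃ x y : g, br k g x y ≠ 0) ∧
    ∀ I : Submodule k g, (∀ x, ∀ y ∈ I, br k g x y ∈ I) → (∀ y ∈ I, par k y ∈ I) →
      I = ⊥ ∨ I = ⊤

/-- The odd part is a completely reducible module over the even part.  A simple Lie superalgebra
with this property is called classical. -/
def OddPartCompletelyReducible : Prop :=
  ∀ N ≤ gr k g 1, (∀ x ∈ gr k g 0, ∀ y ∈ N, br k g x y ∈ N) →
    ∃ N' ≤ gr k g 1, (∀ x ∈ gr k g 0, ∀ y ∈ N', br k g x y ∈ N') ∧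
      N ⊓ N' = ⊥ ∧ N ⊔ N' = gr k g 1

/-- The even part of a Lie superalgebra, as a type. -/
def EvenPart : Type u := ↥(gr k g 0)

instance : AddCommGroup (EvenPart k g) := inferInstanceAs (AddCommGroup ↥(gr k g 0))

instance : Module k (EvenPart k g) := inferInstanceAs (Module k ↥(gr k g 0))

/-- The inclusion of the even part. -/
def EvenPart.incl : EvenPart k g →ₗ[k] g := (gr k g 0).subtype

theorem EvenPart.incl_mem (x : EvenPart k g) : EvenPart.incl k g x ∈ gr k g 0 := x.2

theorem EvenPart.incl_injective : Function.Injective (EvenPart.incl k g) :=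
  Subtype.coe_injective

/-- The even part of a Lie superalgebra is a Lie algebra. -/
instance [CharZero k] : LieRing (EvenPart k g) where
  bracket x y := ⟨br k g (EvenPart.incl k g x) (EvenPart.incl k g y), by
    have h := LieSuperalgebra.br_mem (k := k) x.2 y.2
    rwa [add_zero] at h⟩
  add_lie x y z := EvenPart.incl_injective k g (by
    change br k g (EvenPart.incl k g (x + y)) _ = br k g _ _ + br k g _ _
    simp)
  lie_add x y z := EvenPart.incl_injective k g (by
    change br k g _ (EvenPart.incl k g (y + z)) = br k g _ _ + br k g _ _
    simp)
  lie_self x := EvenPart.incl_injective k g (by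
    change br k g (EvenPart.incl k g x) (EvenPart.incl k g x) = 0
    have h := LieSuperalgebra.br_skew (k := k) x.2 x.2
    have h' : br k g (EvenPart.incl k g x) (EvenPart.incl k g x) =
        -br k g (EvenPart.incl k g x) (EvenPart.incl k g x) := by
      rw [show sgn k 0 0 = 1 by simp [sgn], one_smul] at h
      exact h
    have h2 : (2 : k) • br k g (EvenPart.incl k g x) (EvenPart.incl k g x) = 0 := by
      rw [two_smul]; nth_rewrite 1 [h']; simp
    exact (smul_eq_zero.1 h2).resolve_left two_ne_zero)
  leibniz_lie x y z := EvenPart.incl_injective k g (by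
    change br k g _ (br k g _ _) = br k g (br k g _ _) _ + br k g _ (br k g _ _)
    have h := LieSuperalgebra.jacobi (k := k) (EvenPart.incl k g z) x.2 y.2
    rw [show sgn k 0 0 = 1 by simp [sgn], one_smul] at h
    exact h)

instance [CharZero k] : LieAlgebra k (EvenPart k g) where
  lie_smul c x y := EvenPart.incl_injective k g (by
    change br k g _ (EvenPart.incl k g (c • y)) = c • br k g _ _
    simp)

end LieSuperalgebra

/-! ### The universal enveloping superalgebra -/

section Enveloping

variable (k g : Type u) [Field k] [AddCommGroup g] [Module k g] [LieSuperalgebra k g]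

/-- The defining relations `x y - (-1)^(|x||y|) y x = [x, y]` of the universal enveloping
superalgebra. -/
inductive URel : TensorAlgebra k g → TensorAlgebra k g → Prop
  | mk {i j : ZMod 2} {x y : g} (hx : x ∈ gr k g i) (hy : y ∈ gr k g j) :
      URel (TensorAlgebra.ι k x * TensorAlgebra.ι k y)
        (sgn k i j • (TensorAlgebra.ι k y * TensorAlgebra.ι k x) +
          TensorAlgebra.ι k (br k g x y))

/-- The universal enveloping superalgebra `U(g)`. -/
def U : Type u := RingQuot (URel k g)

instance : Ring (U k g) := inferInstanceAs (Ring (RingQuot (URel k g)))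

instance : Algebra k (U k g) := inferInstanceAs (Algebra k (RingQuot (URel k g)))

namespace U

variable {g} in
/-- The canonical map `g → U(g)`. -/
def ι : g →ₗ[k] U k g :=
  (RingQuot.mkAlgHom k (URel k g)).toLinearMap ∘ₗ TensorAlgebra.ι k

variable {k g}

theorem ι_mul_ι {i j : ZMod 2} {x y : g} (hx : x ∈ gr k g i) (hy : y ∈ gr k g j) :
    ι k x * ι k y = sgn k i j • (ι k y * ι k x) + ι k (br k g x y) := by
  have h := RingQuot.mkAlgHom_rel k (URel.mk (k := k) hx hy)
  simp only [map_mul, map_add, map_smul] at h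
  exact h

variable {B : Type u} [Ring B] [Algebra k B]

/-- The universal property of `U(g)`. -/
def lift (f : g →ₗ[k] B) (hf : ∀ {i j : ZMod 2} {x y : g}, x ∈ gr k g i → y ∈ gr k g j →
    f x * f y = sgn k i j • (f y * f x) + f (br k g x y)) : U k g →ₐ[k] B :=
  RingQuot.liftAlgHom k ⟨TensorAlgebra.lift k f, by
    rintro _ _ ⟨hx, hy⟩
    simpa using hf hx hy⟩

theorem lift_ι (f : g →ₗ[k] B) (hf : ∀ {i j : ZMod 2} {x y : g}, x ∈ gr k g i → y ∈ gr k g j →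
    f x * f y = sgn k i j • (f y * f x) + f (br k g x y)) (x : g) :
    lift f hf (ι k x) = f x := by
  change RingQuot.liftAlgHom k _ (RingQuot.mkAlgHom k (URel k g) (TensorAlgebra.ι k x)) = f x
  rw [RingQuot.liftAlgHom_mkAlgHom_apply]
  simp

theorem algHom_ext {f₁ f₂ : U k g →ₐ[k] B} (h : ∀ x, f₁ (ι k x) = f₂ (ι k x)) : f₁ = f₂ := by
  apply RingQuot.ringQuot_ext' k
  apply TensorAlgebra.hom_ext
  ext x
  exact h x

theorem ι_par_mul {i j : ZMod 2} {x y : g} (hx : x ∈ gr k g i) (hy : y ∈ gr k g j) :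
    (ι k ∘ₗ par k) x * (ι k ∘ₗ par k) y =
      sgn k i j • ((ι k ∘ₗ par k) y * (ι k ∘ₗ par k) x) + (ι k ∘ₗ par k) (br k g x y) := by
  have e1 : par k x = sgn k i 1 • x := Z2Grading.parity_of_mem _ hx
  have e2 : par k y = sgn k j 1 • y := Z2Grading.parity_of_mem _ hy
  have e3 : par k (br k g x y) = sgn k (i + j) 1 • br k g x y :=
    Z2Grading.parity_of_mem _ (LieSuperalgebra.br_mem hx hy)
  simp only [LinearMap.comp_apply, e1, e2, e3, map_smul, smul_mul_smul_comm, ι_mul_ι hx hy,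
    sgn_add, smul_add]
  rw [smul_comm (sgn k i j), mul_comm (sgn k j 1)]

variable (k g) in
/-- The parity automorphism of `U(g)`. -/
noncomputable def σ : U k g →ₐ[k] U k g := lift (ι k ∘ₗ par k) ι_par_mul

theorem σ_ι (x : g) : σ k g (ι k x) = ι k (par k x) := lift_ι _ ι_par_mul x

theorem σ_σ (u : U k g) : σ k g (σ k g u) = u := by
  have : (σ k g).comp (σ k g) = AlgHom.id k _ := algHom_ext fun x => by
    simp only [AlgHom.comp_apply, σ_ι, AlgHom.id_apply]
    rw [show par k (par k x) = x from Z2Grading.parity_parity _ x]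
  exact congrArg (fun f => f u) this

variable (k g) in
/-- The `ℤ/2`-grading of `U(g)`, by the eigenspaces of the parity automorphism. -/
noncomputable def grading [CharZero k] : Z2Grading k (U k g) :=
  Z2Grading.ofInvolution (σ k g).toLinearMap fun u => σ_σ u

theorem mem_grading [CharZero k] {i : ZMod 2} {u : U k g} :
    u ∈ (grading k g).gr i ↔ σ k g u = sgn k i 1 • u :=
  Z2Grading.mem_ofInvolution (σ k g).toLinearMap fun u => σ_σ u

end U

end Enveloping

/-! ### Superalgebras and their graded modules -/

/-- An associative superalgebra. -/
class Superalgebra (k B : Type u) [Field k] [Ring B] [Algebra k B] where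
  grading : Z2Grading k B
  one_mem : (1 : B) ∈ grading.gr 0
  mul_mem : ∀ {i j : ZMod 2} {a b : B}, a ∈ grading.gr i → b ∈ grading.gr j →
    a * b ∈ grading.gr (i + j)

/-- The universal enveloping superalgebra is a superalgebra; it is generated by the elements
`ι x`, which have the parity of `x`. -/
noncomputable instance (k g : Type u) [Field k] [CharZero k] [AddCommGroup g] [Module k g]
    [LieSuperalgebra k g] : Superalgebra k (U k g) where
  grading := U.grading k g
  one_mem := by rw [U.mem_grading, map_one, sgn_zero_one, one_smul]
  mul_mem := by
    intro i j a b ha hb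
    rw [U.mem_grading] at ha hb ⊢
    rw [map_mul, ha, hb, smul_mul_smul_comm, sgn_add]

/-- A (left) `ℤ/2`-graded module over a superalgebra `B`. -/
structure SuperMod (k B : Type u) [Field k] [Ring B] [Algebra k B] [Superalgebra k B] where
  carrier : Type u
  [addCommGroup : AddCommGroup carrier]
  [moduleBase : Module k carrier]
  [module : Module B carrier]
  [isScalarTower : IsScalarTower k B carrier]
  grading : Z2Grading k carrier
  smul_mem : ∀ {i j : ZMod 2} {b : B} {m : carrier},
    b ∈ (Superalgebra.grading (k := k) (B := B)).gr i → m ∈ grading.gr j →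
      b • m ∈ grading.gr (i + j)

namespace SuperMod

attribute [instance] addCommGroup moduleBase module isScalarTower

variable {k B : Type u} [Field k] [Ring B] [Algebra k B] [Superalgebra k B]

instance : CoeSort (SuperMod k B) (Type u) := ⟨carrier⟩

/-- Homomorphisms of graded modules are even. -/
@[ext]
structure Hom (M N : SuperMod k B) where
  toLinearMap : M →ₗ[B] N
  map_mem : ∀ {i : ZMod 2} {m : M}, m ∈ M.grading.gr i → toLinearMap m ∈ N.grading.gr i

instance : Category (SuperMod k B) where
  Hom := Hom
  id M := ⟨LinearMap.id, fun h => h⟩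
  comp f h := ⟨h.toLinearMap ∘ₗ f.toLinearMap, fun hm => h.map_mem (f.map_mem hm)⟩

/-- The quotient of a graded module by a graded submodule. -/
def quot [CharZero k] (M : SuperMod k B) (N : Submodule B M)
    (hN : ∀ m ∈ N, M.grading.parity m ∈ N) : SuperMod k B where
  carrier := M ⧸ N
  grading :=
    { gr := fun i => (M.grading.gr i).map (N.mkQ.restrictScalars k)
      isCompl := by
        have h2 : (2 : k) ≠ 0 := two_ne_zero
        constructor
        · rw [Submodule.disjoint_def]
          rintro _ ⟨a, ha, rfl⟩ ⟨b, hb, e⟩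
          have h1 : b - a ∈ N := (Submodule.Quotient.eq N).1 e
          have h3 := hN _ h1
          rw [map_sub, M.grading.parity_of_mem ha, M.grading.parity_of_mem hb] at h3
          simp only [sgn_zero_one, sgn_one_one, neg_smul, one_smul] at h3
          have h4 : (2 : k) • a ∈ N.restrictScalars k := by
            have := N.neg_mem (N.add_mem h1 h3)
            rw [Submodule.restrictScalars_mem]
            convert this using 1
            rw [two_smul]; abel
          have h5 : a ∈ N.restrictScalars k := by
            have := (N.restrictScalars k).smul_mem (2 : k)⁻¹ h4
            rwa [smul_smul, inv_mul_cancel₀ h2, one_smul] at this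
          exact (Submodule.Quotient.mk_eq_zero N).2 h5
        · rw [codisjoint_iff, eq_top_iff]
          intro x _
          obtain ⟨m, rfl⟩ := N.mkQ_surjective x
          obtain ⟨a, ha, b, hb, rfl⟩ := M.grading.exists_add m
          rw [map_add]
          exact Submodule.add_mem_sup ⟨a, ha, rfl⟩ ⟨b, hb, rfl⟩ }
  smul_mem := by
    rintro i j b _ hb ⟨m, hm, rfl⟩
    exact ⟨b • m, M.smul_mem hb hm, by simp⟩

theorem mk_mem_quot [CharZero k] (M : SuperMod k B) (N : Submodule B M)
    (hN : ∀ m ∈ N, M.grading.parity m ∈ N) {i : ZMod 2} {m : M} (hm : m ∈ M.grading.gr i) :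
    Submodule.Quotient.mk (p := N) m ∈ (M.quot N hN).grading.gr i := ⟨m, hm, rfl⟩

theorem parity_smul (M : SuperMod k B) (b : B) (m : M) :
    M.grading.parity (b • m) =
      (Superalgebra.grading (k := k) (B := B)).parity b • M.grading.parity m := by
  have key : ∀ {i j : ZMod 2} {b : B} {m : M},
      b ∈ (Superalgebra.grading (k := k) (B := B)).gr i → m ∈ M.grading.gr j →
      M.grading.parity (b • m) =
        (Superalgebra.grading (k := k) (B := B)).parity b • M.grading.parity m := by
    intro i j b m hb hm
    rw [M.grading.parity_of_mem (M.smul_mem hb hm), Z2Grading.parity_of_mem _ hb,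
      M.grading.parity_of_mem hm, smul_assoc, smul_algebra_smul_comm, smul_smul, sgn_add]
  obtain ⟨b0, hb0, b1, hb1, rfl⟩ := (Superalgebra.grading (k := k) (B := B)).exists_add b
  obtain ⟨m0, hm0, m1, hm1, rfl⟩ := M.grading.exists_add m
  simp only [add_smul, smul_add, map_add, key hb0 hm0, key hb0 hm1, key hb1 hm0, key hb1 hm1]

/-- A submodule spanned by a set which is stable under the parity operator is graded. -/
theorem parity_mem_span (M : SuperMod k B) (s : Set M)
    (hs : ∀ m ∈ s, M.grading.parity m ∈ Submodule.span B s) :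
    ∀ m ∈ Submodule.span B s, M.grading.parity m ∈ Submodule.span B s := by
  intro m hm
  induction hm using Submodule.span_induction with
  | mem x hx => exact hs x hx
  | zero => simp
  | add x y _ _ hx hy => rw [map_add]; exact Submodule.add_mem _ hx hy
  | smul b x _ hx => rw [M.parity_smul]; exact Submodule.smul_mem _ _ hx

variable (k B) in
/-- The regular module. -/
def regular : SuperMod k B where
  carrier := B
  grading := Superalgebra.grading
  smul_mem := Superalgebra.mul_mem

/-- `M` is a finite-dimensional irreducible graded module. -/
def IsFinDimIrreducible (M : SuperMod k B) : Prop :=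
  Module.Finite k M ∧ Nontrivial M ∧
    ∀ N : Submodule B M, (∀ m ∈ N, M.grading.parity m ∈ N) → N = ⊥ ∨ N = ⊤

end SuperMod

theorem U.parity_eq_σ {k g : Type u} [Field k] [CharZero k] [AddCommGroup g] [Module k g]
    [LieSuperalgebra k g] (u : U k g) :
    (Superalgebra.grading (k := k) (B := U k g)).parity u = U.σ k g u := by
  obtain ⟨a, ha, b, hb, rfl⟩ := (Superalgebra.grading (k := k) (B := U k g)).exists_add u
  rw [map_add, map_add, Z2Grading.parity_of_mem _ ha, Z2Grading.parity_of_mem _ hb]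
  rw [U.mem_grading.1 ha, U.mem_grading.1 hb]

/-! ### Map superalgebras -/

section MapSuperalgebra

variable (k g A : Type u) [Field k] [AddCommGroup g] [Module k g] [LieSuperalgebra k g]
  [CommRing A] [Algebra k A]

/-- The bracket `[x ⊗ a, y ⊗ b] = [x, y] ⊗ ab`. -/
noncomputable def mapBr : g ⊗[k] A →ₗ[k] g ⊗[k] A →ₗ[k] g ⊗[k] A :=
  TensorProduct.map₂ (br k g) (LinearMap.mul k A)

theorem mapBr_tmul (x y : g) (a b : A) :
    mapBr k g A (x ⊗ₜ a) (y ⊗ₜ b) = br k g x y ⊗ₜ (a * b) := by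
  simp [mapBr]

/-- The grading `(g ⊗ A)_i = g_i ⊗ A`. -/
noncomputable def mapGr (i : ZMod 2) : Submodule k (g ⊗[k] A) :=
  LinearMap.range ((gr k g i).subtype.rTensor A)

variable {k g A}

theorem tmul_mem_mapGr {i : ZMod 2} {x : g} (hx : x ∈ gr k g i) (a : A) :
    x ⊗ₜ[k] a ∈ mapGr k g A i := ⟨(⟨x, hx⟩ : gr k g i) ⊗ₜ a, by simp⟩

theorem mapGr_induction {i : ZMod 2} {p : g ⊗[k] A → Prop} (h0 : p 0)
    (h1 : ∀ x ∈ gr k g i, ∀ a : A, p (x ⊗ₜ a)) (h2 : ∀ s t, p s → p t → p (s + t))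
    {t : g ⊗[k] A} (ht : t ∈ mapGr k g A i) : p t := by
  obtain ⟨s, rfl⟩ := ht
  induction s with
  | zero => simpa using h0
  | tmul x a => simpa using h1 x x.2 a
  | add s t hs ht => rw [map_add]; exact h2 _ _ hs ht

variable (k g A)

theorem mapGr_isCompl : IsCompl (mapGr k g A 0) (mapGr k g A 1) := by
  let P : g →ₗ[k] g := LinearMap.ofIsCompl (LieSuperalgebra.grading (k := k) (g := g)).isCompl
    (gr k g 0).subtype 0
  have h0 : ∀ t ∈ mapGr k g A 0, P.rTensor A t = t := fun t ht =>
    mapGr_induction (p := fun t => P.rTensor A t = t) (by simp) (fun x hx a => by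
      rw [LinearMap.rTensor_tmul]
      exact congrArg (· ⊗ₜ[k] a) (LinearMap.ofIsCompl_apply_left _ ⟨x, hx⟩))
      (fun s t hs ht => by rw [map_add, hs, ht]) ht
  have h1 : ∀ t ∈ mapGr k g A 1, P.rTensor A t = 0 := fun t ht =>
    mapGr_induction (p := fun t => P.rTensor A t = 0) (by simp) (fun x hx a => by
      rw [LinearMap.rTensor_tmul, show P x = 0 from LinearMap.ofIsCompl_apply_right _ ⟨x, hx⟩,
        TensorProduct.zero_tmul])
      (fun s t hs ht => by rw [map_add, hs, ht, add_zero]) ht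
  constructor
  · rw [Submodule.disjoint_def]
    intro t ht0 ht1
    rw [← h0 t ht0, h1 t ht1]
  · rw [codisjoint_iff, eq_top_iff]
    intro t _
    induction t with
    | zero => exact Submodule.zero_mem _
    | add s t hs ht => exact Submodule.add_mem _ (hs trivial) (ht trivial)
    | tmul x a =>
      obtain ⟨x0, hx0, x1, hx1, rfl⟩ := (LieSuperalgebra.grading (k := k) (g := g)).exists_add x
      rw [TensorProduct.add_tmul]
      exact Submodule.add_mem_sup (tmul_mem_mapGr hx0 a) (tmul_mem_mapGr hx1 a)

noncomputable instance : LieSuperalgebra k (g ⊗[k] A) where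
  grading := ⟨mapGr k g A, mapGr_isCompl k g A⟩
  br := mapBr k g A
  br_mem := by
    intro i j x y hx hy
    refine mapGr_induction (p := fun x => mapBr k g A x y ∈ mapGr k g A (i + j)) (by simp) ?_
      (fun s t hs ht => by rw [map_add, LinearMap.add_apply]; exact Submodule.add_mem _ hs ht) hx
    intro x hx a
    refine mapGr_induction (p := fun y => mapBr k g A (x ⊗ₜ a) y ∈ mapGr k g A (i + j)) (by simp) ?_
      (fun s t hs ht => by rw [map_add]; exact Submodule.add_mem _ hs ht) hy
    intro y hy b
    rw [mapBr_tmul]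
    exact tmul_mem_mapGr (LieSuperalgebra.br_mem hx hy) _
  br_skew := by
    intro i j x y hx hy
    refine mapGr_induction (p := fun x => mapBr k g A x y = -(sgn k i j • mapBr k g A y x))
      (by simp) ?_ (fun s t hs ht => by
        rw [map_add, LinearMap.add_apply, map_add, hs, ht, smul_add, neg_add]) hx
    intro x hx a
    refine mapGr_induction (p := fun y => mapBr k g A (x ⊗ₜ a) y =
      -(sgn k i j • mapBr k g A y (x ⊗ₜ a))) (by simp) ?_ (fun s t hs ht => by
        rw [map_add, LinearMap.map_add₂, hs, ht, smul_add, neg_add]) hy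
    intro y hy b
    rw [mapBr_tmul, mapBr_tmul, show br k g x y = _ from LieSuperalgebra.br_skew hx hy, mul_comm b,
      TensorProduct.neg_tmul, TensorProduct.smul_tmul']
    rfl
  jacobi := by
    intro i j x y z hx hy
    refine mapGr_induction (p := fun x => mapBr k g A x (mapBr k g A y z) =
      mapBr k g A (mapBr k g A x y) z + sgn k i j • mapBr k g A y (mapBr k g A x z))
      (by simp) ?_ (fun s t hs ht => by
        simp only [map_add, LinearMap.add_apply, hs, ht, smul_add]; abel) hx
    intro x hx a
    refine mapGr_induction (p := fun y => mapBr k g A (x ⊗ₜ a) (mapBr k g A y z) =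
      mapBr k g A (mapBr k g A (x ⊗ₜ a) y) z +
        sgn k i j • mapBr k g A y (mapBr k g A (x ⊗ₜ a) z))
      (by simp) ?_ (fun s t hs ht => by
        simp only [map_add, LinearMap.add_apply, hs, ht, smul_add]; abel) hy
    intro y hy b
    induction z with
    | zero => simp
    | add s t hs ht => simp only [map_add, hs, ht, smul_add]; abel
    | tmul z c =>
      simp only [mapBr_tmul]
      rw [show br k g x (br k g y z) = _ from LieSuperalgebra.jacobi z hx hy,
        TensorProduct.add_tmul, TensorProduct.smul_tmul', mul_assoc a, mul_left_comm b]
      rfl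

theorem ι_tmul_one_mul {i j : ZMod 2} {x y : g} (hx : x ∈ gr k g i) (hy : y ∈ gr k g j) :
    (U.ι k ∘ₗ (TensorProduct.mk k g A).flip 1) x * (U.ι k ∘ₗ (TensorProduct.mk k g A).flip 1) y =
      sgn k i j • ((U.ι k ∘ₗ (TensorProduct.mk k g A).flip 1) y *
        (U.ι k ∘ₗ (TensorProduct.mk k g A).flip 1) x) +
      (U.ι k ∘ₗ (TensorProduct.mk k g A).flip 1) (br k g x y) := by
  have := U.ι_mul_ι (k := k) (tmul_mem_mapGr (A := A) hx 1) (tmul_mem_mapGr (A := A) hy 1)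
  have h : br k (g ⊗[k] A) (x ⊗ₜ 1) (y ⊗ₜ 1) = br k g x y ⊗ₜ 1 :=
    (mapBr_tmul k g A x y 1 1).trans (by rw [mul_one])
  rw [h] at this
  exact this

/-- The algebra homomorphism `U(g) → U(g ⊗ A)` induced by `x ↦ x ⊗ 1`. -/
noncomputable def UIncl : U k g →ₐ[k] U k (g ⊗[k] A) :=
  U.lift (U.ι k ∘ₗ (TensorProduct.mk k g A).flip 1) (ι_tmul_one_mul k g A)

theorem UIncl_ι (x : g) : UIncl k g A (U.ι k x) = U.ι k (x ⊗ₜ[k] (1 : A)) :=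
  U.lift_ι _ (ι_tmul_one_mul k g A) x

theorem mapPar_tmul (x : g) (a : A) : par k (x ⊗ₜ[k] a) = par k x ⊗ₜ[k] a := by
  obtain ⟨x0, h0, x1, h1, rfl⟩ := (LieSuperalgebra.grading (k := k) (g := g)).exists_add x
  have key : ∀ {i : ZMod 2} {x : g}, x ∈ gr k g i →
      par k (x ⊗ₜ[k] a) = par k x ⊗ₜ[k] a := by
    intro i x hx
    rw [show par k (x ⊗ₜ[k] a) = sgn k i 1 • (x ⊗ₜ[k] a) from
      Z2Grading.parity_of_mem _ (tmul_mem_mapGr hx a),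
      show par k x = sgn k i 1 • x from Z2Grading.parity_of_mem _ hx, TensorProduct.smul_tmul']
  rw [TensorProduct.add_tmul, map_add, map_add, TensorProduct.add_tmul, key h0, key h1]

end MapSuperalgebra

/-! ### The Lie superalgebras under consideration -/

section Types

variable {k : Type u} [Field k]

/-- An isomorphism of the Lie superalgebra `g` onto its image in the associative superalgebra `E`
with grading `𝒢`, in which the bracket is the supercommutator. -/
def IsSuperEmbedding {g E : Type u} [AddCommGroup g] [Module k g] [LieSuperalgebra k g] [Ring E]
    [Algebra k E] (𝒢 : ZMod 2 → Submodule k E) (φ : g →ₗ[k] E) : Prop :=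
  Function.Injective φ ∧ (∀ i, ∀ x ∈ gr k g i, φ x ∈ 𝒢 i) ∧
    ∀ i j, ∀ x ∈ gr k g i, ∀ y ∈ gr k g j,
      φ (br k g x y) = φ x * φ y - sgn k i j • (φ y * φ x)

/-- The homogeneous endomorphisms of parity `i` of a graded vector space. -/
def endGr {V : Type u} [AddCommGroup V] [Module k V] (G : Z2Grading k V) (i : ZMod 2) :
    Submodule k (Module.End k V) where
  carrier := {D | ∀ j, ∀ v ∈ G.gr j, D v ∈ G.gr (i + j)}
  add_mem' hD hE j v hv := Submodule.add_mem _ (hD j v hv) (hE j v hv)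
  zero_mem' _ _ _ := Submodule.zero_mem _
  smul_mem' c _ hD j v hv := Submodule.smul_mem _ c (hD j v hv)

/-! #### Matrix superalgebras -/

variable (k) in
/-- The grading of the superalgebra of `(n|n) × (n|n)`-matrices: the block-diagonal matrices are
even, the block-off-diagonal ones are odd. -/
def matGr (n : ℕ) (i : ZMod 2) : Submodule k (Matrix (Fin n ⊕ Fin n) (Fin n ⊕ Fin n) k) where
  carrier := {M | if i = 0 then M.toBlocks₁₂ = 0 ∧ M.toBlocks₂₁ = 0
    else M.toBlocks₁₁ = 0 ∧ M.toBlocks₂₂ = 0}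
  add_mem' {M N} hM hN := by
    simp only [Set.mem_ofPred_eq] at hM hN ⊢
    split_ifs at hM hN ⊢ with h
    · exact ⟨by rw [show (M + N).toBlocks₁₂ = M.toBlocks₁₂ + N.toBlocks₁₂ from rfl, hM.1, hN.1,
        add_zero], by rw [show (M + N).toBlocks₂₁ = M.toBlocks₂₁ + N.toBlocks₂₁ from rfl, hM.2,
        hN.2, add_zero]⟩
    · exact ⟨by rw [show (M + N).toBlocks₁₁ = M.toBlocks₁₁ + N.toBlocks₁₁ from rfl, hM.1, hN.1,
        add_zero], by rw [show (M + N).toBlocks₂₂ = M.toBlocks₂₂ + N.toBlocks₂₂ from rfl, hM.2,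
        hN.2, add_zero]⟩
  zero_mem' := by
    simp only [Set.mem_ofPred_eq]
    split_ifs <;> exact ⟨rfl, rfl⟩
  smul_mem' c M hM := by
    simp only [Set.mem_ofPred_eq] at hM ⊢
    split_ifs at hM ⊢ with h
    · exact ⟨by rw [show (c • M).toBlocks₁₂ = c • M.toBlocks₁₂ from rfl, hM.1, smul_zero],
        by rw [show (c • M).toBlocks₂₁ = c • M.toBlocks₂₁ from rfl, hM.2, smul_zero]⟩
    · exact ⟨by rw [show (c • M).toBlocks₁₁ = c • M.toBlocks₁₁ from rfl, hM.1, smul_zero],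
        by rw [show (c • M).toBlocks₂₂ = c • M.toBlocks₂₂ from rfl, hM.2, smul_zero]⟩

/-- The supertrace. -/
def supertrace {n : ℕ} (M : Matrix (Fin n ⊕ Fin n) (Fin n ⊕ Fin n) k) : k :=
  M.toBlocks₁₁.trace - M.toBlocks₂₂.trace

variable (k) in
/-- `g` is isomorphic to `sl(n, n)` for some `n ≥ 2`. -/
def IsSpecialLinear (g : Type u) [AddCommGroup g] [Module k g] [LieSuperalgebra k g] : Prop :=
  ∃ n : ℕ, 2 ≤ n ∧ ∃ φ : g →ₗ[k] Matrix (Fin n ⊕ Fin n) (Fin n ⊕ Fin n) k,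
    IsSuperEmbedding (matGr k n) φ ∧ ∀ M, M ∈ LinearMap.range φ ↔ supertrace M = 0

variable (k) in
/-- The pairs `(a, b)` of `n × n`-matrices with `tr b = 0`. -/
def sqMat (n : ℕ) : Submodule k (Matrix (Fin n) (Fin n) k × Matrix (Fin n) (Fin n) k) :=
  LinearMap.ker (Matrix.traceLinearMap (Fin n) k k ∘ₗ LinearMap.snd k _ _)

/-- The matrix with blocks `a, b; b, a`. -/
def sqBlocks {n : ℕ} (X : sqMat k n) : Matrix (Fin n ⊕ Fin n) (Fin n ⊕ Fin n) k :=
  Matrix.fromBlocks X.1.1 X.1.2 X.1.2 X.1.1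

variable (k) in
/-- `g` is isomorphic to `q(n)` for some `n ≥ 2`, the quotient by the scalar matrices of the Lie
superalgebra of the matrices with blocks `a, b; b, a` of size `n + 1` and `tr b = 0`. -/
def IsTypeQ (g : Type u) [AddCommGroup g] [Module k g] [LieSuperalgebra k g] : Prop :=
  ∃ n : ℕ, 2 ≤ n ∧ ∃ ψ : sqMat k (n + 1) →ₗ[k] g,
    Function.Surjective ψ ∧
    (∀ X, ψ X = 0 ↔ ∃ c : k, sqBlocks X = c • 1) ∧
    (∀ i X, sqBlocks X ∈ matGr k (n + 1) i → ψ X ∈ gr k g i) ∧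
    ∀ i j X Y Z, sqBlocks X ∈ matGr k (n + 1) i → sqBlocks Y ∈ matGr k (n + 1) j →
      sqBlocks Z = sqBlocks X * sqBlocks Y - sgn k i j • (sqBlocks Y * sqBlocks X) →
      ψ Z = br k g (ψ X) (ψ Y)

/-! #### Lie superalgebras of Cartan type -/

variable (k) (n : ℕ)

/-- The exterior algebra on the generators `ξ_1, …, ξ_n`. -/
abbrev Ext : Type u := ExteriorAlgebra k (Fin n → k)

/-- The generators `ξ_i`. -/
noncomputable def ξ (i : Fin n) : Ext k n := ExteriorAlgebra.ι k (Pi.single i 1)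

/-- The product `ξ_1 ⋯ ξ_n`. -/
noncomputable def ξTop : Ext k n := (List.ofFn (ξ k n)).prod

/-- The `ℤ/2`-grading of the exterior algebra. -/
noncomputable def extGrading : Z2Grading k (Ext k n) where
  gr := CliffordAlgebra.evenOdd (0 : QuadraticForm k (Fin n → k))
  isCompl := CliffordAlgebra.evenOdd_isCompl _

/-- The superderivation `∂_i`, with `∂_i ξ_j = δ_ij`. -/
noncomputable def pd (i : Fin n) : Module.End k (Ext k n) :=
  CliffordAlgebra.contractLeft (Q := (0 : QuadraticForm k (Fin n → k))) (LinearMap.proj i)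

/-- The space `W(n)` of superderivations of the exterior algebra. -/
noncomputable def cartanW : Submodule k (Module.End k (Ext k n)) :=
  Submodule.span k {D | ∃ i, D ∈ endGr (extGrading k n) i ∧
    ∀ j, ∀ x ∈ (extGrading k n).gr j, ∀ y, D (x * y) = D x * y + sgn k i j • (x * D y)}

/-- The divergence `∑ ∂_i (D ξ_i)`. -/
noncomputable def divergence : Module.End k (Ext k n) →ₗ[k] Ext k n :=
  ∑ i, pd k n i ∘ₗ LinearMap.applyₗ (ξ k n i)

/-- `S(n)`: the superderivations of divergence zero. -/
noncomputable def cartanS : Submodule k (Module.End k (Ext k n)) :=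
  cartanW k n ⊓ LinearMap.ker (divergence k n)

/-- `S̃(n)`: the superderivations `D` with `(1 + ξ_1 ⋯ ξ_n) div(D) + D(ξ_1 ⋯ ξ_n) = 0`. -/
noncomputable def cartanSTilde : Submodule k (Module.End k (Ext k n)) :=
  cartanW k n ⊓ LinearMap.ker (LinearMap.mulLeft k (1 + ξTop k n) ∘ₗ divergence k n +
    LinearMap.applyₗ (ξTop k n))

/-- The superderivation `D_x = ∑ ∂_i(x) ∂_i`. -/
noncomputable def hamiltonian (x : Ext k n) : Module.End k (Ext k n) :=
  ∑ i, LinearMap.mulLeft k (pd k n i x) ∘ₗ pd k n i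

/-- The span `H̃(n)` of the superderivations `D_x`. -/
noncomputable def cartanHTilde : Submodule k (Module.End k (Ext k n)) :=
  Submodule.span k (Set.range (hamiltonian k n))

/-- `H(n) = [H̃(n), H̃(n)]`. -/
noncomputable def cartanH : Submodule k (Module.End k (Ext k n)) :=
  Submodule.span k {F | ∃ i j, ∃ D ∈ cartanHTilde k n ⊓ endGr (extGrading k n) i,
    ∃ E ∈ cartanHTilde k n ⊓ endGr (extGrading k n) j, F = D * E - sgn k i j • (E * D)}

/-- The Lie superalgebras `W(n)`, `S(n)`, `S̃(n)` and `H(n)` of Cartan type. -/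
def IsCartanFamily (L : Submodule k (Module.End k (Ext k n))) : Prop :=
  (2 ≤ n ∧ L = cartanW k n) ∨ (3 ≤ n ∧ L = cartanS k n) ∨
    (4 ≤ n ∧ Even n ∧ L = cartanSTilde k n) ∨ (4 ≤ n ∧ L = cartanH k n)

variable {k} {g : Type u} [CharZero k] [AddCommGroup g] [Module k g] [LieSuperalgebra k g]

/-- `g` is of Cartan type, and `r` is its component `g_0`, which consists of the elements of degree
zero for the `ℤ`-grading of the exterior algebra. -/
def IsCartanTypeWith (r : LieSubalgebra k (EvenPart k g)) : Prop :=
  ∃ (n : ℕ) (L : Submodule k (Module.End k (Ext k n))), IsCartanFamily k n L ∧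
    ∃ φ : g →ₗ[k] Module.End k (Ext k n),
      IsSuperEmbedding (endGr (extGrading k n)) φ ∧ LinearMap.range φ = L ∧
      ∀ x : EvenPart k g, x ∈ r ↔ ∀ i, φ (EvenPart.incl k g x) (ξ k n i) ∈ ⋀[k]^1 (Fin n → k)

/-- `g` is either `sl(n, n)` with `n ≥ 2`, or a finite-dimensional simple Lie superalgebra which is
not of type `q(n)`, and `r` is its reductive part: the component `g_0` if `g` is of Cartan type, and
the even part of `g` otherwise.  Finite-dimensional simple Lie superalgebras are either classical or
of Cartan type. -/
def IsReductivePart (r : LieSubalgebra k (EvenPart k g)) : Prop :=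
  (IsSpecialLinear k g ∧ r = ⊤) ∨
    (FiniteDimensional k g ∧ IsSimple k g ∧ OddPartCompletelyReducible k g ∧ ¬ IsTypeQ k g ∧
      r = ⊤) ∨
    IsCartanTypeWith r

end Types

/-! ### Triangular decompositions -/

section Roots

variable {k g : Type u} [Field k] [CharZero k] [AddCommGroup g] [Module k g] [LieSuperalgebra k g]
  {r : LieSubalgebra k (EvenPart k g)} (h : LieSubalgebra k r)

/-- The inclusion of `h` in `g`. -/
def inclCartan : h →ₗ[k] g :=
  EvenPart.incl k g ∘ₗ r.toSubmodule.subtype ∘ₗ h.toSubmodule.subtype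

/-- The space `g_α` of all `x` with `[y, x] = α(y) x` for all `y ∈ h`. -/
def rootSpace (α : Module.Dual k h) : Submodule k g where
  carrier := {x | ∀ y : h, br k g (inclCartan h y) x = α y • x}
  add_mem' hx hx' y := by rw [map_add, hx y, hx' y, smul_add]
  zero_mem' y := by simp
  smul_mem' c x hx y := by rw [map_smul, hx y, smul_comm]

/-- The set of roots of `g`. -/
def roots : Set (Module.Dual k h) := {α | α ≠ 0 ∧ rootSpace h α ≠ ⊥}

end Roots

/-- A triangular decomposition of `g`: a Cartan subalgebra `h` of the subalgebra `r` of the even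
part, with its root space decomposition `g = h ⊕ ⨁ g_α`, and a set of positive roots. -/
structure TriangularDecomposition (k g : Type u) [Field k] [CharZero k] [AddCommGroup g]
    [Module k g] [LieSuperalgebra k g] where
  /-- the subalgebra `r` -/
  r : LieSubalgebra k (EvenPart k g)
  /-- the Cartan subalgebra -/
  h : LieSubalgebra k r
  isCartanSubalgebra : h.IsCartanSubalgebra
  rootSpace_zero : rootSpace h 0 = LinearMap.range (inclCartan h)
  iSup_rootSpace : ⨆ α, rootSpace h α = ⊤
  /-- the set of positive roots -/
  pos : Set (Module.Dual k h)
  /-- the positive roots are those on which some regular real-valued functional is positive -/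
  exists_regular : ∃ f : Module.Dual k h →+ ℝ,
    (∀ α ∈ roots h, f α ≠ 0) ∧ pos = {α ∈ roots h | 0 < f α}

namespace TriangularDecomposition

variable {k g : Type u} [Field k] [CharZero k] [AddCommGroup g] [Module k g] [LieSuperalgebra k g]
  (T : TriangularDecomposition k g)

/-- The inclusion of `r` in `g`. -/
def inclR : T.r →ₗ[k] g := EvenPart.incl k g ∘ₗ T.r.toSubmodule.subtype

/-- The inclusion of `h` in `g`. -/
def inclH : T.h →ₗ[k] g := inclCartan T.h

/-- The subspace `n⁺`, the sum of the root spaces of the positive roots. -/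
def nPlus : Submodule k g := ⨆ α ∈ T.pos, rootSpace T.h α

/-- The subspace `n⁻`, the sum of the root spaces of the negative roots. -/
def nMinus : Submodule k g := ⨆ α ∈ roots T.h \ T.pos, rootSpace T.h α

/-- The condition that the even part of `n⁻` is contained in `r`. -/
def C1 : Prop := T.nMinus ⊓ gr k g 0 ≤ LinearMap.range T.inclR

/-- The partial order on weights: `μ ≤ lam` if `lam - μ` is a sum of positive roots. -/
def le (μ lam : Module.Dual k T.h) : Prop := lam - μ ∈ AddSubmonoid.closure T.pos

/-- The positive roots of `r`. -/
def posR : Set (Module.Dual k T.h) :=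
  {α ∈ T.pos | rootSpace T.h α ⊓ LinearMap.range T.inclR ≠ ⊥}

/-- The simple roots of `r`: the positive roots which are not the sum of two positive roots. -/
def simpleR : Set (Module.Dual k T.h) :=
  {α ∈ T.posR | ¬ ∃ β ∈ T.posR, ∃ γ ∈ T.posR, α = β + γ}

/-- The dominant weights, that is, the weights `lam` such that there is a finite-dimensional
irreducible module with a highest-weight vector of weight `lam`. -/
def dominantWeights : Set (Module.Dual k T.h) :=
  {lam | ∃ L : SuperMod k (U k g), L.IsFinDimIrreducible ∧ ∃ v : L, v ≠ 0 ∧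
    (∀ x ∈ T.nPlus, U.ι k x • v = 0) ∧ ∀ y : T.h, U.ι k (T.inclH y) • v = lam y • v}

/-! ### Generalized Kac modules -/

/-- The generators of the left ideal defining the generalized Kac module: `n⁺`, `y - lam(y)` for
`y ∈ h`, and `(x_α⁻)^(lam(h_α) + 1)` for the simple roots `α` of `r`, where `x_α`, `x_α⁻`, `h_α` is
an `sl(2)`-triple with `x_α ∈ r_α` and `x_α⁻ ∈ r_{-α}`. -/
def kacRelations (lam : Module.Dual k T.h) : Set (U k g) :=
  {u | ∃ x ∈ T.nPlus, u = U.ι k x} ∪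
  {u | ∃ y : T.h, u = U.ι k (T.inclH y) - algebraMap k (U k g) (lam y)} ∪
  {u | ∃ α ∈ T.simpleR, ∃ (e f : T.r) (y : T.h) (N : ℕ), T.inclR e ∈ rootSpace T.h α ∧
    T.inclR f ∈ rootSpace T.h (-α) ∧ IsSl2Triple (y : T.r) e f ∧ lam y = N ∧
    u = U.ι k (T.inclR f) ^ (N + 1)}

theorem par_br_of_even {x y : g} (hx : x ∈ gr k g 0) :
    par k (br k g x y) = br k g x (par k y) := by
  have key : ∀ {j : ZMod 2} {y : g}, y ∈ gr k g j →
      par k (br k g x y) = br k g x (par k y) := by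
    intro j y hy
    have h := LieSuperalgebra.br_mem (k := k) hx hy
    rw [zero_add] at h
    rw [show par k y = sgn k j 1 • y from Z2Grading.parity_of_mem _ hy, map_smul]
    exact Z2Grading.parity_of_mem _ h
  obtain ⟨a, ha, b, hb, rfl⟩ := (LieSuperalgebra.grading (k := k) (g := g)).exists_add y
  simp only [map_add]
  rw [key ha, key hb]

theorem inclH_mem (y : T.h) : T.inclH y ∈ gr k g 0 := EvenPart.incl_mem k g _

theorem inclR_mem (y : T.r) : T.inclR y ∈ gr k g 0 := EvenPart.incl_mem k g _

theorem par_of_even {x : g} (hx : x ∈ gr k g 0) : par k x = x := by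
  rw [show par k x = sgn k 0 1 • x from Z2Grading.parity_of_mem _ hx, sgn_zero_one, one_smul]

theorem par_mem_nPlus {x : g} (hx : x ∈ T.nPlus) : par k x ∈ T.nPlus := by
  suffices h : T.nPlus ≤ T.nPlus.comap (par k) from h hx
  refine iSup₂_le fun α hα y hy => ?_
  refine Submodule.mem_iSup_of_mem α (Submodule.mem_iSup_of_mem hα fun z => ?_)
  have h := par_br_of_even (y := y) (T.inclH_mem z)
  rw [show br k g (T.inclH z) y = α z • y from hy z, map_smul] at h
  exact h.symm

theorem parity_mem_kacIdeal (lam : Module.Dual k T.h) :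
    ∀ m ∈ Submodule.span (U k g) (T.kacRelations lam),
      (SuperMod.regular k (U k g)).grading.parity m ∈
        Submodule.span (U k g) (T.kacRelations lam) := by
  refine SuperMod.parity_mem_span (SuperMod.regular k (U k g)) _ fun m hm => ?_
  rw [show (SuperMod.regular k (U k g)).grading.parity m = U.σ k g m from U.parity_eq_σ m]
  refine Submodule.subset_span ?_
  rcases hm with (⟨x, hx, rfl⟩ | ⟨y, rfl⟩) | ⟨α, hα, e, f, y, N, he, hf, ht, hN, rfl⟩
  · exact Or.inl (Or.inl ⟨par k x, T.par_mem_nPlus hx, U.σ_ι x⟩)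
  · refine Or.inl (Or.inr ⟨y, ?_⟩)
    rw [map_sub, U.σ_ι, par_of_even (T.inclH_mem y), AlgHom.commutes]
  · refine Or.inr ⟨α, hα, e, f, y, N, he, hf, ht, hN, ?_⟩
    rw [map_pow, U.σ_ι, par_of_even (T.inclR_mem f)]

/-- The generalized Kac module `K(lam)`. -/
noncomputable def kac (lam : Module.Dual k T.h) : SuperMod k (U k g) :=
  (SuperMod.regular k (U k g)).quot (Submodule.span (U k g) (T.kacRelations lam))
    (T.parity_mem_kacIdeal lam)

end TriangularDecomposition

/-! ### Induced modules -/

section Induction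

variable {k B : Type u} [Field k] [CharZero k] [Ring B] [Algebra k B] [Superalgebra k B]
  {V : Type u} [AddCommGroup V] [Module k V]

variable (B) in
/-- The parity operator of `B ⊗ V`. -/
noncomputable def freeParity (G : Z2Grading k V) : B ⊗[k] V →ₗ[k] B ⊗[k] V :=
  TensorProduct.map (Superalgebra.grading (k := k) (B := B)).parity G.parity

theorem freeParity_smul (G : Z2Grading k V) (b : B) (t : B ⊗[k] V) :
    freeParity B G (b • t) =
      (Superalgebra.grading (k := k) (B := B)).parity b • freeParity B G t := by
  induction t with
  | zero => simp
  | add s t hs ht => simp only [smul_add, map_add, hs, ht]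
  | tmul c v =>
    have h := (SuperMod.regular k B).parity_smul b c
    simp only [freeParity, TensorProduct.smul_tmul', TensorProduct.map_tmul, smul_eq_mul] at h ⊢
    exact congrArg (· ⊗ₜ[k] G.parity v) h

theorem freeParity_freeParity (G : Z2Grading k V) (t : B ⊗[k] V) :
    freeParity B G (freeParity B G t) = t := by
  induction t with
  | zero => simp
  | add s t hs ht => simp only [map_add, hs, ht]
  | tmul c v => simp [freeParity, Z2Grading.parity_parity]

variable (B) in
/-- The graded `B`-module `B ⊗ V`, with `(B ⊗ V)_i` the sum of the `B_a ⊗ V_b` with `a + b = i`. -/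
noncomputable def freeModule (G : Z2Grading k V) : SuperMod k B where
  carrier := B ⊗[k] V
  grading := Z2Grading.ofInvolution (freeParity B G) (freeParity_freeParity G)
  smul_mem := by
    intro i j b m hb hm
    rw [Z2Grading.mem_ofInvolution] at hm ⊢
    rw [freeParity_smul, Z2Grading.parity_of_mem _ hb, hm, smul_assoc, smul_algebra_smul_comm,
      smul_smul, sgn_add]

theorem tmul_mem_freeModule (G : Z2Grading k V) {i j : ZMod 2} {b : B} {v : V}
    (hb : b ∈ (Superalgebra.grading (k := k) (B := B)).gr i) (hv : v ∈ G.gr j) :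
    b ⊗ₜ[k] v ∈ (freeModule B G).grading.gr (i + j) :=
  (Z2Grading.mem_ofInvolution (freeParity B G) (freeParity_freeParity G)).2 (by
    rw [freeParity, TensorProduct.map_tmul, Z2Grading.parity_of_mem _ hb, G.parity_of_mem hv,
      TensorProduct.smul_tmul_smul, sgn_add])

theorem freeModule_parity (G : Z2Grading k V) (t : B ⊗[k] V) :
    (freeModule B G).grading.parity t = freeParity B G t := by
  obtain ⟨a, ha, b, hb, rfl⟩ := (freeModule B G).grading.exists_add t
  have ha' := (Z2Grading.mem_ofInvolution _ (freeParity_freeParity G)).1 ha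
  have hb' := (Z2Grading.mem_ofInvolution _ (freeParity_freeParity G)).1 hb
  rw [map_add, Z2Grading.parity_of_mem _ ha, Z2Grading.parity_of_mem _ hb]
  rw [← ha', ← hb']
  exact (map_add _ _ _).symm

variable (k) (g A : Type u) [AddCommGroup g] [Module k g] [LieSuperalgebra k g]
  [CommRing A] [Algebra k A]

theorem σ_UIncl (u : U k g) : U.σ k (g ⊗[k] A) (UIncl k g A u) = UIncl k g A (U.σ k g u) := by
  have : (U.σ k (g ⊗[k] A)).comp (UIncl k g A) = (UIncl k g A).comp (U.σ k g) :=
    U.algHom_ext fun x => by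
      simp only [AlgHom.comp_apply, UIncl_ι, U.σ_ι, mapPar_tmul]
  exact congrArg (fun f => f u) this

variable {k g}

/-- The elements `u s ⊗ v - u ⊗ s v` of `U(g ⊗ A) ⊗ V`. -/
def balancing (V : SuperMod k (U k g)) : Set (U k (g ⊗[k] A) ⊗[k] V) :=
  {t | ∃ (u : U k (g ⊗[k] A)) (s : U k g) (v : V),
    t = (u * UIncl k g A s) ⊗ₜ[k] v - u ⊗ₜ[k] (s • v)}

theorem parity_mem_balancing (V : SuperMod k (U k g)) :
    ∀ m ∈ Submodule.span (U k (g ⊗[k] A)) (balancing A V),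
      (freeModule (U k (g ⊗[k] A)) V.grading).grading.parity m ∈
        Submodule.span (U k (g ⊗[k] A)) (balancing A V) := by
  refine SuperMod.parity_mem_span (freeModule (U k (g ⊗[k] A)) V.grading) _ ?_
  rintro _ ⟨u, s, v, rfl⟩
  rw [freeModule_parity]
  refine Submodule.subset_span ⟨U.σ k (g ⊗[k] A) u, U.σ k g s, V.grading.parity v, ?_⟩
  rw [map_sub]
  simp only [freeParity, TensorProduct.map_tmul]
  rw [U.parity_eq_σ, U.parity_eq_σ, map_mul, σ_UIncl, V.parity_smul, U.parity_eq_σ]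

/-- The induced module `P_A(V) = U(g ⊗ A) ⊗_{U(g)} V`. -/
noncomputable def induced (V : SuperMod k (U k g)) : SuperMod k (U k (g ⊗[k] A)) :=
  (freeModule (U k (g ⊗[k] A)) V.grading).quot
    (Submodule.span (U k (g ⊗[k] A)) (balancing A V)) (parity_mem_balancing A V)

end Induction

namespace TriangularDecomposition

variable {k g : Type u} [Field k] [CharZero k] [AddCommGroup g] [Module k g] [LieSuperalgebra k g]
  (T : TriangularDecomposition k g) {A : Type u} [CommRing A] [Algebra k A]

/-! ### Weight spaces and the categories `C_A` and `C_A^lam` -/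

/-- The weight space `M_μ` of a `g ⊗ A`-module. -/
noncomputable def weightSpace (M : SuperMod k (U k (g ⊗[k] A))) (μ : Module.Dual k T.h) : Submodule k M where
  carrier := {m | ∀ y : T.h, U.ι k (T.inclH y ⊗ₜ[k] (1 : A)) • m = μ y • m}
  add_mem' hx hx' y := by rw [smul_add, hx y, hx' y, smul_add]
  zero_mem' y := by simp
  smul_mem' c x hx y := by rw [smul_algebra_smul_comm, hx y, smul_comm]

/-- `M` is finitely semisimple as an `r`-module: it is the sum of its finite-dimensional irreducible
`r`-submodules.  As `r` is even, the homogeneous components of a module are `r`-submodules and it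
makes no difference whether the irreducible submodules are required to be graded. -/
def IsFinitelySemisimple (M : SuperMod k (U k (g ⊗[k] A))) : Prop :=
  sSup {N : Submodule k M | FiniteDimensional k N ∧ N ≠ ⊥ ∧
    (∀ x : T.r, ∀ m ∈ N, U.ι k (T.inclR x ⊗ₜ[k] (1 : A)) • m ∈ N) ∧
    ∀ N' ≤ N, (∀ x : T.r, ∀ m ∈ N', U.ι k (T.inclR x ⊗ₜ[k] (1 : A)) • m ∈ N') →
      N' = ⊥ ∨ N' = N} = ⊤

/-- The sum of the submodules `U(g ⊗ A) M_μ` over all `μ` with `μ ≰ lam`. -/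
noncomputable def upperPart (lam : Module.Dual k T.h) (M : SuperMod k (U k (g ⊗[k] A))) :
    Submodule (U k (g ⊗[k] A)) M :=
  Submodule.span (U k (g ⊗[k] A)) {m | ∃ μ, ¬ T.le μ lam ∧ m ∈ T.weightSpace M μ}

variable {T} in
theorem parity_mem_weightSpace {M : SuperMod k (U k (g ⊗[k] A))} {μ : Module.Dual k T.h} {m : M}
    (hm : m ∈ T.weightSpace M μ) : M.grading.parity m ∈ T.weightSpace M μ := by
  intro y
  have h := congrArg M.grading.parity (hm y)
  rwa [M.parity_smul, U.parity_eq_σ, U.σ_ι, mapPar_tmul, par_of_even (T.inclH_mem y),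
    map_smul] at h

theorem parity_mem_upperPart (lam : Module.Dual k T.h) (M : SuperMod k (U k (g ⊗[k] A))) :
    ∀ m ∈ T.upperPart lam M, M.grading.parity m ∈ T.upperPart lam M := by
  refine SuperMod.parity_mem_span M _ ?_
  rintro m ⟨μ, hμ, hm⟩
  exact Submodule.subset_span ⟨μ, hμ, parity_mem_weightSpace hm⟩

/-- The quotient `M^lam` of `M`. -/
noncomputable def truncation (lam : Module.Dual k T.h) (M : SuperMod k (U k (g ⊗[k] A))) :
    SuperMod k (U k (g ⊗[k] A)) :=
  M.quot (T.upperPart lam M) (T.parity_mem_upperPart lam M)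

variable (A) in
/-- The objects of the category `C_A^lam`: the graded `g ⊗ A`-modules `M` which are finitely
semisimple as `r`-modules and satisfy `M^lam = M`. -/
def catC (lam : Module.Dual k T.h) : ObjectProperty (SuperMod k (U k (g ⊗[k] A))) :=
  fun M => T.IsFinitelySemisimple M ∧ T.upperPart lam M = ⊥

/-! ### Global Weyl modules -/

variable (A) (lam : Module.Dual k T.h)

/-- The global Weyl module `W_A(lam) = P_A(K(lam))^lam`. -/
noncomputable def weyl : SuperMod k (U k (g ⊗[k] A)) := T.truncation lam (induced A (T.kac lam))

/-- The generator `w_lam` of the global Weyl module. -/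
noncomputable def weylGen : T.weyl A lam :=
  Submodule.Quotient.mk (p := T.upperPart lam (induced A (T.kac lam)))
    (Submodule.Quotient.mk
      (p := Submodule.span (U k (g ⊗[k] A)) (balancing A (T.kac lam)))
      ((1 : U k (g ⊗[k] A)) ⊗ₜ[k]
        Submodule.Quotient.mk (p := Submodule.span (U k g) (T.kacRelations lam)) (1 : U k g)))

theorem weyl_generated (m : T.weyl A lam) : ∃ u : U k (g ⊗[k] A), u • T.weylGen A lam = m := by
  obtain ⟨p, rfl⟩ := Submodule.Quotient.mk_surjective _ m
  obtain ⟨t, rfl⟩ := Submodule.Quotient.mk_surjective _ p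
  change U k (g ⊗[k] A) ⊗[k] (T.kac lam) at t
  induction t with
  | zero => exact ⟨0, by rw [zero_smul]; rfl⟩
  | add s t hs ht =>
    obtain ⟨a, ha⟩ := hs
    obtain ⟨b, hb⟩ := ht
    exact ⟨a + b, by rw [add_smul, ha, hb]; rfl⟩
  | tmul u v =>
    obtain ⟨s, rfl⟩ := Submodule.Quotient.mk_surjective _ v
    change U k g at s
    refine ⟨u * UIncl k g A s, ?_⟩
    refine congrArg (Submodule.Quotient.mk (p := T.upperPart lam (induced A (T.kac lam)))) ?_
    refine (Submodule.Quotient.eq _).2 (Submodule.subset_span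
      ⟨u, s, Submodule.Quotient.mk (p := Submodule.span (U k g) (T.kacRelations lam)) (1 : U k g),
        ?_⟩)
    let x : T.kac lam :=
      Submodule.Quotient.mk (p := Submodule.span (U k g) (T.kacRelations lam)) (1 : U k g)
    have h1 : (u * UIncl k g A s) • ((1 : U k (g ⊗[k] A)) ⊗ₜ[k] x) =
        (u * UIncl k g A s) ⊗ₜ[k] x := by
      rw [TensorProduct.smul_tmul', smul_eq_mul, mul_one]
    let y : T.kac lam := Submodule.Quotient.mk (p := Submodule.span (U k g) (T.kacRelations lam)) s
    have h2 : s • x = y :=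
      congrArg (Submodule.Quotient.mk (p := Submodule.span (U k g) (T.kacRelations lam)))
        (mul_one (M := U k g) s)
    exact congrArg₂ (· - ·) h1 (congrArg (u ⊗ₜ[k] ·) h2.symm)

end TriangularDecomposition

namespace TriangularDecomposition

variable {k g : Type u} [Field k] [CharZero k] [AddCommGroup g] [Module k g] [LieSuperalgebra k g]
  (T : TriangularDecomposition k g) (A : Type u) [CommRing A] [Algebra k A]

/-! ### The algebra `A_lam` -/

/-- The subalgebra `U(h ⊗ A)` of `U(g ⊗ A)`. -/
noncomputable def cartanAlg : Subalgebra k (U k (g ⊗[k] A)) :=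
  Algebra.adjoin k {u | ∃ (y : T.h) (a : A), u = U.ι k (T.inclH y ⊗ₜ[k] a)}

theorem br_inclH (y z : T.h) : br k g (T.inclH y) (T.inclH z) = 0 := by
  have h : T.inclH z ∈ rootSpace T.h 0 := by
    rw [T.rootSpace_zero]; exact ⟨z, rfl⟩
  have := h y
  rwa [LinearMap.zero_apply, zero_smul] at this

open scoped IsMulCommutative

instance : IsMulCommutative (T.cartanAlg A) := by
  apply Algebra.isMulCommutative_adjoin
  rintro _ ⟨y, a, rfl⟩ _ ⟨z, b, rfl⟩
  have h := U.ι_mul_ι (k := k) (tmul_mem_mapGr (A := A) (T.inclH_mem y) a)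
    (tmul_mem_mapGr (A := A) (T.inclH_mem z) b)
  rw [show br k (g ⊗[k] A) (T.inclH y ⊗ₜ a) (T.inclH z ⊗ₜ b) = 0 from
    (mapBr_tmul k g A _ _ a b).trans (by rw [br_inclH, TensorProduct.zero_tmul]), map_zero,
    add_zero, show sgn k 0 0 = 1 by simp [sgn], one_smul] at h
  exact h

theorem σ_cartanAlg (s : T.cartanAlg A) : U.σ k (g ⊗[k] A) s = s := by
  obtain ⟨s, hs⟩ := s
  change U.σ k (g ⊗[k] A) s = s
  induction hs using Algebra.adjoin_induction with
  | mem x hx =>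
    obtain ⟨y, a, rfl⟩ := hx
    rw [U.σ_ι, mapPar_tmul, par_of_even (T.inclH_mem y)]
  | algebraMap c => exact AlgHom.commutes _ c
  | add x y _ _ hx hy => rw [map_add, hx, hy]
  | mul x y _ _ hx hy => rw [map_mul, hx, hy]

variable (lam : Module.Dual k T.h)

/-- The annihilator of `w_lam` in `U(h ⊗ A)`. -/
noncomputable def annIdeal : Ideal (T.cartanAlg A) where
  carrier := {s | (s : U k (g ⊗[k] A)) • T.weylGen A lam = 0}
  add_mem' hs ht := by
    rw [Set.mem_ofPred_eq] at hs ht ⊢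
    rw [AddMemClass.coe_add, add_smul, hs, ht, add_zero]
  zero_mem' := by rw [Set.mem_ofPred_eq, ZeroMemClass.coe_zero, zero_smul]
  smul_mem' c s hs := by
    rw [Set.mem_ofPred_eq] at hs ⊢
    rw [smul_eq_mul, MulMemClass.coe_mul, mul_smul, hs, smul_zero]

/-- The algebra `A_lam`, the quotient of `U(h ⊗ A)` by the annihilator of `w_lam`. -/
def Alam : Type u := T.cartanAlg A ⧸ T.annIdeal A lam

noncomputable instance : CommRing (T.Alam A lam) :=
  inferInstanceAs (CommRing (T.cartanAlg A ⧸ T.annIdeal A lam))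

noncomputable instance : Algebra k (T.Alam A lam) :=
  inferInstanceAs (Algebra k (T.cartanAlg A ⧸ T.annIdeal A lam))

/-- The projection of `U(h ⊗ A)` onto `A_lam`. -/
noncomputable def AlamMk : T.cartanAlg A →ₐ[k] T.Alam A lam :=
  Ideal.Quotient.mkₐ k (T.annIdeal A lam)

theorem AlamMk_surjective : Function.Surjective (T.AlamMk A lam) := Ideal.Quotient.mk_surjective

/-- `A_lam` is purely even, so a graded `A_lam`-module is an `A_lam`-module with a decomposition
into an even and an odd submodule. -/
noncomputable instance : Superalgebra k (T.Alam A lam) where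
  grading :=
    { gr := fun i => if i = 0 then ⊤ else ⊥
      isCompl := by simpa using isCompl_top_bot }
  one_mem := by simp
  mul_mem := by
    intro i j a b ha hb
    rcases zmod_two_cases i with rfl | rfl <;> rcases zmod_two_cases j with rfl | rfl <;>
      simp_all

theorem parity_Alam (b : T.Alam A lam) :
    (Superalgebra.grading (k := k) (B := T.Alam A lam)).parity b = b := by
  rw [Z2Grading.parity_of_mem (i := 0) _ (by simp [Superalgebra.grading]), sgn_zero_one, one_smul]

/-! ### The weight space functor -/

/-- The annihilator of `w_lam` acts trivially on the weight spaces of weight `lam` of the objects of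
`C_A^lam`, so that these are modules over `A_lam`. -/
def AnnActsTrivially : Prop :=
  ∀ M, T.catC A lam M → ∀ s ∈ T.annIdeal A lam, ∀ v ∈ T.weightSpace M lam,
    (s : U k (g ⊗[k] A)) • v = 0

variable {T A lam} in
theorem cartanAlg_smul_mem (M : SuperMod k (U k (g ⊗[k] A))) (s : T.cartanAlg A) {v : M}
    (hv : v ∈ T.weightSpace M lam) : (s : U k (g ⊗[k] A)) • v ∈ T.weightSpace M lam := by
  intro y
  let t : T.cartanAlg A := ⟨U.ι k (T.inclH y ⊗ₜ[k] (1 : A)), Algebra.subset_adjoin ⟨y, 1, rfl⟩⟩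
  have h : (t : U k (g ⊗[k] A)) * s = s * t := congrArg Subtype.val (mul_comm t s)
  change (t : U k (g ⊗[k] A)) • _ = _
  rw [← mul_smul, h, mul_smul, show (t : U k (g ⊗[k] A)) • v = lam y • v from hv y,
    smul_algebra_smul_comm]

/-- The action of `U(h ⊗ A)` on the weight space `M_lam`. -/
noncomputable def actCartan (M : SuperMod k (U k (g ⊗[k] A))) :
    T.cartanAlg A →ₐ[k] Module.End k (T.weightSpace M lam) where
  toFun s := (Algebra.lsmul k k M (s : U k (g ⊗[k] A))).restrict
    fun _ hv => cartanAlg_smul_mem M s hv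
  map_one' := LinearMap.ext fun v => Subtype.ext (one_smul _ v.1)
  map_mul' s t := LinearMap.ext fun v =>
    Subtype.ext (mul_smul (s : U k (g ⊗[k] A)) (t : U k (g ⊗[k] A)) v.1)
  map_zero' := LinearMap.ext fun v => Subtype.ext (zero_smul _ v.1)
  map_add' s t := LinearMap.ext fun v =>
    Subtype.ext (add_smul (s : U k (g ⊗[k] A)) (t : U k (g ⊗[k] A)) v.1)
  commutes' c := LinearMap.ext fun v => Subtype.ext (algebraMap_smul _ c v.1)

variable {T A lam}

/-- The action of `A_lam` on the weight space `M_lam` of an object `M` of `C_A^lam`. -/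
noncomputable def actAlam (hA : T.AnnActsTrivially A lam) (M : (T.catC A lam).FullSubcategory) :
    T.Alam A lam →ₐ[k] Module.End k (T.weightSpace M.obj lam) :=
  Ideal.Quotient.liftₐ (T.annIdeal A lam) (T.actCartan A lam M.obj) fun s hs => by
    ext v
    exact hA M.obj M.property s hs v v.2

/-- The grading of the weight space `M_lam`. -/
noncomputable def weightGrading (M : SuperMod k (U k (g ⊗[k] A))) :
    Z2Grading k (T.weightSpace M lam) where
  gr := fun i => (M.grading.gr i).comap (T.weightSpace M lam).subtype
  isCompl := by
    constructor
    · rw [Submodule.disjoint_def]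
      intro v h0 h1
      exact Subtype.ext (Submodule.disjoint_def.1 M.grading.isCompl.disjoint v h0 h1)
    · rw [codisjoint_iff, eq_top_iff]
      rintro ⟨v, hv⟩ _
      obtain ⟨a, ha, b, hb, rfl⟩ := M.grading.exists_add v
      have h2 : (2 : k) ≠ 0 := two_ne_zero
      have hp := parity_mem_weightSpace hv
      rw [map_add, M.grading.parity_of_mem ha, M.grading.parity_of_mem hb,
        sgn_zero_one, sgn_one_one, one_smul, neg_smul, one_smul] at hp
      have ha' : a ∈ T.weightSpace M lam := by
        have h := Submodule.smul_mem _ (2 : k)⁻¹ (Submodule.add_mem _ hv hp)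
        rwa [show a + b + (a + -b) = (2 : k) • a by rw [two_smul]; abel, smul_smul,
          inv_mul_cancel₀ h2, one_smul] at h
      have hb' : b ∈ T.weightSpace M lam := by
        have h := Submodule.sub_mem _ hv ha'
        rwa [add_sub_cancel_left] at h
      exact Submodule.mem_sup.2 ⟨⟨a, ha'⟩, ha, ⟨b, hb'⟩, hb, rfl⟩

/-- The weight space `M_lam`, as an `A_lam`-module. -/
def WeightCarrier (_hA : T.AnnActsTrivially A lam) (M : (T.catC A lam).FullSubcategory) : Type u :=
  T.weightSpace M.obj lam

section

variable (hA : T.AnnActsTrivially A lam) (M : (T.catC A lam).FullSubcategory)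

noncomputable instance : AddCommGroup (WeightCarrier hA M) :=
  inferInstanceAs (AddCommGroup (T.weightSpace M.obj lam))

noncomputable instance : Module k (WeightCarrier hA M) :=
  inferInstanceAs (Module k (T.weightSpace M.obj lam))

noncomputable instance : Module (T.Alam A lam) (WeightCarrier hA M) :=
  letI : Module (Module.End k (T.weightSpace M.obj lam)) (WeightCarrier hA M) :=
    inferInstanceAs (Module (Module.End k (T.weightSpace M.obj lam)) (T.weightSpace M.obj lam))
  Module.compHom _ (actAlam hA M).toRingHom

theorem weightCarrier_smul_def (a : T.Alam A lam) (v : WeightCarrier hA M) :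
    a • v = actAlam hA M a v := rfl

/-- The class of `s` acts on `M_lam` as `s` does. -/
theorem mk_smul_weightCarrier (s : T.cartanAlg A) (v : WeightCarrier hA M) :
    (T.weightSpace M.obj lam).subtype (T.AlamMk A lam s • v) =
      (s : U k (g ⊗[k] A)) • (T.weightSpace M.obj lam).subtype v := rfl

instance : IsScalarTower k (T.Alam A lam) (WeightCarrier hA M) :=
  ⟨fun c a v => by
    rw [weightCarrier_smul_def, weightCarrier_smul_def, map_smul]
    rfl⟩

/-- The grading of the `A_lam`-module `M_lam`. -/
noncomputable def weightCarrierGrading : Z2Grading k (WeightCarrier hA M) := weightGrading M.obj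

theorem mem_weightCarrierGrading {i : ZMod 2} {v : WeightCarrier hA M} :
    v ∈ (weightCarrierGrading hA M).gr i ↔
      (T.weightSpace M.obj lam).subtype v ∈ M.obj.grading.gr i := Iff.rfl

/-- The graded `A_lam`-module `M_lam`. -/
noncomputable def weightModule : SuperMod k (T.Alam A lam) where
  carrier := WeightCarrier hA M
  grading := weightCarrierGrading hA M
  smul_mem := by
    intro i j a v ha hv
    rcases zmod_two_cases i with rfl | rfl
    · obtain ⟨s, rfl⟩ := T.AlamMk_surjective A lam a
      have hs : (s : U k (g ⊗[k] A)) ∈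
          (Superalgebra.grading (k := k) (B := U k (g ⊗[k] A))).gr 0 := by
        apply Z2Grading.mem_of_parity
        rw [U.parity_eq_σ, σ_cartanAlg, sgn_zero_one, one_smul]
      rw [mem_weightCarrierGrading] at hv ⊢
      rw [mk_smul_weightCarrier]
      exact M.obj.smul_mem hs hv
    · have ha0 : a = 0 := by simpa [Superalgebra.grading] using ha
      subst ha0
      rw [zero_smul]
      exact Submodule.zero_mem _

end

theorem map_mem_weightSpace {M N : SuperMod k (U k (g ⊗[k] A))} (f : M ⟶ N) {v : M}
    (hv : v ∈ T.weightSpace M lam) :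
    SuperMod.Hom.toLinearMap f v ∈ T.weightSpace N lam := by
  intro y
  rw [← map_smul, hv y, LinearMap.map_smul_of_tower]

/-- The weight space functor `R_A^lam : C_A^lam → A_lam-mod`, `M ↦ M_lam`. -/
noncomputable def weightFunctor (hA : T.AnnActsTrivially A lam) :
    (T.catC A lam).FullSubcategory ⥤ SuperMod k (T.Alam A lam) where
  obj M := weightModule hA M
  map {M N} f :=
    { toLinearMap :=
        { toFun := fun v => ⟨SuperMod.Hom.toLinearMap f.hom v.1, map_mem_weightSpace f.hom v.2⟩
          map_add' := fun v w => Subtype.ext (map_add _ _ _)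
          map_smul' := fun a v => by
            obtain ⟨s, rfl⟩ := Ideal.Quotient.mk_surjective a
            exact Subtype.ext (map_smul (SuperMod.Hom.toLinearMap f.hom) (s : U k (g ⊗[k] A)) v.1) }
      map_mem := fun {i v} hv => SuperMod.Hom.map_mem f.hom hv }
  map_id _ := rfl
  map_comp _ _ := rfl

/-! ### The Weyl functor -/

variable (T A lam) in
/-- The formula `(u w_lam) s = u s w_lam`, for `u ∈ U(g ⊗ A)` and `s ∈ U(h ⊗ A)`, is a correct
definition of a right action on the global Weyl module. -/
def RightActionWellDefined : Prop :=
  ∀ (u : U k (g ⊗[k] A)) (s : T.cartanAlg A), u • T.weylGen A lam = 0 →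
    (u * s) • T.weylGen A lam = 0

theorem rightMul_aux (hR : T.RightActionWellDefined A lam) (s : T.cartanAlg A)
    {u u' : U k (g ⊗[k] A)} (h : u • T.weylGen A lam = u' • T.weylGen A lam) :
    (u * s) • T.weylGen A lam = (u' * s) • T.weylGen A lam := by
  rw [← sub_eq_zero, ← sub_smul, ← sub_mul]
  exact hR _ s (by rw [sub_smul, h, sub_self])

/-- The endomorphism `u w_lam ↦ u s w_lam` of the global Weyl module. -/
noncomputable def rightMul (hR : T.RightActionWellDefined A lam) (s : T.cartanAlg A) :
    T.weyl A lam →ₗ[U k (g ⊗[k] A)] T.weyl A lam where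
  toFun m := (Classical.choose (T.weyl_generated A lam m) * s) • T.weylGen A lam
  map_add' m n := by
    rw [← add_smul, ← add_mul]
    apply rightMul_aux hR s
    rw [Classical.choose_spec (T.weyl_generated A lam (m + n)), add_smul,
      Classical.choose_spec (T.weyl_generated A lam m),
      Classical.choose_spec (T.weyl_generated A lam n)]
  map_smul' u m := by
    rw [RingHom.id_apply, ← mul_smul, ← mul_assoc]
    apply rightMul_aux hR s
    rw [Classical.choose_spec (T.weyl_generated A lam (u • m)), mul_smul,
      Classical.choose_spec (T.weyl_generated A lam m)]

theorem rightMul_apply (hR : T.RightActionWellDefined A lam) (s : T.cartanAlg A)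
    (u : U k (g ⊗[k] A)) :
    rightMul hR s (u • T.weylGen A lam) = (u * s) • T.weylGen A lam :=
  rightMul_aux hR s (Classical.choose_spec (T.weyl_generated A lam (u • T.weylGen A lam)))

/-- The right action of `U(h ⊗ A)` on the global Weyl module. -/
noncomputable def rightAct (hR : T.RightActionWellDefined A lam) :
    T.cartanAlg A →+* Module.End (U k (g ⊗[k] A)) (T.weyl A lam) where
  toFun := rightMul hR
  map_one' := by
    ext m
    obtain ⟨u, rfl⟩ := T.weyl_generated A lam m
    rw [rightMul_apply, OneMemClass.coe_one, mul_one]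
    rfl
  map_mul' s t := by
    ext m
    obtain ⟨u, rfl⟩ := T.weyl_generated A lam m
    rw [Module.End.mul_apply, rightMul_apply, rightMul_apply, rightMul_apply, mul_comm s t,
      MulMemClass.coe_mul, mul_assoc]
  map_zero' := by
    ext m
    obtain ⟨u, rfl⟩ := T.weyl_generated A lam m
    rw [rightMul_apply, ZeroMemClass.coe_zero, mul_zero, zero_smul]
    rfl
  map_add' s t := by
    ext m
    obtain ⟨u, rfl⟩ := T.weyl_generated A lam m
    rw [LinearMap.add_apply, rightMul_apply, rightMul_apply, rightMul_apply, AddMemClass.coe_add,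
      mul_add, add_smul]

/-- The right action of `A_lam` on the global Weyl module. -/
noncomputable def rightActAlam (hR : T.RightActionWellDefined A lam) :
    T.Alam A lam →+* Module.End (U k (g ⊗[k] A)) (T.weyl A lam) :=
  Ideal.Quotient.lift (T.annIdeal A lam) (rightAct hR) fun s hs => by
    ext m
    obtain ⟨u, rfl⟩ := T.weyl_generated A lam m
    change rightMul hR s _ = 0
    rw [rightMul_apply, mul_smul, show (s : U k (g ⊗[k] A)) • T.weylGen A lam = 0 from hs,
      smul_zero]

/-- The global Weyl module as a bimodule: `U(g ⊗ A)` acts on the left and the commutative algebra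
`A_lam` acts on the right. -/
def WeylBimodule (_hR : T.RightActionWellDefined A lam) : Type u := T.weyl A lam

variable (hR : T.RightActionWellDefined A lam)

noncomputable instance : AddCommGroup (WeylBimodule hR) :=
  inferInstanceAs (AddCommGroup (T.weyl A lam))

noncomputable instance : Module k (WeylBimodule hR) :=
  inferInstanceAs (Module k (T.weyl A lam))

noncomputable instance : Module (U k (g ⊗[k] A)) (WeylBimodule hR) :=
  inferInstanceAs (Module (U k (g ⊗[k] A)) (T.weyl A lam))

noncomputable instance : IsScalarTower k (U k (g ⊗[k] A)) (WeylBimodule hR) :=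
  inferInstanceAs (IsScalarTower k (U k (g ⊗[k] A)) (T.weyl A lam))

noncomputable instance : Module (T.Alam A lam) (WeylBimodule hR) :=
  letI : Module (Module.End (U k (g ⊗[k] A)) (T.weyl A lam)) (WeylBimodule hR) :=
    inferInstanceAs (Module (Module.End (U k (g ⊗[k] A)) (T.weyl A lam)) (T.weyl A lam))
  Module.compHom _ (rightActAlam hR)

theorem Alam_smul_def (a : T.Alam A lam) (m : WeylBimodule hR) :
    a • m = rightActAlam hR a m := rfl

instance : SMulCommClass (T.Alam A lam) (U k (g ⊗[k] A)) (WeylBimodule hR) :=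
  ⟨fun a u m => map_smul (rightActAlam hR a) u m⟩

instance : SMulCommClass (T.Alam A lam) k (WeylBimodule hR) :=
  ⟨fun a c m => LinearMap.map_smul_of_tower (rightActAlam hR a) c m⟩

theorem one_tmul_mem (V : SuperMod k (U k g)) {x : V} (hx : x ∈ V.grading.gr 0) :
    (1 : U k (g ⊗[k] A)) ⊗ₜ[k] x ∈ (freeModule (U k (g ⊗[k] A)) V.grading).grading.gr 0 := by
  have h := tmul_mem_freeModule (B := U k (g ⊗[k] A)) V.grading (i := 0) (j := 0)
    Superalgebra.one_mem hx
  rwa [add_zero] at h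

theorem weylGen_mem : T.weylGen A lam ∈ (T.weyl A lam).grading.gr 0 :=
  SuperMod.mk_mem_quot _ _ (T.parity_mem_upperPart lam (induced A (T.kac lam)))
    (SuperMod.mk_mem_quot _ _ (parity_mem_balancing A (T.kac lam))
      (one_tmul_mem _ (SuperMod.mk_mem_quot (SuperMod.regular k (U k g)) _
        (T.parity_mem_kacIdeal lam) (Superalgebra.one_mem (k := k) (B := U k g)))))

theorem parity_weylGen :
    (T.weyl A lam).grading.parity (T.weylGen A lam) = T.weylGen A lam := by
  rw [Z2Grading.parity_of_mem _ weylGen_mem, sgn_zero_one, one_smul]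

/-- The parity operator of the global Weyl module commutes with the right action. -/
noncomputable def weylParity : WeylBimodule hR →ₗ[T.Alam A lam] WeylBimodule hR where
  toFun m := (T.weyl A lam).grading.parity m
  map_add' m n := map_add (T.weyl A lam).grading.parity m n
  map_smul' a m := by
    obtain ⟨s, rfl⟩ := Ideal.Quotient.mk_surjective a
    obtain ⟨u, rfl⟩ := T.weyl_generated A lam m
    change (T.weyl A lam).grading.parity (rightMul hR s (u • T.weylGen A lam)) =
      rightMul hR s ((T.weyl A lam).grading.parity (u • T.weylGen A lam))
    rw [rightMul_apply, SuperMod.parity_smul, SuperMod.parity_smul, parity_weylGen,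
      rightMul_apply, U.parity_eq_σ, U.parity_eq_σ, map_mul, σ_cartanAlg]

variable (M : SuperMod k (T.Alam A lam))

/-- The parity operator of a graded `A_lam`-module is linear. -/
noncomputable def AlamParity : M →ₗ[T.Alam A lam] M where
  toFun m := M.grading.parity m
  map_add' m n := map_add M.grading.parity m n
  map_smul' a m := by
    rw [M.parity_smul, parity_Alam, RingHom.id_apply]

/-- The parity operator of `W_A(lam) ⊗_{A_lam} M`. -/
noncomputable def weylTensorParity :
    WeylBimodule hR ⊗[T.Alam A lam] M →ₗ[k] WeylBimodule hR ⊗[T.Alam A lam] M where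
  toFun := TensorProduct.map (weylParity hR) (AlamParity M)
  map_add' := map_add _
  map_smul' c t := by
    induction t with
    | zero => simp
    | add s t hs ht => simp only [smul_add, map_add, hs, ht]
    | tmul w m =>
      rw [TensorProduct.smul_tmul', TensorProduct.map_tmul, TensorProduct.map_tmul,
        RingHom.id_apply, TensorProduct.smul_tmul']
      exact congrArg (· ⊗ₜ _) (map_smul (T.weyl A lam).grading.parity c w)

theorem weylTensorParity_tmul (w : WeylBimodule hR) (m : M) :
    weylTensorParity hR M (w ⊗ₜ m) = weylParity hR w ⊗ₜ AlamParity M m := rfl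

theorem weylTensorParity_smul (u : U k (g ⊗[k] A)) (t : WeylBimodule hR ⊗[T.Alam A lam] M) :
    weylTensorParity hR M (u • t) = U.σ k (g ⊗[k] A) u • weylTensorParity hR M t := by
  induction t with
  | zero => simp
  | add s t hs ht => simp only [smul_add, map_add, hs, ht]
  | tmul w m =>
    rw [TensorProduct.smul_tmul', weylTensorParity_tmul, weylTensorParity_tmul,
      TensorProduct.smul_tmul']
    refine congrArg (· ⊗ₜ _) ?_
    exact ((T.weyl A lam).parity_smul u w).trans (by rw [U.parity_eq_σ]; rfl)

theorem weylTensorParity_invol (t : WeylBimodule hR ⊗[T.Alam A lam] M) :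
    weylTensorParity hR M (weylTensorParity hR M t) = t := by
  induction t with
  | zero => simp
  | add s t hs ht => simp only [map_add, hs, ht]
  | tmul w m =>
    rw [weylTensorParity_tmul, weylTensorParity_tmul]
    exact congrArg₂ (· ⊗ₜ ·) ((T.weyl A lam).grading.parity_parity w) (M.grading.parity_parity m)

/-- The graded `g ⊗ A`-module `W_A(lam) ⊗_{A_lam} M`; its component of degree `i` is the sum of the
`W_A(lam)_a ⊗ M_b` with `a + b = i`. -/
noncomputable def weylTensor : SuperMod k (U k (g ⊗[k] A)) where
  carrier := WeylBimodule hR ⊗[T.Alam A lam] M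
  grading := Z2Grading.ofInvolution (weylTensorParity hR M) (weylTensorParity_invol hR M)
  smul_mem := by
    intro i j u t hu ht
    rw [Z2Grading.mem_ofInvolution] at ht ⊢
    rw [weylTensorParity_smul, ht, ← U.parity_eq_σ, Z2Grading.parity_of_mem _ hu, smul_assoc,
      smul_algebra_smul_comm, smul_smul, sgn_add]

variable {M} in
theorem AlamParity_map {N : SuperMod k (T.Alam A lam)} (f : M ⟶ N) (m : M) :
    AlamParity N (SuperMod.Hom.toLinearMap f m) = SuperMod.Hom.toLinearMap f (AlamParity M m) := by
  change N.grading.parity _ = SuperMod.Hom.toLinearMap f (M.grading.parity m)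
  obtain ⟨a, ha, b, hb, rfl⟩ := M.grading.exists_add m
  simp only [map_add]
  rw [N.grading.parity_of_mem (SuperMod.Hom.map_mem f ha), M.grading.parity_of_mem ha,
    N.grading.parity_of_mem (SuperMod.Hom.map_mem f hb), M.grading.parity_of_mem hb,
    LinearMap.map_smul_of_tower, LinearMap.map_smul_of_tower]

variable {M} in
theorem weylTensorParity_lTensor {N : SuperMod k (T.Alam A lam)} (f : M ⟶ N)
    (t : WeylBimodule hR ⊗[T.Alam A lam] M) :
    LinearMap.lTensor (WeylBimodule hR) (SuperMod.Hom.toLinearMap f) (weylTensorParity hR M t) =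
      weylTensorParity hR N (LinearMap.lTensor (WeylBimodule hR) (SuperMod.Hom.toLinearMap f) t) := by
  induction t with
  | zero => simp
  | add s t hs ht => simp only [map_add, hs, ht]
  | tmul w m =>
    rw [weylTensorParity_tmul, LinearMap.lTensor_tmul, LinearMap.lTensor_tmul,
      weylTensorParity_tmul, AlamParity_map]

variable {M} in
theorem weylTensor_lTensor_smul {N : SuperMod k (T.Alam A lam)} (f : M ⟶ N) (c : k)
    (t : WeylBimodule hR ⊗[T.Alam A lam] M) :
    LinearMap.lTensor (WeylBimodule hR) (SuperMod.Hom.toLinearMap f) (c • t) =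
      c • LinearMap.lTensor (WeylBimodule hR) (SuperMod.Hom.toLinearMap f) t := by
  induction t with
  | zero => simp
  | add s t hs ht => simp only [smul_add, map_add, hs, ht]
  | tmul w m => rfl

variable {M} in
/-- The homomorphism `id ⊗ f`. -/
noncomputable def weylTensorMap {N : SuperMod k (T.Alam A lam)} (f : M ⟶ N) :
    weylTensor hR M ⟶ weylTensor hR N where
  toLinearMap :=
    { toFun := LinearMap.lTensor (WeylBimodule hR) (SuperMod.Hom.toLinearMap f)
      map_add' := map_add _
      map_smul' := fun u t => by
        change WeylBimodule hR ⊗[T.Alam A lam] M at t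
        change LinearMap.lTensor (WeylBimodule hR) (SuperMod.Hom.toLinearMap f) (u • t) =
          u • LinearMap.lTensor (WeylBimodule hR) (SuperMod.Hom.toLinearMap f) t
        induction t with
        | zero => simp
        | add s t hs ht => simp only [smul_add, map_add, hs, ht]
        | tmul w m => rfl }
  map_mem := by
    intro i t ht
    have ht' := (Z2Grading.mem_ofInvolution _ (weylTensorParity_invol hR M)).1 ht
    refine (Z2Grading.mem_ofInvolution _ (weylTensorParity_invol hR N)).2 ?_
    change WeylBimodule hR ⊗[T.Alam A lam] M at t
    change weylTensorParity hR N (LinearMap.lTensor (WeylBimodule hR)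
      (SuperMod.Hom.toLinearMap f) t) = _
    rw [← weylTensorParity_lTensor, ht']
    exact weylTensor_lTensor_smul hR f (sgn k i 1) t

/-- The Weyl functor `W_A^lam : A_lam-mod → C_A^lam`, `M ↦ W_A(lam) ⊗_{A_lam} M`, `f ↦ id ⊗ f`. -/
noncomputable def weylFunctor
    (hW : ∀ M : SuperMod k (T.Alam A lam), T.catC A lam (weylTensor hR M)) :
    SuperMod k (T.Alam A lam) ⥤ (T.catC A lam).FullSubcategory where
  obj M := ⟨weylTensor hR M, hW M⟩
  map f := ObjectProperty.homMk (weylTensorMap hR f)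
  map_id M := by
    apply ObjectProperty.hom_ext
    apply SuperMod.Hom.ext
    apply LinearMap.ext
    exact fun t => LinearMap.lTensor_id_apply (WeylBimodule hR) M t
  map_comp f f' := by
    apply ObjectProperty.hom_ext
    apply SuperMod.Hom.ext
    apply LinearMap.ext
    exact fun t => LinearMap.lTensor_comp_apply (WeylBimodule hR)
      (SuperMod.Hom.toLinearMap f') (SuperMod.Hom.toLinearMap f) t

end TriangularDecomposition

end SuperWeyl

namespace SuperWeyl

/-! ### Simultaneous eigenspaces -/

section WeightSpaces

variable {k H V V' : Type*} [Field k] [AddCommGroup H] [Module k H] [AddCommGroup V] [Module k V]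
  [AddCommGroup V'] [Module k V']

/-! The global Weyl module `W` is universal among the objects of the category with a marked vector
of weight `λ`. If `M` is an object and `v ∈ M_λ`, then `n⁺ ⊗ A` kills `v`, because the image would
have a weight outside the region `≤ λ`. The powers of the negative simple root vectors kill `v` by
`sl(2)`-theory in a finite-dimensional `r`-submodule containing `v`. So `v` satisfies the Kac
relations, and some homomorphism `W → M` sends `w` to `v` (`exists_weylLift`). This alone shows that
the annihilator of `w` in `U(h ⊗ A)` kills `M_λ`.

Two facts carry the rest. The first is that `W` lies in the category (`weyl_mem_catC`). This makes
the right action well defined, since `s w` is again a vector of weight `λ` in `W`, and it puts `W ⊗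
M` in the category, which is a sum of images of `W`. The second is the splitting `W = A_λ w ⊕ (lower
weights)` over `A_λ`, with `A_λ w` free of rank one (`weyl_eq_top_sup_lower`, `isCompl_AlamGen`).
Hence `m ↦ w ⊗ m` is an isomorphism `M ≅ (W ⊗ M)_λ`, natural in `M`. The universal property turns
maps `M → N_λ` into maps `W ⊗ M → N`, which is the adjunction. A left adjoint whose composite with
its right adjoint is isomorphic to the identity is fully faithful. It also preserves projectives
once the right adjoint preserves epimorphisms, which holds because epimorphisms are surjective and
weight vectors lift.

To decide membership in the category, finite semisimplicity over `r` is replaced by local finiteness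
together with diagonalizability of `h` (`sSup_irreducible_eq_top_iff`). This needs `r` to be
reductive, which is deduced from the fact that finite-dimensional irreducible modules separate the
elements of `r` (`IsSeparatedByIrreducibles.isReductive`), checked separately for the classical,
special linear and Cartan types. It also needs Weyl's theorem, proved through the Casimir operator
and Whitehead's lemma.

Local finiteness of `W` propagates from `w`, because `g` is finite-dimensional. For `w` it is the
finite-dimensionality of integrable highest-weight modules (`finiteDimensional_of_generated`): the
weights are invariant under simple reflections, so all negative root vectors act locally
nilpotently, and a finite-dimensional stable subspace is built one root at a time. -/

/-- The simultaneous eigenspace of weight `μ` of a family of endomorphisms. -/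
def wt (ρ : H →ₗ[k] Module.End k V) (μ : Module.Dual k H) : Submodule k V where
  carrier := {v | ∀ y, ρ y v = μ y • v}
  add_mem' hx hx' y := by rw [map_add, hx y, hx' y, smul_add]
  zero_mem' y := by simp
  smul_mem' c x hx y := by rw [map_smul, hx y, smul_comm]

/-- `V` is the sum of its weight spaces. -/
def IsWeighted (ρ : H →ₗ[k] Module.End k V) : Prop := ⨆ μ, wt ρ μ = ⊤

/-- The operator `ρ y - μ₀ y` removes the component of weight `μ₀` and rescales each other component
by `μ y - μ₀ y`, which is nonzero for a suitable `y`; this drives the induction. With `N = ⊥` it is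
the independence of the weight spaces. -/
theorem mem_of_sum_mem {ρ : H →ₗ[k] Module.End k V} {N : Submodule k V}
    (hN : ∀ y, ∀ v ∈ N, ρ y v ∈ N) (s : Finset (Module.Dual k H)) :
    ∀ v : Module.Dual k H → V, (∀ μ ∈ s, v μ ∈ wt ρ μ) → ∑ μ ∈ s, v μ ∈ N → ∀ μ ∈ s, v μ ∈ N := by
  classical
  induction s using Finset.induction_on with
  | empty => simp
  | insert μ₀ s h₀ ih =>
    intro v hv hs
    have key : ∀ μ ∈ s, v μ ∈ N := by
      intro μ hμ
      obtain ⟨y, hy⟩ : ∃ y, μ y ≠ μ₀ y := by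
        by_contra! h
        exact h₀ (LinearMap.ext h ▸ hμ)
      have h := ih (fun μ => (μ y - μ₀ y) • v μ)
        (fun μ hμ => Submodule.smul_mem _ _ (hv μ (Finset.mem_insert_of_mem hμ))) (by
          have h1 := N.sub_mem (hN y _ hs) (N.smul_mem (μ₀ y) hs)
          rw [Finset.sum_insert h₀, map_add, map_sum, smul_add, Finset.smul_sum,
            hv μ₀ (Finset.mem_insert_self _ _) y, add_sub_add_left_eq_sub,
            ← Finset.sum_sub_distrib] at h1
          convert h1 using 1
          refine Finset.sum_congr rfl fun μ hμ => ?_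
          rw [hv μ (Finset.mem_insert_of_mem hμ) y, sub_smul]) μ hμ
      exact (Submodule.smul_mem_iff _ (sub_ne_zero.2 hy)).1 h
    intro μ hμ
    rcases Finset.mem_insert.1 hμ with rfl | hμ
    · rw [Finset.sum_insert h₀] at hs
      exact (Submodule.add_mem_iff_left _ (Submodule.sum_mem _ key)).1 hs
    · exact key μ hμ

theorem exists_sum_of_mem_iSup_wt {ρ : H →ₗ[k] Module.End k V} {S : Set (Module.Dual k H)} {x : V}
    (hx : x ∈ ⨆ μ ∈ S, wt ρ μ) : ∃ (s : Finset (Module.Dual k H)) (v : Module.Dual k H → V),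
      ↑s ⊆ S ∧ (∀ μ, v μ ∈ wt ρ μ) ∧ ∑ μ ∈ s, v μ = x := by
  classical
  rw [iSup_subtype'] at hx
  obtain ⟨f, hf, rfl⟩ := (Submodule.mem_iSup_iff_exists_finsupp _ _).1 hx
  -- The family is extended by zero outside `S` so that it becomes a total function on weights.
  refine ⟨f.support.map (Function.Embedding.subtype _), fun μ => if h : μ ∈ S then f ⟨μ, h⟩ else 0,
    ?_, ?_, ?_⟩
  · intro μ hμ
    obtain ⟨a, _, rfl⟩ := Finset.mem_map.1 hμ
    exact a.2
  · intro μ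
    dsimp only
    split_ifs with h
    · exact hf ⟨μ, h⟩
    · exact Submodule.zero_mem _
  · simp [Finsupp.sum]

theorem IsWeighted.exists_sum {ρ : H →ₗ[k] Module.End k V} (hρ : IsWeighted ρ) (x : V) :
    ∃ (s : Finset (Module.Dual k H)) (v : Module.Dual k H → V),
      (∀ μ, v μ ∈ wt ρ μ) ∧ ∑ μ ∈ s, v μ = x := by
  have hx : x ∈ ⨆ μ ∈ Set.univ, wt ρ μ := by
    simp only [Set.mem_univ, iSup_pos]
    rw [hρ]; trivial
  obtain ⟨s, v, -, h⟩ := exists_sum_of_mem_iSup_wt hx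
  exact ⟨s, v, h⟩

/-- A weight vector in a sum `A + B`, where `A` consists of vectors of weight `μ` and `B` is a sum of
other weight spaces, lies in `A`. -/
theorem mem_of_mem_sup_wt {ρ : H →ₗ[k] Module.End k V} {A B : Submodule k V}
    {μ : Module.Dual k H} (hA : A ≤ wt ρ μ) {S : Set (Module.Dual k H)} (hS : μ ∉ S)
    (hB : B ≤ ⨆ ν ∈ S, wt ρ ν) {x : V} (hx : x ∈ wt ρ μ) (hx' : x ∈ A ⊔ B) : x ∈ A := by
  classical
  obtain ⟨a, ha, b, hb, rfl⟩ := Submodule.mem_sup.1 hx'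
  obtain ⟨s, v, hs, hv, rfl⟩ := exists_sum_of_mem_iSup_wt (hB hb)
  have hμ : μ ∉ s := fun h => hS (hs h)
  have hb0 : ∑ ν ∈ s, v ν ∈ wt ρ μ := by
    have := Submodule.sub_mem _ hx (hA ha)
    rwa [add_sub_cancel_left] at this
  -- The sum `b` has weight `μ`, so the components of `b` together with `-b` in position `μ` are
  -- weight vectors with sum zero, and independence forces `b = 0`.
  have := mem_of_sum_mem (ρ := ρ) (N := ⊥) (by simp) (insert μ s)
    (fun ν => if ν = μ then -∑ ν ∈ s, v ν else v ν) (by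
      intro ν _
      split_ifs with h
      · subst h; exact Submodule.neg_mem _ hb0
      · exact hv ν) (by
      rw [Finset.sum_insert hμ, if_pos rfl, Finset.sum_congr rfl fun ν hν =>
        if_neg fun h : ν = μ => hμ (h ▸ hν), neg_add_cancel]
      exact Submodule.zero_mem _) μ (Finset.mem_insert_self _ _)
  rw [if_pos rfl, Submodule.mem_bot, neg_eq_zero] at this
  rwa [this, add_zero]

theorem wt_eq_bot_of_notMem {ρ : H →ₗ[k] Module.End k V} {S : Set (Module.Dual k H)}
    (hS : ⨆ ν ∈ S, wt ρ ν = ⊤) {μ : Module.Dual k H} (hμ : μ ∉ S) : wt ρ μ = ⊥ := by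
  rw [eq_bot_iff]
  intro x hx
  exact mem_of_mem_sup_wt bot_le hμ hS.ge hx (by simp)

/-- A stable subspace of a weighted space is weighted. -/
theorem IsWeighted.le_iSup_inf {ρ : H →ₗ[k] Module.End k V} (hρ : IsWeighted ρ)
    {N : Submodule k V} (hN : ∀ y, ∀ v ∈ N, ρ y v ∈ N) : N ≤ ⨆ μ, N ⊓ wt ρ μ := by
  intro x hx
  obtain ⟨s, v, hv, rfl⟩ := hρ.exists_sum x
  exact Submodule.sum_mem _ fun μ hμ => Submodule.mem_iSup_of_mem μ
    ⟨mem_of_sum_mem hN s v (fun μ _ => hv μ) hx μ hμ, hv μ⟩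

theorem map_mem_wt {ρ : H →ₗ[k] Module.End k V} {ρ' : H →ₗ[k] Module.End k V'} {φ : V →ₗ[k] V'}
    (hφ : ∀ y v, φ (ρ y v) = ρ' y (φ v)) {μ : Module.Dual k H} {v : V} (hv : v ∈ wt ρ μ) :
    φ v ∈ wt ρ' μ := fun y => by rw [← hφ, hv y, map_smul]

/-- The range of `φ` is a stable subspace, hence the sum of its intersections with the weight
spaces. Injectivity pulls each weight vector in the range back to one of the same weight. -/
theorem IsWeighted.of_injective {ρ : H →ₗ[k] Module.End k V} {ρ' : H →ₗ[k] Module.End k V'}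
    (hρ : IsWeighted ρ') {φ : V →ₗ[k] V'} (hφ : ∀ y v, φ (ρ y v) = ρ' y (φ v))
    (h : Function.Injective φ) : IsWeighted ρ := by
  rw [IsWeighted, eq_top_iff]
  intro x _
  have h1 := hρ.le_iSup_inf (N := LinearMap.range φ) (by
    rintro y _ ⟨v, rfl⟩
    exact ⟨_, hφ y v⟩) ⟨x, rfl⟩
  suffices h2 : ⨆ μ, LinearMap.range φ ⊓ wt ρ' μ ≤ (⨆ μ, wt ρ μ).map φ by
    obtain ⟨z, hz, e⟩ := h2 h1
    rwa [← h e]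
  refine iSup_le fun μ => ?_
  rintro _ ⟨⟨z, rfl⟩, hz⟩
  refine ⟨z, Submodule.mem_iSup_of_mem μ fun y => h ?_, rfl⟩
  rw [hφ, hz y, map_smul]

/-- Weight vectors lift along surjections from weighted spaces. -/
theorem IsWeighted.exists_lift {ρ : H →ₗ[k] Module.End k V} {ρ' : H →ₗ[k] Module.End k V'}
    (hρ : IsWeighted ρ) {φ : V →ₗ[k] V'} (hφ : ∀ y v, φ (ρ y v) = ρ' y (φ v))
    {μ : Module.Dual k H} {x : V} (hx : φ x ∈ wt ρ' μ) : ∃ v ∈ wt ρ μ, φ v = φ x := by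
  classical
  obtain ⟨s, v, hv, rfl⟩ := hρ.exists_sum x
  -- The lift is the `μ`-component of the given preimage. The other components map into other weight
  -- spaces, while their total image has weight `μ`, so that image vanishes.
  refine ⟨if μ ∈ s then v μ else 0, ?_, ?_⟩
  · split_ifs
    · exact hv μ
    · exact Submodule.zero_mem _
  have h2 : φ (∑ ν ∈ s.erase μ, v ν) = φ (∑ ν ∈ s, v ν) - φ (if μ ∈ s then v μ else 0) := by
    split_ifs with h
    · rw [← Finset.add_sum_erase s v h, map_add, add_sub_cancel_left]
    · rw [Finset.erase_eq_of_notMem h, map_zero, sub_zero]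
  have h3 : φ (∑ ν ∈ s.erase μ, v ν) ∈ wt ρ' μ := by
    rw [h2]
    refine Submodule.sub_mem _ hx ?_
    split_ifs
    · exact map_mem_wt hφ (hv μ)
    · simp
  have h4 : φ (∑ ν ∈ s.erase μ, v ν) ∈ (⊥ : Submodule k V') := by
    refine mem_of_mem_sup_wt (ρ := ρ') (S := {ν | ν ≠ μ}) (μ := μ)
      (B := ⨆ ν ∈ {ν : Module.Dual k H | ν ≠ μ}, wt ρ' ν) bot_le (by simp) le_rfl h3 ?_
    rw [map_sum]
    refine Submodule.sum_mem _ fun ν hν => Submodule.mem_sup_right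
      (Submodule.mem_iSup_of_mem ν (Submodule.mem_iSup_of_mem (Finset.ne_of_mem_erase hν)
        (map_mem_wt hφ (hv ν))))
  rw [h2, Submodule.mem_bot, sub_eq_zero] at h4
  exact h4.symm

/-- The weights of a weighted space lie in `S` if the vectors of other weights vanish. -/
theorem IsWeighted.iSup_eq_top {ρ : H →ₗ[k] Module.End k V} (hρ : IsWeighted ρ)
    {S : Set (Module.Dual k H)} (hS : ∀ μ ∉ S, wt ρ μ = ⊥) : ⨆ μ ∈ S, wt ρ μ = ⊤ := by
  rw [eq_top_iff, ← hρ]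
  refine iSup_le fun μ => ?_
  by_cases h : μ ∈ S
  · exact le_iSup₂_of_le μ h le_rfl
  · rw [hS μ h]; exact bot_le

end WeightSpaces

/-! ### Complete reducibility of modules over semisimple Lie algebras -/

section Whitehead

open LieModule

variable {k L : Type*} [Field k] [LieRing L] [LieAlgebra k L]

/-- Linear maps `f : L → M` with `f [x, y] = x f(y) - y f(x)`. -/
def IsCocycle {M : Type*} [AddCommGroup M] [Module k M] [LieRingModule L M] [LieModule k L M]
    (f : L →ₗ[k] M) : Prop := ∀ x y, f ⁅x, y⁆ = ⁅x, f y⁆ - ⁅y, f x⁆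

/-- The Killing complement `C` of `[I, I]` meets `I` in an abelian ideal, because brackets there lie
in both `[I, I]` and `C`. That ideal vanishes in a semisimple algebra, and the modular law gives `I
= [I, I]`. -/
theorem lieIdeal_lie_self [FiniteDimensional k L] [LieAlgebra.IsKilling k L] (I : LieIdeal k L) :
    ⁅I, I⁆ = I := by
  refine le_antisymm (LieSubmodule.lie_le_left I I) ?_
  have hc := LieIdeal.isCompl_killingCompl (K := k) ⁅I, I⁆
  set C := LieIdeal.killingCompl k L ⁅I, I⁆
  have hA : C ⊓ I = ⊥ := by
    have : IsLieAbelian ↥(C ⊓ I) := by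
      rw [LieSubmodule.lie_abelian_iff_lie_self_eq_bot, eq_bot_iff, ← hc.inf_eq_bot]
      exact le_inf (LieSubmodule.mono_lie inf_le_right inf_le_right)
        ((LieSubmodule.lie_le_left _ _).trans inf_le_left)
    exact LieAlgebra.HasTrivialRadical.eq_bot_of_isSolvable (R := k) _
  calc I = (⁅I, I⁆ ⊔ C) ⊓ I := by rw [hc.sup_eq_top, top_inf_eq]
    _ = ⁅I, I⁆ ⊔ C ⊓ I := sup_inf_assoc_of_le _ (LieSubmodule.lie_le_left I I)
    _ ≤ ⁅I, I⁆ := by rw [hA, sup_bot_eq]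

variable {M : Type*} [AddCommGroup M] [Module k M] [LieRingModule L M] [LieModule k L M]

/-- The vectors annihilated by an ideal. -/
def idealInvariants (I : LieIdeal k L) : LieSubmodule k L M where
  carrier := {m | ∀ x ∈ I, ⁅x, m⁆ = 0}
  add_mem' ha hb x hx := by rw [lie_add, ha x hx, hb x hx, add_zero]
  zero_mem' x _ := lie_zero x
  smul_mem' c m hm x hx := by rw [lie_smul, hm x hx, smul_zero]
  lie_mem := by
    intro y m hm x hx
    rw [leibniz_lie, hm x hx, lie_zero, add_zero, hm _ (lie_mem_left k L I x y hx)]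

/-- The radical of the trace form of an irreducible module acts trivially. -/
theorem le_ker_of_traceForm [CharZero k] [FiniteDimensional k L] [LieAlgebra.IsKilling k L]
    [FiniteDimensional k M] [LieModule.IsIrreducible k L M] (I : LieIdeal k L)
    (hI : ∀ x ∈ I, ∀ y ∈ I, traceForm k L M x y = 0) : ∀ x ∈ I, ∀ m : M, ⁅x, m⁆ = 0 := by
  have h0 : traceForm k I M = 0 := by
    ext ⟨x, hx⟩ ⟨y, hy⟩
    exact hI x hx y hy
  -- Cartan's criterion: the derived algebra of `I` acts nilpotently. Since `I` is perfect, all of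
  -- `I` does, and Engel's theorem then provides a nonzero vector killed by `I`.
  have h1 := isNilpotent_derivedSeries_of_traceForm_eq_zero h0
  rw [isNilpotent_iff_forall' (R := k)] at h1
  have hN : LieModule.IsNilpotent I M := by
    rw [isNilpotent_iff_forall' (R := k)]
    intro x
    have hx : x ∈ LieAlgebra.derivedSeries k I 1 := by
      rw [LieIdeal.derivedSeries_eq_derivedSeriesOfIdeal_comap, LieIdeal.mem_comap,
        LieAlgebra.derivedSeriesOfIdeal_succ, LieAlgebra.derivedSeriesOfIdeal_zero,
        lieIdeal_lie_self]
      exact x.2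
    exact h1 ⟨x, hx⟩
  have hnt : Nontrivial M := nontrivial_of_isIrreducible k L M
  have h2 : Nontrivial (maxTrivSubmodule k I M) := nontrivial_max_triv_of_isNilpotent k I M
  obtain ⟨⟨m, hm⟩, hm0⟩ := exists_ne (0 : maxTrivSubmodule k I M)
  -- As `I` is an ideal, its invariants form an `L`-submodule, so irreducibility makes them
  -- everything.
  have h3 : (idealInvariants I : LieSubmodule k L M) ≠ ⊥ := by
    intro h
    refine hm0 (Subtype.ext ?_)
    change m = 0
    rw [← LieSubmodule.mem_bot (R := k) (L := L), ← h]
    exact fun x hx => hm ⟨x, hx⟩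
  have h4 := (IsSimpleOrder.eq_bot_or_eq_top (idealInvariants I : LieSubmodule k L M)).resolve_left h3
  intro x hx m
  have : m ∈ (idealInvariants I : LieSubmodule k L M) := h4 ▸ LieSubmodule.mem_top m
  exact this x hx

/-- The invariance of the Casimir tensor. -/
theorem sum_dualBasis_lie {J : LieIdeal k L} [FiniteDimensional k J] {ι : Type*} [Fintype ι]
    [DecidableEq ι] {B : LinearMap.BilinForm k J} (hB : B.Nondegenerate) (hs : B.IsSymm)
    (hinv : ∀ (y : L) (x z : J), B ⁅y, x⁆ z = -B x ⁅y, z⁆) (b : Module.Basis ι k J)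
    {P : Type*} [AddCommGroup P] [Module k P] (β : J →ₗ[k] J →ₗ[k] P) (y : L) :
    ∑ i, (β ⁅y, b i⁆ (B.dualBasis hB b i) + β (b i) ⁅y, B.dualBasis hB b i⁆) = 0 := by
  set b' := B.dualBasis hB b
  have e1 : ∀ x, x = ∑ j, B x (b' j) • b j := fun x => by
    conv_lhs => rw [← b.sum_repr x]
    refine Finset.sum_congr rfl fun j _ => ?_
    rw [← LinearMap.BilinForm.dualBasis_dualBasis hB hs b,
      LinearMap.BilinForm.dualBasis_repr_apply]
  have e2 : ∀ x, x = ∑ j, B x (b j) • b' j := fun x => by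
    conv_lhs => rw [← b'.sum_repr x]
    refine Finset.sum_congr rfl fun j _ => ?_
    rw [LinearMap.BilinForm.dualBasis_repr_apply]
  rw [Finset.sum_add_distrib]
  have h1 : ∑ i, β ⁅y, b i⁆ (b' i) = ∑ i, ∑ j, B ⁅y, b i⁆ (b' j) • β (b j) (b' i) := by
    refine Finset.sum_congr rfl fun i _ => ?_
    conv_lhs => rw [e1 ⁅y, b i⁆]
    rw [map_sum, LinearMap.sum_apply]
    simp only [map_smul, LinearMap.smul_apply]
  have h2 : ∑ i, β (b i) ⁅y, b' i⁆ = ∑ i, ∑ j, B ⁅y, b' i⁆ (b j) • β (b i) (b' j) := by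
    refine Finset.sum_congr rfl fun i _ => ?_
    conv_lhs => rw [e2 ⁅y, b' i⁆]
    rw [map_sum]
    simp only [map_smul]
  rw [h1, h2, Finset.sum_comm, ← Finset.sum_add_distrib]
  refine Finset.sum_eq_zero fun i _ => ?_
  rw [← Finset.sum_add_distrib]
  refine Finset.sum_eq_zero fun j _ => ?_
  -- After the indices are swapped, both sums run over the same vectors `β (b i) (b' j)`, and
  -- invariance of the form makes the two coefficients opposite.
  rw [← add_smul, hinv, ← hs.eq (b j) ⁅y, b' i⁆]
  simp

/-- The Casimir operator `c` of the trace form commutes with `L`, and its trace is the dimension of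
the part of `L` acting faithfully. In characteristic zero it is therefore nonzero, hence invertible
by Schur's lemma, and dividing by it solves the cocycle equation. -/
theorem exists_eq_lie_of_isIrreducible [CharZero k] [FiniteDimensional k L]
    [LieAlgebra.IsKilling k L] [FiniteDimensional k M] [LieModule.IsIrreducible k L M]
    {f : L →ₗ[k] M} (hf : IsCocycle f) : ∃ m, ∀ x, f x = ⁅x, m⁆ := by
  classical
  -- On a trivial module a cocycle vanishes on brackets, and `L` is perfect.
  by_cases ht : ∀ (x : L) (m : M), ⁅x, m⁆ = 0
  · refine ⟨0, fun x => ?_⟩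
    have hx : x ∈ ⁅(⊤ : LieIdeal k L), (⊤ : LieIdeal k L)⁆ := by
      rw [lieIdeal_lie_self]; exact LieSubmodule.mem_top x
    rw [lie_zero]
    rw [← LieSubmodule.mem_toSubmodule, LieSubmodule.lieIdeal_oper_eq_linear_span'] at hx
    induction hx using Submodule.span_induction with
    | mem z hz =>
      obtain ⟨x, -, y, -, rfl⟩ := hz
      rw [hf, ht, ht, sub_zero]
    | zero => simp
    | add x y _ _ hx hy => rw [map_add, hx, hy, add_zero]
    | smul c x _ hx => rw [map_smul, hx, smul_zero]
  -- Only the complement `J` of the kernel sees `M`; the trace form becomes nondegenerate there, so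
  -- dual bases exist.
  let K : LieIdeal k L := LieModule.ker k L M
  let J : LieIdeal k L := LieIdeal.killingCompl k L K
  have hKJ : IsCompl K J := LieIdeal.isCompl_killingCompl K
  have hK : ∀ {x : L}, x ∈ K ↔ ∀ m : M, ⁅x, m⁆ = 0 := fun {x} => LieModule.mem_ker k L M x
  let B : LinearMap.BilinForm k J := (traceForm k L M).restrict J.toSubmodule
  have hBs : B.IsSymm := ⟨fun x y => traceForm_comm k L M x y⟩
  have hinv : ∀ (y : L) (x z : J), B ⁅y, x⁆ z = -B x ⁅y, z⁆ :=
    fun y x z => traceForm_apply_lie_apply' k L M y x z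
  -- A vector of `J` orthogonal to `J` is orthogonal to `K + J = L`, because `K` acts by zero. It
  -- thus lies in the radical of the trace form, which acts trivially by `le_ker_of_traceForm`, and
  -- so in `K ∩ J = 0`.
  have hB : B.Nondegenerate := by
    have : ∀ x : J, (∀ y : J, B x y = 0) → x = 0 := by
      intro x hx
      let R : LieIdeal k L :=
        LieAlgebra.InvariantForm.orthogonal (traceForm k L M) (traceForm_lieInvariant k L M) ⊤
      have hR : ∀ {z : L}, z ∈ R ↔ ∀ y : L, traceForm k L M y z = 0 := by
        intro z
        simp [R, LieAlgebra.InvariantForm.mem_orthogonal]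
      have hxR : (x : L) ∈ R := by
        rw [hR]
        intro y
        obtain ⟨a, ha, b, hb, rfl⟩ := (LieSubmodule.mem_sup _ _ y).1
          (hKJ.sup_eq_top ▸ LieSubmodule.mem_top y : y ∈ K ⊔ J)
        have ha0 : toEnd k L M a = 0 := LinearMap.ext fun m => hK.1 ha m
        rw [map_add, LinearMap.add_apply, traceForm_apply_apply, ha0, LinearMap.zero_comp, map_zero,
          zero_add, traceForm_comm]
        exact hx ⟨b, hb⟩
      have hxK : (x : L) ∈ K := hK.2 (le_ker_of_traceForm R (fun a ha y _ => by
        rw [traceForm_comm]; exact hR.1 ha y) x hxR)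
      have : (x : L) ∈ K ⊓ J := ⟨hxK, x.2⟩
      rw [hKJ.inf_eq_bot] at this
      exact Subtype.ext this
    refine ⟨?_, ?_⟩
    · exact fun x hx => this x hx
    · exact fun x hx => this x fun y => (hBs.eq x y).trans (hx y)
  let b := Module.finBasis k J
  let b' := B.dualBasis hB b
  let φ : J →ₗ[k] Module.End k M := (toEnd k L M : L →ₗ[k] Module.End k M) ∘ₗ J.toSubmodule.subtype
  have hφ : ∀ (x : J) (m : M), φ x m = ⁅(x : L), m⁆ := fun _ _ => rfl
  let c : Module.End k M := ∑ i, φ (b i) * φ (b' i)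
  have hc : ∀ m, c m = ∑ i, ⁅(b i : L), ⁅(b' i : L), m⁆⁆ := fun m => by
    simp [c, LinearMap.sum_apply, hφ]
  have hcomm : ∀ (y : L) (m : M), ⁅y, c m⁆ = c ⁅y, m⁆ := by
    intro y m
    have h := sum_dualBasis_lie hB hBs hinv b
      ((LinearMap.mul k (Module.End k M)).compl₁₂ φ φ) y
    have h' := congrArg (fun e : Module.End k M => e m) h
    simp only [LinearMap.sum_apply, LinearMap.add_apply, LinearMap.compl₁₂_apply,
      LinearMap.mul_apply', Module.End.mul_apply, hφ, LieSubmodule.coe_bracket,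
      LinearMap.zero_apply] at h'
    rw [hc, hc, lie_sum, ← sub_eq_zero, ← Finset.sum_sub_distrib, ← h']
    refine Finset.sum_congr rfl fun i _ => ?_
    rw [leibniz_lie y, leibniz_lie y (B.dualBasis hB b i : L), lie_add]
    abel
  -- Each summand has trace `B (b i) (b' i) = 1`.
  have htr : LinearMap.trace k M c = (Module.finrank k J : k) := by
    rw [map_sum]
    have : ∀ i, LinearMap.trace k M (φ (b i) * φ (b' i)) = 1 := fun i => by
      have := LinearMap.BilinForm.apply_dualBasis_right hB hBs b i i
      rw [if_pos rfl] at this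
      exact this
    simp [this]
  have hJ : Module.finrank k J ≠ 0 := by
    intro h
    have hJ0 : J = ⊥ := by
      rw [← LieSubmodule.toSubmodule_eq_bot]
      exact Submodule.finrank_eq_zero.1 h
    have hKt : K = ⊤ := by
      have := hKJ.sup_eq_top
      rwa [hJ0, sup_bot_eq] at this
    exact ht fun x => hK.1 (hKt ▸ LieSubmodule.mem_top x)
  have hc0 : c ≠ 0 := by
    intro h
    rw [h, map_zero] at htr
    exact hJ (Nat.cast_eq_zero.1 htr.symm)
  let N : LieSubmodule k L M :=
    { LinearMap.ker c with
      lie_mem := by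
        intro y m hm
        change c ⁅y, m⁆ = 0
        rw [← hcomm, show c m = 0 from hm, lie_zero] }
  have hN : N = ⊥ := (IsSimpleOrder.eq_bot_or_eq_top N).resolve_right fun h => hc0 <|
    LinearMap.ext fun m => (h ▸ LieSubmodule.mem_top m : m ∈ N)
  have hinj : Function.Injective c := by
    rw [← LinearMap.ker_eq_bot, eq_bot_iff]
    intro m hm
    have : m ∈ N := hm
    rwa [hN] at this
  -- If `f` is to be `x ↦ [x, m]`, then `c m = ∑ [b i, f (b' i)]`; this dictates `m`. Conversely,
  -- invariance of the Casimir tensor for `(x, z) ↦ [x, f z]` and the cocycle identity give `[y, c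
  -- m] = c (f y)`, and `c` can be cancelled.
  obtain ⟨m, hm⟩ := LinearMap.surjective_of_injective hinj
    (∑ i, ⁅(b i : L), f (b' i)⁆)
  refine ⟨m, fun y => hinj ?_⟩
  have h := sum_dualBasis_lie hB hBs hinv b
    (LinearMap.mk₂ k (fun x z : J => ⁅(x : L), f z⁆) (by simp) (by simp) (by simp) (by simp)) y
  have hf' : ∀ i, f (⁅y, b' i⁆ : J) = ⁅y, f (b' i)⁆ - ⁅(b' i : L), f y⁆ := fun i => hf y (b' i)
  simp only [LinearMap.mk₂_apply] at h
  rw [← hcomm, hm, hc, lie_sum, ← sub_eq_zero, ← Finset.sum_sub_distrib, ← neg_eq_zero, ← h,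
    ← Finset.sum_neg_distrib]
  refine Finset.sum_congr rfl fun i _ => ?_
  rw [leibniz_lie y, hf', lie_sub, LieSubmodule.coe_bracket]
  abel

/-- Whitehead's lemma: cocycles with values in a finite-dimensional module are coboundaries. -/
theorem exists_eq_lie_of_isCocycle [CharZero k] [FiniteDimensional k L]
    [LieAlgebra.IsKilling k L] [FiniteDimensional k M] {f : L →ₗ[k] M} (hf : IsCocycle f) :
    ∃ m, ∀ x, f x = ⁅x, m⁆ := by
  induction hn : Module.finrank k M using Nat.strong_induction_on generalizing M with
  | _ n ih =>
  subst hn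
  rcases subsingleton_or_nontrivial M with hM | hM
  · exact ⟨0, fun x => Subsingleton.elim _ _⟩
  by_cases hirr : LieModule.IsIrreducible k L M
  · exact exists_eq_lie_of_isIrreducible hf
  obtain ⟨N, hN0, hN1⟩ : ∃ N : LieSubmodule k L M, N ≠ ⊥ ∧ N ≠ ⊤ := by
    by_contra! h
    exact hirr (LieModule.IsIrreducible.mk fun N hN => h N hN)
  have hlt : Module.finrank k N < Module.finrank k M :=
    Submodule.finrank_lt (fun h => hN1 (by rwa [← LieSubmodule.toSubmodule_eq_top]))
  have hpos : 0 < Module.finrank k N := by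
    rw [Nat.pos_iff_ne_zero]
    intro h
    exact hN0 (by rw [← LieSubmodule.toSubmodule_eq_bot]; exact Submodule.finrank_eq_zero.1 h)
  have hsum := Submodule.finrank_quotient_add_finrank N.toSubmodule
  have hlt' : Module.finrank k (M ⧸ N) < Module.finrank k M := by
    change Module.finrank k (M ⧸ N.toSubmodule) < _
    change 0 < Module.finrank k N.toSubmodule at hpos
    omega
  -- The cocycle becomes a coboundary modulo `N` by induction.
  obtain ⟨q, hq⟩ := ih _ hlt' (M := M ⧸ N) (f := (LieSubmodule.Quotient.mk' N : M →ₗ[k] M ⧸ N) ∘ₗ f)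
    (by
      intro x y
      simp only [LinearMap.comp_apply, hf x y, map_sub]
      rfl) rfl
  obtain ⟨m₁, rfl⟩ := LieSubmodule.Quotient.surjective_mk' N q
  have hmem : ∀ x, f x - ⁅x, m₁⁆ ∈ N := fun x =>
    (Submodule.Quotient.eq N.toSubmodule).1 (hq x)
  -- Subtracting a lift of that coboundary leaves a cocycle with values in `N`, to which the
  -- induction applies again.
  let f' : L →ₗ[k] N :=
    { toFun := fun x => ⟨f x - ⁅x, m₁⁆, hmem x⟩
      map_add' := fun x y => Subtype.ext (by
        change f (x + y) - ⁅x + y, m₁⁆ = f x - ⁅x, m₁⁆ + (f y - ⁅y, m₁⁆)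
        rw [map_add, add_lie]; abel)
      map_smul' := fun c x => Subtype.ext (by
        change f (c • x) - ⁅c • x, m₁⁆ = c • (f x - ⁅x, m₁⁆)
        rw [map_smul, smul_lie, smul_sub]) }
  obtain ⟨m₂, hm₂⟩ := ih _ hlt (M := N) (f := f') (by
    intro x y
    refine Subtype.ext ?_
    change f ⁅x, y⁆ - ⁅⁅x, y⁆, m₁⁆ = ⁅x, f y - ⁅y, m₁⁆⁆ - ⁅y, f x - ⁅x, m₁⁆⁆
    rw [hf, lie_sub, lie_sub, lie_lie]
    abel) rfl
  refine ⟨m₁ + m₂, fun x => ?_⟩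
  have := congrArg Subtype.val (hm₂ x)
  change f x - ⁅x, m₁⁆ = ⁅x, (m₂ : M)⁆ at this
  rw [lie_add, ← this]
  abel

/-- Weyl's theorem. -/
theorem complementedLattice_of_isKilling [CharZero k] [FiniteDimensional k L]
    [LieAlgebra.IsKilling k L] [FiniteDimensional k M] :
    ComplementedLattice (LieSubmodule k L M) := by
  refine ⟨fun N => ?_⟩
  -- Any linear projection onto `N` will do. Its failure to be equivariant, `x ↦ [x, P]`, is a
  -- cocycle with values in the maps that vanish on `N`.
  obtain ⟨p, hp⟩ := N.toSubmodule.subtype.exists_leftInverse_of_injective (by simp)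
  have hp' : ∀ n : N, p n = n := fun n => congrArg (fun e : N.toSubmodule →ₗ[k] N.toSubmodule => e n) hp
  let E : LieSubmodule k L (M →ₗ[k] N) :=
    { carrier := {φ | ∀ n ∈ N, φ n = 0}
      add_mem' := fun ha hb n hn => by rw [LinearMap.add_apply, ha n hn, hb n hn, add_zero]
      zero_mem' := fun n _ => rfl
      smul_mem' := fun c φ h n hn => by rw [LinearMap.smul_apply, h n hn, smul_zero]
      lie_mem := by
        intro x φ h n hn
        rw [LieHom.lie_apply, h n hn, h _ (N.lie_mem hn), lie_zero, sub_zero] }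
  let P : M →ₗ[k] N := p
  have hmem : ∀ x : L, ⁅x, P⁆ ∈ E := by
    intro x n hn
    rw [LieHom.lie_apply, show P n = ⟨n, hn⟩ from hp' ⟨n, hn⟩,
      show P ⁅x, n⁆ = ⟨⁅x, n⁆, N.lie_mem hn⟩ from hp' ⟨_, N.lie_mem hn⟩]
    exact sub_self _
  let f : L →ₗ[k] E :=
    { toFun := fun x => ⟨⁅x, P⁆, hmem x⟩
      map_add' := fun x y => Subtype.ext (add_lie x y P)
      map_smul' := fun c x => Subtype.ext (smul_lie c x P) }
  obtain ⟨⟨φ, hφ⟩, h⟩ := exists_eq_lie_of_isCocycle (f := f) (by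
    intro x y
    refine Subtype.ext ?_
    change ⁅⁅x, y⁆, P⁆ = ⁅x, ⁅y, P⁆⁆ - ⁅y, ⁅x, P⁆⁆
    exact lie_lie x y P)
  -- The correction `φ` vanishes on `N`, so `q` is still a projection, now equivariant; its kernel
  -- is the complement.
  let q : M →ₗ[k] N := P - φ
  have hq : ∀ (x : L) (m : M), q ⁅x, m⁆ = ⁅x, q m⁆ := by
    intro x m
    have h1 := congrArg (fun e : E => (e : M →ₗ[k] N) m) (h x)
    change ⁅x, P⁆ m = ⁅x, φ⁆ m at h1
    rw [LieHom.lie_apply, LieHom.lie_apply] at h1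
    simp only [q, LinearMap.sub_apply, lie_sub]
    exact (sub_eq_sub_iff_sub_eq_sub.1 h1).symm
  have hqN : ∀ n (hn : n ∈ N), q n = ⟨n, hn⟩ := fun n hn => by
    simp only [q, LinearMap.sub_apply]
    rw [hφ n hn, sub_zero]
    exact hp' ⟨n, hn⟩
  let C : LieSubmodule k L M :=
    { LinearMap.ker q with
      lie_mem := by
        intro y m hm
        change q ⁅y, m⁆ = 0
        rw [hq, show q m = 0 from hm, lie_zero] }
  have hC : ∀ {m}, m ∈ C ↔ q m = 0 := Iff.rfl
  refine ⟨C, IsCompl.of_eq ?_ ?_⟩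
  · rw [LieSubmodule.eq_bot_iff]
    rintro m ⟨h1, h2⟩
    have h3 := hqN m h1
    rw [hC.1 h2] at h3
    exact congrArg Subtype.val h3.symm
  · rw [eq_top_iff]
    intro m _
    refine (LieSubmodule.mem_sup _ _ m).2 ⟨q m, (q m).2, m - q m, ?_, add_sub_cancel _ _⟩
    rw [hC, map_sub, hqN _ (q m).2, sub_self]

end Whitehead

/-! ### Reductive Lie algebras -/

section Reductive

open LieModule

variable (k : Type u) (L : Type u) [Field k] [LieRing L] [LieAlgebra k L]

/-- The derived ideal `[L, L]`. -/
abbrev derivedIdeal : LieIdeal k L := ⁅(⊤ : LieIdeal k L), (⊤ : LieIdeal k L)⁆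

/-- `L` is the direct sum of its centre and its semisimple derived algebra. -/
structure IsReductive : Prop where
  sup_eq_top : LieAlgebra.center k L ⊔ derivedIdeal k L = ⊤
  inf_eq_bot : LieAlgebra.center k L ⊓ derivedIdeal k L = ⊥
  isKilling : LieAlgebra.IsKilling k (derivedIdeal k L)

/-- The finite-dimensional irreducible representations of `L` separate its elements from zero. -/
def IsSeparatedByIrreducibles : Prop :=
  ∀ x : L, (∀ (V : Type u) [AddCommGroup V] [Module k V] [LieRingModule L V] [LieModule k L V]
    [FiniteDimensional k V] [LieModule.IsIrreducible k L V], ∀ v : V, ⁅x, v⁆ = 0) → x = 0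

variable {k L}

/-- Lie's theorem gives a common eigenvector of the radical. Since the radical is an ideal and the
characteristic is zero, its eigenspace is stable under `L`, hence equal to `V`. -/
theorem radical_acts_by_scalars [IsAlgClosed k] [CharZero k] [FiniteDimensional k L]
    (V : Type*) [AddCommGroup V] [Module k V] [LieRingModule L V] [LieModule k L V]
    [FiniteDimensional k V] [LieModule.IsIrreducible k L V] {x : L}
    (hx : x ∈ LieAlgebra.radical k L) : ∃ c : k, ∀ v : V, ⁅x, v⁆ = c • v := by
  have := nontrivial_of_isIrreducible k L V
  obtain ⟨χ, hχ⟩ : ∃ χ : Module.Dual k (LieAlgebra.radical k L), Nontrivial (weightSpace V χ) :=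
    exists_nontrivial_weightSpace_of_isSolvable k (LieAlgebra.radical k L) V
  let N : LieSubmodule k L V := weightSpaceOfIsLieTower k V χ
  replace hχ : Nontrivial N := hχ
  replace hχ : N = ⊤ := N.eq_top_of_isIrreducible k L V
  refine ⟨χ ⟨x, hx⟩, fun v => ?_⟩
  have hm : ∀ (y : L) (hy : y ∈ LieAlgebra.radical k L), ⁅y, v⁆ = χ ⟨y, hy⟩ • v := by
    simpa [N, weightSpaceOfIsLieTower, mem_weightSpace] using (hχ ▸ LieSubmodule.mem_top _ : v ∈ N)
  exact hm x hx

theorem mem_derivedIdeal_induction {p : L → Prop} (hlie : ∀ x y : L, p ⁅x, y⁆) (h0 : p 0)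
    (hadd : ∀ x y, p x → p y → p (x + y)) (hsmul : ∀ (c : k) x, p x → p (c • x)) {x : L}
    (hx : x ∈ derivedIdeal k L) : p x := by
  rw [← LieSubmodule.mem_toSubmodule, LieSubmodule.lieIdeal_oper_eq_linear_span'] at hx
  induction hx using Submodule.span_induction with
  | mem z hz =>
    obtain ⟨x, -, y, -, rfl⟩ := hz
    exact hlie x y
  | zero => exact h0
  | add x y _ _ hx hy => exact hadd x y hx hy
  | smul c x _ hx => exact hsmul c x hx

theorem lie_mem_derivedIdeal (x y : L) : ⁅x, y⁆ ∈ derivedIdeal k L :=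
  LieSubmodule.lie_mem_lie (LieSubmodule.mem_top x) (LieSubmodule.mem_top y)

/-- In every irreducible module the radical acts by scalars. Its brackets with `L` therefore act by
zero, so it is central. A central element of `[L, L]` acts by a scalar of trace zero, hence by zero.
Separation turns both statements about actions into statements about elements. -/
theorem IsSeparatedByIrreducibles.isReductive [IsAlgClosed k] [CharZero k] [FiniteDimensional k L]
    (hL : IsSeparatedByIrreducibles k L) : IsReductive k L := by
  have hrad : LieAlgebra.radical k L ≤ LieAlgebra.center k L := by
    intro x hx
    rw [LieModule.mem_maxTrivSubmodule]
    intro y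
    refine hL _ fun V _ _ _ _ _ _ v => ?_
    obtain ⟨c, hc⟩ := radical_acts_by_scalars V hx
    rw [lie_lie, hc, hc, lie_smul, sub_self]
  have hinf : LieAlgebra.center k L ⊓ derivedIdeal k L = ⊥ := by
    rw [LieSubmodule.eq_bot_iff]
    rintro x ⟨hx, hx'⟩
    refine hL _ fun V _ _ _ _ _ _ v => ?_
    obtain ⟨c, hc⟩ := radical_acts_by_scalars V (LieAlgebra.center_le_radical k L hx)
    have htr : LinearMap.trace k V (toEnd k L V x) = 0 := by
      refine mem_derivedIdeal_induction (p := fun x => LinearMap.trace k V (toEnd k L V x) = 0)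
        (fun x y => ?_) (by simp) (fun x y hx hy => by rw [map_add, map_add, hx, hy, add_zero])
        (fun c x hx => by rw [map_smul, map_smul, hx, smul_zero]) hx'
      have e : toEnd k L V ⁅x, y⁆ = toEnd k L V x * toEnd k L V y - toEnd k L V y * toEnd k L V x :=
        LinearMap.ext fun v => lie_lie x y v
      rw [e, map_sub, LinearMap.trace_mul_comm, sub_self]
    have he : toEnd k L V x = c • LinearMap.id := LinearMap.ext hc
    have := nontrivial_of_isIrreducible k L V
    rw [he, map_smul, LinearMap.trace_id, smul_eq_mul, mul_eq_zero, Nat.cast_eq_zero] at htr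
    rw [hc, htr.resolve_right Module.finrank_pos.ne', zero_smul]
  -- If `[J, J]` is central then the second derived ideal of `J` vanishes, so `J` is solvable and
  -- lies in the radical, which is central.
  have hsolv : ∀ J : LieIdeal k L, (∀ x ∈ J, ∀ y ∈ J, ⁅x, y⁆ ∈ LieAlgebra.center k L) →
      J ≤ LieAlgebra.center k L := by
    intro J hJ
    refine le_trans ?_ hrad
    rw [← LieAlgebra.LieIdeal.solvable_iff_le_radical]
    refine LieAlgebra.IsSolvable.mk (k := 2)
      ((LieIdeal.derivedSeries_eq_bot_iff J 2).2 ?_)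
    rw [LieAlgebra.derivedSeriesOfIdeal_succ, LieAlgebra.derivedSeriesOfIdeal_succ,
      LieAlgebra.derivedSeriesOfIdeal_zero, eq_bot_iff]
    have h1 : ⁅J, J⁆ ≤ LieAlgebra.center k L := by
      rw [LieSubmodule.lie_le_iff]
      exact hJ
    rw [LieSubmodule.lie_le_iff]
    intro x hx y hy
    rw [LieSubmodule.mem_bot]
    exact (LieModule.mem_maxTrivSubmodule k L L y).1 (h1 hy) x
  have hsup : LieAlgebra.center k L ⊔ derivedIdeal k L = ⊤ := by
    -- The preimage of an abelian ideal of `L / Z` has central brackets, so it is contained in `Z`.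
    -- Thus `L / Z` is semisimple, hence perfect, and lifting brackets gives `L = Z + [L, L]`.
    have htriv : LieAlgebra.HasTrivialRadical k (L ⧸ LieAlgebra.center k L) := by
      rw [LieAlgebra.hasTrivialRadical_iff_no_abelian_ideals]
      intro I hI
      let π := LieSubmodule.Quotient.mk' (LieAlgebra.center k L)
      let J : LieIdeal k L :=
        { I.toSubmodule.comap (π : L →ₗ[k] L ⧸ LieAlgebra.center k L) with
          lie_mem := by
            intro x y hy
            exact lie_mem_right k _ I (π x) (π y) hy }
      have hJ := hsolv J fun x hx y hy => by
        rw [← LieSubmodule.Quotient.mk_eq_zero']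
        have := congrArg Subtype.val (hI.trivial ⟨π x, hx⟩ ⟨π y, hy⟩)
        exact this
      rw [LieSubmodule.eq_bot_iff]
      intro q hq
      obtain ⟨x, rfl⟩ := LieSubmodule.Quotient.surjective_mk' _ q
      exact (LieSubmodule.Quotient.mk_eq_zero (N := LieAlgebra.center k L)).2 (hJ hq)
    rw [eq_top_iff]
    intro x _
    have hx : LieSubmodule.Quotient.mk' (LieAlgebra.center k L) x ∈
        derivedIdeal k (L ⧸ LieAlgebra.center k L) := by
      rw [derivedIdeal, lieIdeal_lie_self]; exact LieSubmodule.mem_top _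
    have key : ∀ q ∈ derivedIdeal k (L ⧸ LieAlgebra.center k L), ∃ d ∈ derivedIdeal k L,
        LieSubmodule.Quotient.mk' (LieAlgebra.center k L) d = q := by
      intro q hq
      refine mem_derivedIdeal_induction (p := fun q => ∃ d ∈ derivedIdeal k L,
        LieSubmodule.Quotient.mk' (LieAlgebra.center k L) d = q) ?_ ?_ ?_ ?_ hq
      · intro a b
        obtain ⟨a, rfl⟩ := LieSubmodule.Quotient.surjective_mk' _ a
        obtain ⟨b, rfl⟩ := LieSubmodule.Quotient.surjective_mk' _ b
        exact ⟨⁅a, b⁆, lie_mem_derivedIdeal a b, rfl⟩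
      · exact ⟨0, zero_mem _, map_zero _⟩
      · rintro _ _ ⟨a, ha, rfl⟩ ⟨b, hb, rfl⟩
        exact ⟨a + b, add_mem ha hb, map_add _ _ _⟩
      · rintro c _ ⟨a, ha, rfl⟩
        exact ⟨c • a, SMulMemClass.smul_mem c ha, map_smul _ _ _⟩
    obtain ⟨d, hd, e⟩ := key _ hx
    refine (LieSubmodule.mem_sup _ _ x).2 ⟨x - d, ?_, d, hd, sub_add_cancel _ _⟩
    rw [← LieSubmodule.Quotient.mk_eq_zero']
    exact (map_sub (LieSubmodule.Quotient.mk' (LieAlgebra.center k L)) x d).trans (by rw [e, sub_self])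
  refine ⟨hsup, hinf, ?_⟩
  -- Because `L = Z + [L, L]`, an ideal of `[L, L]` is an ideal of `L`. An abelian one is central by
  -- `hsolv`, hence zero by `hinf`.
  have : LieAlgebra.HasTrivialRadical k (derivedIdeal k L) := by
    rw [LieAlgebra.hasTrivialRadical_iff_no_abelian_ideals]
    intro I hI
    let J : LieIdeal k L :=
      { I.toSubmodule.map (derivedIdeal k L).toSubmodule.subtype with
        lie_mem := by
          rintro x _ ⟨y, hy, rfl⟩
          obtain ⟨z, hz, d, hd, rfl⟩ := (LieSubmodule.mem_sup _ _ x).1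
            (hsup ▸ LieSubmodule.mem_top x :
              x ∈ LieAlgebra.center k L ⊔ derivedIdeal k L)
          refine ⟨⁅(⟨d, hd⟩ : derivedIdeal k L), y⁆, lie_mem_right k _ I _ _ hy, ?_⟩
          change ⁅d, (y : L)⁆ = ⁅z + d, (y : L)⁆
          rw [add_lie, ← lie_skew z, (LieModule.mem_maxTrivSubmodule k L L z).1 hz, neg_zero,
            zero_add] }
    have hJ := hsolv J (by
      rintro _ ⟨x, hx, rfl⟩ _ ⟨y, hy, rfl⟩
      have := congrArg (fun z : I => ((z : derivedIdeal k L) : L)) (hI.trivial ⟨x, hx⟩ ⟨y, hy⟩)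
      change ⁅(x : L), (y : L)⁆ = 0 at this
      change ⁅(x : L), (y : L)⁆ ∈ _
      rw [this]
      exact zero_mem _)
    rw [LieSubmodule.eq_bot_iff]
    intro x hx
    have : (x : L) ∈ LieAlgebra.center k L ⊓ derivedIdeal k L := ⟨hJ ⟨x, hx, rfl⟩, x.2⟩
    rw [hinf, LieSubmodule.mem_bot] at this
    exact Subtype.ext this
  infer_instance

/-- Over a reductive Lie algebra, a module on which the centre acts by scalars is completely
reducible. -/
theorem IsReductive.complementedLattice [CharZero k] [FiniteDimensional k L]
    (hL : IsReductive k L) {M : Type*} [AddCommGroup M] [Module k M] [LieRingModule L M]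
    [LieModule k L M] [FiniteDimensional k M] {χ : L → k}
    (hχ : ∀ z ∈ LieAlgebra.center k L, ∀ m : M, ⁅z, m⁆ = χ z • m) :
    ComplementedLattice (LieSubmodule k L M) := by
  have := hL.isKilling
  obtain ⟨hc⟩ := complementedLattice_of_isKilling (k := k) (L := derivedIdeal k L) (M := M)
  refine ⟨fun N => ?_⟩
  let N' : LieSubmodule k (derivedIdeal k L) M :=
    { N.toSubmodule with lie_mem := fun {x m} hm => N.lie_mem (x := (x : L)) hm }
  obtain ⟨C', hC'⟩ := hc N'
  -- A complement over the derived algebra is automatically stable under the centre, which acts by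
  -- scalars.
  let C : LieSubmodule k L M :=
    { C'.toSubmodule with
      lie_mem := by
        intro x m hm
        obtain ⟨z, hz, d, hd, rfl⟩ := (LieSubmodule.mem_sup _ _ x).1
          (hL.sup_eq_top ▸ LieSubmodule.mem_top x :
            x ∈ LieAlgebra.center k L ⊔ derivedIdeal k L)
        rw [add_lie, hχ z hz]
        exact C'.toSubmodule.add_mem (C'.toSubmodule.smul_mem _ hm)
          (C'.lie_mem (x := ⟨d, hd⟩) hm) }
  refine ⟨C, IsCompl.of_eq ?_ ?_⟩
  · rw [LieSubmodule.eq_bot_iff]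
    rintro m ⟨h1, h2⟩
    have : m ∈ N' ⊓ C' := ⟨h1, h2⟩
    rwa [hC'.inf_eq_bot] at this
  · rw [eq_top_iff]
    intro m _
    obtain ⟨a, ha, b, hb, rfl⟩ := (LieSubmodule.mem_sup _ _ m).1
      (hC'.sup_eq_top ▸ LieSubmodule.mem_top m : m ∈ N' ⊔ C')
    exact (LieSubmodule.mem_sup _ _ _).2 ⟨a, ha, b, hb, rfl⟩

end Reductive

/-! ### Split Cartan subalgebras -/

section SplitCartan

open LieModule

variable {k : Type u} {L : Type u} [Field k] [LieRing L] [LieAlgebra k L]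

/-- The action of a subalgebra on a module. -/
def act (H : LieSubalgebra k L) (M : Type*) [AddCommGroup M] [Module k M] [LieRingModule L M]
    [LieModule k L M] : H →ₗ[k] Module.End k M :=
  (toEnd k L M : L →ₗ[k] Module.End k M) ∘ₗ H.toSubmodule.subtype

variable {H : LieSubalgebra k L} {M : Type*} [AddCommGroup M] [Module k M] [LieRingModule L M]
  [LieModule k L M]

theorem act_apply (y : H) (m : M) : act H M y m = ⁅(y : L), m⁆ := rfl

theorem mem_wt_act {μ : Module.Dual k H} {m : M} :
    m ∈ wt (act H M) μ ↔ ∀ y : H, ⁅(y : L), m⁆ = μ y • m := Iff.rfl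

theorem lie_mem_wt {α μ : Module.Dual k H} {x : L} {m : M} (hx : x ∈ wt (act H L) α)
    (hm : m ∈ wt (act H M) μ) : ⁅x, m⁆ ∈ wt (act H M) (α + μ) := by
  intro y
  rw [act_apply, leibniz_lie, mem_wt_act.1 hx y, mem_wt_act.1 hm y, smul_lie, lie_smul, ← add_smul,
    LinearMap.add_apply]

/-- `H` is its own centralizer, and `L` is the sum of its weight spaces. -/
structure IsSplitCartan (H : LieSubalgebra k L) : Prop where
  mem_iff : ∀ x : L, x ∈ H ↔ ∀ y : H, ⁅(y : L), x⁆ = 0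
  isWeighted : IsWeighted (act H L)

theorem IsSplitCartan.lie_eq_zero (hH : IsSplitCartan H) {x y : L} (hx : x ∈ H) (hy : y ∈ H) :
    ⁅x, y⁆ = 0 := (hH.mem_iff y).1 hy ⟨x, hx⟩

theorem IsSplitCartan.isLieAbelian (hH : IsSplitCartan H) : IsLieAbelian H :=
  ⟨fun x y => Subtype.ext (hH.lie_eq_zero x.2 y.2)⟩

theorem IsSplitCartan.center_le (hH : IsSplitCartan H) {z : L}
    (hz : z ∈ LieAlgebra.center k L) : z ∈ H :=
  (hH.mem_iff z).2 fun y => (LieModule.mem_maxTrivSubmodule k L L z).1 hz y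

/-- The sum of the weight spaces of a module is a submodule. -/
def weightSum (hH : IsSplitCartan H) (M : Type*) [AddCommGroup M] [Module k M] [LieRingModule L M]
    [LieModule k L M] : LieSubmodule k L M where
  __ := ⨆ μ, wt (act H M) μ
  lie_mem := by
    intro x m hm
    obtain ⟨s, v, hv, rfl⟩ := hH.isWeighted.exists_sum x
    change m ∈ ⨆ μ, wt (act H M) μ at hm
    change ⁅∑ α ∈ s, v α, m⁆ ∈ ⨆ μ, wt (act H M) μ
    rw [sum_lie]
    refine Submodule.sum_mem _ fun α _ => ?_
    suffices h : ⨆ μ, wt (act H M) μ ≤ (⨆ μ, wt (act H M) μ).comap (toEnd k L M (v α)) from h hm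
    exact iSup_le fun μ z hz => Submodule.mem_iSup_of_mem _ (lie_mem_wt (hv α) hz)

/-- `H` is abelian, so Lie's theorem supplies a weight vector; the sum of the weight spaces is then
a nonzero submodule. -/
theorem isWeighted_of_isIrreducible [IsAlgClosed k] [CharZero k] (hH : IsSplitCartan H)
    [FiniteDimensional k M] [LieModule.IsIrreducible k L M] : IsWeighted (act H M) := by
  have := hH.isLieAbelian
  have := nontrivial_of_isIrreducible k L M
  obtain ⟨χ, hχ⟩ := exists_nontrivial_weightSpace_of_isSolvable k H M
  obtain ⟨⟨v, hv⟩, hv0⟩ := exists_ne (0 : weightSpace M χ)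
  have hv' : v ∈ weightSum hH M := by
    refine Submodule.mem_iSup_of_mem χ ?_
    rw [mem_weightSpace] at hv
    exact fun y => hv y
  have h : weightSum hH M = ⊤ := (IsSimpleOrder.eq_bot_or_eq_top _).resolve_left fun h => by
    rw [h, LieSubmodule.mem_bot] at hv'
    exact hv0 (Subtype.ext hv')
  rw [← LieSubmodule.toSubmodule_eq_top] at h
  exact h

/-- The vectors which are contained in finite-dimensional submodules. -/
def locallyFinitePart (k L M : Type*) [Field k] [LieRing L] [LieAlgebra k L] [AddCommGroup M]
    [Module k M] [LieRingModule L M] [LieModule k L M] : LieSubmodule k L M where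
  carrier := {m | ∃ N : LieSubmodule k L M, FiniteDimensional k N ∧ m ∈ N}
  add_mem' := by
    rintro a b ⟨N, hN, ha⟩ ⟨N', hN', hb⟩
    refine ⟨N ⊔ N', ?_, add_mem (le_sup_left (b := N') ha) (le_sup_right (a := N) hb)⟩
    change FiniteDimensional k ↥(N ⊔ N').toSubmodule
    rw [LieSubmodule.sup_toSubmodule]
    have : FiniteDimensional k N.toSubmodule := hN
    have : FiniteDimensional k N'.toSubmodule := hN'
    infer_instance
  zero_mem' := ⟨⊥, by
    change FiniteDimensional k ↥(⊥ : LieSubmodule k L M).toSubmodule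
    rw [LieSubmodule.bot_toSubmodule]
    infer_instance, zero_mem _⟩
  smul_mem' := by
    rintro c m ⟨N, hN, hm⟩
    exact ⟨N, hN, N.smul_mem c hm⟩
  lie_mem := by
    rintro x m ⟨N, hN, hm⟩
    exact ⟨N, hN, N.lie_mem hm⟩

theorem isIrreducible_of_isAtom {N : LieSubmodule k L M} (hN : IsAtom N) :
    LieModule.IsIrreducible k L N := by
  have : Nontrivial N := (LieSubmodule.nontrivial_iff_ne_bot k L M).2 hN.1
  refine LieModule.IsIrreducible.mk fun P hP => ?_
  have h1 : P.map N.incl ≤ N := LieSubmodule.map_incl_le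
  rcases hN.le_iff.1 h1 with h | h
  · exfalso
    apply hP
    rw [LieSubmodule.eq_bot_iff] at h ⊢
    exact fun p hp => Subtype.ext (h p ((LieSubmodule.mem_map _).2 ⟨p, hp, rfl⟩))
  · rw [eq_top_iff]
    intro p _
    have h2 : (p : M) ∈ P.map N.incl := by rw [h]; exact p.2
    obtain ⟨q, hq, e⟩ := (LieSubmodule.mem_map _).1 h2
    rwa [← Subtype.ext (show (q : M) = p from e)]

theorem isAtom_map_incl {F : LieSubmodule k L M} {P : LieSubmodule k L F} (hP : IsAtom P) :
    IsAtom (P.map F.incl) := by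
  have hmap : ∀ {x : F}, (x : M) ∈ P.map F.incl ↔ x ∈ P := by
    intro x
    constructor
    · intro h
      obtain ⟨q, hq, e⟩ := (LieSubmodule.mem_map _).1 h
      rwa [← Subtype.ext (show (q : M) = x from e)]
    · exact fun h => (LieSubmodule.mem_map _).2 ⟨x, h, rfl⟩
  refine ⟨fun h => hP.1 ?_, fun Q hQ => ?_⟩
  · rw [LieSubmodule.eq_bot_iff] at h ⊢
    exact fun p hp => Subtype.ext (h p (hmap.2 hp))
  · have h1 : Q.comap F.incl < P := by
      refine lt_of_le_of_ne (fun x hx => hmap.1 (hQ.le hx)) fun h => hQ.not_ge ?_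
      intro x hx
      obtain ⟨q, hq, rfl⟩ := (LieSubmodule.mem_map _).1 hx
      rw [← h] at hq
      exact hq
    have h2 := hP.2 _ h1
    rw [LieSubmodule.eq_bot_iff] at h2 ⊢
    intro x hx
    obtain ⟨q, hq, rfl⟩ := (LieSubmodule.mem_map _).1 (hQ.le hx)
    exact congrArg Subtype.val (h2 q hx)

/-- `M` is a sum of finite-dimensional irreducible submodules if and only if it is locally finite
and the Cartan subalgebra acts diagonalizably. -/
theorem sSup_irreducible_eq_top_iff [IsAlgClosed k] [CharZero k] [FiniteDimensional k L]
    (hL : IsReductive k L) (hH : IsSplitCartan H) :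
    sSup {N : LieSubmodule k L M | FiniteDimensional k N ∧ IsAtom N} = ⊤ ↔
      locallyFinitePart k L M = ⊤ ∧ IsWeighted (act H M) := by
  constructor
  · intro h
    constructor
    · rw [eq_top_iff, ← h]
      exact sSup_le fun N hN m hm => ⟨N, hN.1, hm⟩
    · have h1 : weightSum hH M = ⊤ := by
        rw [eq_top_iff, ← h]
        refine sSup_le fun N hN m hm => ?_
        have := isIrreducible_of_isAtom hN.2
        have := hN.1
        have h2 := isWeighted_of_isIrreducible (M := N) hH
        have h3 : (⟨m, hm⟩ : N) ∈ ⨆ μ, wt (act H N) μ := by rw [h2]; trivial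
        have h4 : ⨆ μ, wt (act H N) μ ≤ (⨆ μ, wt (act H M) μ).comap N.toSubmodule.subtype :=
          iSup_le fun μ z hz => Submodule.mem_iSup_of_mem μ
            (map_mem_wt (φ := N.toSubmodule.subtype) (fun _ _ => rfl) hz)
        exact h4 h3
      rw [← LieSubmodule.toSubmodule_eq_top] at h1
      exact h1
  · rintro ⟨h1, h2⟩
    rw [eq_top_iff]
    have key : ∀ μ, ∀ m ∈ wt (act H M) μ,
        m ∈ sSup {N : LieSubmodule k L M | FiniteDimensional k N ∧ IsAtom N} := by
      intro μ m hm
      obtain ⟨F, hF, hmF⟩ : m ∈ locallyFinitePart k L M := h1 ▸ LieSubmodule.mem_top m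
      -- Cutting `F` down to the vectors on which the centre acts through `μ` gives a submodule that
      -- still contains `m` and on which Weyl's theorem is available.
      let F' : LieSubmodule k L M :=
        { carrier := {x | x ∈ F ∧ ∀ z : L, ∀ hz : z ∈ LieAlgebra.center k L,
            ⁅z, x⁆ = μ ⟨z, hH.center_le hz⟩ • x}
          add_mem' := fun ha hb => ⟨add_mem ha.1 hb.1, fun z hz => by
            rw [lie_add, ha.2 z hz, hb.2 z hz, smul_add]⟩
          zero_mem' := ⟨zero_mem _, fun z hz => by rw [lie_zero, smul_zero]⟩
          smul_mem' := fun c x hx => ⟨F.smul_mem c hx.1, fun z hz => by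
            rw [lie_smul, hx.2 z hz, smul_comm]⟩
          lie_mem := by
            rintro x v ⟨hv, hv'⟩
            refine ⟨F.lie_mem hv, fun z hz => ?_⟩
            rw [leibniz_lie, ← lie_skew, (LieModule.mem_maxTrivSubmodule k L L z).1 hz x, neg_zero,
              zero_lie, zero_add, hv' z hz, lie_smul] }
      have hF' : FiniteDimensional k F' := by
        have : FiniteDimensional k F.toSubmodule := hF
        exact Submodule.finiteDimensional_of_le (S₂ := F.toSubmodule) fun x hx => hx.1
      have hmF' : m ∈ F' := ⟨hmF, fun z hz => hm ⟨z, hH.center_le hz⟩⟩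
      classical
      -- Only the values of `χ` on the centre matter; the default `0` elsewhere is arbitrary.
      have := hL.complementedLattice (M := F')
        (χ := fun z => if hz : z ∈ LieAlgebra.center k L then μ ⟨z, hH.center_le hz⟩ else 0)
        (fun z hz v => Subtype.ext (by
          rw [dif_pos hz]
          exact v.2.2 z hz))
      have hat : sSup {P : LieSubmodule k L F' | IsAtom P} = ⊤ := sSup_atoms_eq_top
      have h3 : (⊤ : LieSubmodule k L F') ≤ LieSubmodule.comap F'.incl
          (sSup {N : LieSubmodule k L M | FiniteDimensional k N ∧ IsAtom N}) := by
        rw [← hat]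
        refine sSup_le fun P hP p hp => ?_
        have : FiniteDimensional k F'.toSubmodule := hF'
        have hfd : FiniteDimensional k (P.map F'.incl).toSubmodule :=
          Submodule.finiteDimensional_of_le (S₂ := F'.toSubmodule) LieSubmodule.map_incl_le
        have hle : P.map F'.incl ≤
            sSup {N : LieSubmodule k L M | FiniteDimensional k N ∧ IsAtom N} :=
          le_sSup ⟨hfd, isAtom_map_incl hP⟩
        exact hle ((LieSubmodule.mem_map _).2 ⟨p, hp, rfl⟩)
      exact h3 (LieSubmodule.mem_top (⟨m, hmF'⟩ : F'))
    intro m _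
    obtain ⟨s, v, hv, rfl⟩ := h2.exists_sum m
    exact sum_mem fun μ _ => key μ _ (hv μ)

/-- Every root is part of an `sl(2)`-triple. -/
theorem exists_isSl2Triple [IsAlgClosed k] [CharZero k] [FiniteDimensional k L]
    (hL : IsReductive k L) (hH : IsSplitCartan H) {α : Module.Dual k H} (hα : α ≠ 0)
    (hα' : wt (act H L) α ≠ ⊥) : ∃ (y : H) (e f : L), IsSl2Triple (y : L) e f ∧
      e ∈ wt (act H L) α ∧ f ∈ wt (act H L) (-α) := by
  have := hL.isKilling
  let D := derivedIdeal k L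
  let H' : LieSubalgebra k D := H.comap D.incl
  have hH' : ∀ {x : D}, x ∈ H' ↔ (x : L) ∈ H := Iff.rfl
  -- `H` contains the centre, so it is the sum of the centre and `H ∩ D`. This reduces everything to
  -- the semisimple algebra `D`.
  have hdec : ∀ y ∈ H, ∃ z ∈ LieAlgebra.center k L, ∃ d : D, (d : L) ∈ H ∧ y = z + d := by
    intro y hy
    obtain ⟨z, hz, d, hd, rfl⟩ := (LieSubmodule.mem_sup _ _ y).1
      (hL.sup_eq_top ▸ LieSubmodule.mem_top y : y ∈ LieAlgebra.center k L ⊔ derivedIdeal k L)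
    refine ⟨z, hz, ⟨d, hd⟩, ?_, rfl⟩
    have := sub_mem hy (hH.center_le hz)
    rwa [add_sub_cancel_left] at this
  have hcen : ∀ {z : L}, z ∈ LieAlgebra.center k L → ∀ x : L, ⁅z, x⁆ = 0 := by
    intro z hz x
    rw [← lie_skew, (LieModule.mem_maxTrivSubmodule k L L z).1 hz x, neg_zero]
  have hab : IsLieAbelian H' :=
    ⟨fun x y => Subtype.ext (Subtype.ext (hH.lie_eq_zero x.2 y.2))⟩
  -- If `x` normalizes `H'`, all brackets `[y, x]` with `y ∈ H` lie in `H`, hence so do their weight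
  -- components `ν(y) x_ν`. Those of nonzero weight show `x_ν ∈ H`, while `x_0` centralizes `H`.
  have hcart : H'.IsCartanSubalgebra := by
    refine ⟨inferInstance, le_antisymm ?_ H'.le_normalizer⟩
    intro x hx
    rw [LieSubalgebra.mem_normalizer_iff] at hx
    rw [hH']
    have hx0 : ∀ y : H', ⁅(y : D), x⁆ ∈ H' := fun y => by
      rw [← lie_skew]; exact neg_mem (hx y y.2)
    obtain ⟨s, v, hv, hs⟩ := hH.isWeighted.exists_sum (x : L)
    classical
    have hxH : ∀ y : H, ⁅(y : L), (x : L)⁆ ∈ H := by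
      intro y
      obtain ⟨z, hz, d, hd, e⟩ := hdec y y.2
      rw [e, add_lie, hcen hz, zero_add]
      exact hx0 ⟨d, hd⟩
    rw [← hs]
    refine sum_mem fun μ hμ => ?_
    by_cases h0 : μ = 0
    · subst h0
      rw [hH.mem_iff]
      intro y
      have := hv 0 y
      rwa [LinearMap.zero_apply, zero_smul] at this
    · obtain ⟨y, hy⟩ : ∃ y, μ y ≠ 0 := by
        by_contra! h
        exact h0 (LinearMap.ext h)
      have h1 : ∑ ν ∈ s, ν y • v ν ∈ H.toSubmodule := by
        have := hxH y
        rw [← hs, lie_sum] at this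
        rwa [show ∑ ν ∈ s, ν y • v ν = ∑ ν ∈ s, ⁅(y : L), v ν⁆ from
          Finset.sum_congr rfl fun ν _ => (hv ν y).symm]
      have h2 := mem_of_sum_mem (ρ := act H L) (N := H.toSubmodule)
        (fun y v hv => H.lie_mem y.2 hv) s (fun ν => ν y • v ν)
        (fun ν _ => Submodule.smul_mem _ _ (hv ν)) h1 μ hμ
      exact (Submodule.smul_mem_iff _ hy).1 h2
  obtain ⟨x, hx, hx0⟩ := (Submodule.ne_bot_iff _).1 hα'
  -- A vector of nonzero weight is a multiple of a bracket `[y, x]`.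
  have hxD : x ∈ D := by
    obtain ⟨y, hy⟩ : ∃ y, α y ≠ 0 := by
      by_contra! h
      exact hα (LinearMap.ext h)
    have h1 : x = (α y)⁻¹ • ⁅(y : L), x⁆ := by
      rw [mem_wt_act.1 hx y, smul_smul, inv_mul_cancel₀ hy, one_smul]
    rw [h1]
    exact D.smul_mem _ (lie_mem_derivedIdeal _ _)
  let ι : H' →ₗ[k] H :=
    { toFun := fun y => ⟨((y : D) : L), y.2⟩
      map_add' := fun _ _ => rfl
      map_smul' := fun _ _ => rfl }
  have hαz : ∀ z (hz : z ∈ LieAlgebra.center k L), α ⟨z, hH.center_le hz⟩ = 0 := by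
    intro z hz
    have h := mem_wt_act.1 hx ⟨z, hH.center_le hz⟩
    rw [show ⁅((⟨z, hH.center_le hz⟩ : H) : L), x⁆ = 0 from hcen hz x] at h
    exact (smul_eq_zero.1 h.symm).resolve_right hx0
  -- Restricted to `H'`, the root `α` becomes a root of `D`, where the theory of semisimple algebras
  -- produces an `sl(2)`-triple.
  let w : LieModule.Weight k H' D := ⟨fun y => α (ι y), by
    rw [← (LieSubmodule.toSubmodule_eq_bot _).ne, Submodule.ne_bot_iff]
    refine ⟨⟨x, hxD⟩, ?_, fun h => hx0 (congrArg Subtype.val h)⟩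
    refine LieModule.weightSpace_le_genWeightSpace D _ ?_
    rw [LieModule.mem_weightSpace]
    intro y
    exact Subtype.ext (hx (ι y))⟩
  have hw : w.IsNonZero := by
    intro h
    apply hα
    refine LinearMap.ext fun y => ?_
    obtain ⟨z, hz, d, hd, e⟩ := hdec y y.2
    have h1 : y = ⟨z, hH.center_le hz⟩ + ι ⟨d, hd⟩ := Subtype.ext e
    rw [h1, map_add, hαz z hz, zero_add]
    exact congrFun h ⟨d, hd⟩
  obtain ⟨y, e, f, ht, he, hf⟩ := LieAlgebra.IsKilling.exists_isSl2Triple_of_weight_isNonZero hw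
  -- Since `α` vanishes on the centre and the centre acts by zero, weights for `H'` determine
  -- weights for `H`. Only `c = 1` and `c = -1` are needed.
  have hlift : ∀ (c : k) (x : D), (∀ y : H', ⁅(y : D), x⁆ = (c * w y) • x) →
      (x : L) ∈ wt (act H L) (c • α) := by
    intro c x hx y
    obtain ⟨z, hz, d, hd, e⟩ := hdec y y.2
    have h1 : y = ⟨z, hH.center_le hz⟩ + ι ⟨d, hd⟩ := Subtype.ext e
    rw [act_apply, e, add_lie, hcen hz, zero_add, h1, map_add, LinearMap.smul_apply, hαz z hz,
      smul_zero, zero_add]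
    exact congrArg Subtype.val (hx ⟨d, hd⟩)
  have he' : (e : L) ∈ wt (act H L) α := by
    have := hlift 1 e fun y => by
      rw [one_mul]
      exact LieAlgebra.IsKilling.lie_eq_smul_of_mem_rootSpace he y
    rwa [one_smul] at this
  have hf' : (f : L) ∈ wt (act H L) (-α) := by
    have := hlift (-1) f fun y => by
      rw [neg_one_mul]
      exact LieAlgebra.IsKilling.lie_eq_smul_of_mem_rootSpace hf y
    rwa [show (-1 : k) • α = -α from LinearMap.ext fun y => by simp] at this
  -- The element `y = [e, f]` has weight `α - α = 0`, so it centralizes `H`.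
  have hyH : (y : L) ∈ H := by
    rw [hH.mem_iff]
    intro y'
    have := mem_wt_act.1 (lie_mem_wt he' hf') y'
    rw [add_neg_cancel, LinearMap.zero_apply, zero_smul] at this
    rw [← ht.lie_e_f]
    exact this
  refine ⟨⟨y, hyH⟩, e, f, ⟨fun h => ht.h_ne_zero (Subtype.ext h), ?_, ?_, ?_⟩, he', hf'⟩
  · exact congrArg Subtype.val ht.lie_e_f
  · exact congrArg Subtype.val ht.lie_h_e_nsmul
  · exact congrArg Subtype.val ht.lie_h_f_nsmul

end SplitCartan

/-! ### Finite-dimensionality of integrable highest-weight modules over a reductive Lie algebra. -/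

section Integrable

open LieModule

/-! ### Subspaces generated by lowering operators -/

section Lowering

variable {k V : Type*} [Field k] [AddCommGroup V] [Module k V]

/-- The smallest subspace which contains `P` and is stable under the operators in `𝒩`. -/
def stableClosure (𝒩 : Set (Module.End k V)) (P : Submodule k V) : Submodule k V :=
  sInf {Q | P ≤ Q ∧ ∀ n ∈ 𝒩, ∀ q ∈ Q, n q ∈ Q}

variable {𝒩 ℬ : Set (Module.End k V)} {P : Submodule k V}

theorem le_stableClosure : P ≤ stableClosure 𝒩 P := le_sInf fun _ hQ => hQ.1

theorem stableClosure_le {Q : Submodule k V} (hP : P ≤ Q) (hQ : ∀ n ∈ 𝒩, ∀ q ∈ Q, n q ∈ Q) :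
    stableClosure 𝒩 P ≤ Q := sInf_le ⟨hP, hQ⟩

theorem stableClosure_stable {n : Module.End k V} (hn : n ∈ 𝒩) {v : V}
    (hv : v ∈ stableClosure 𝒩 P) : n v ∈ stableClosure 𝒩 P := by
  rw [stableClosure, Submodule.mem_sInf] at hv ⊢
  exact fun Q hQ => hQ.2 n hn v (hv Q hQ)

/-- If `ℬ` commutes with `𝒩` up to scalars and elements of `ℬ` and `𝒩`, and if `P` is stable under
`ℬ`, then so is the smallest subspace which contains `P` and is stable under `𝒩`. -/
theorem stableClosure_stable_of_comm (hP : ∀ b ∈ ℬ, ∀ p ∈ P, b p ∈ P)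
    (hcomm : ∀ b ∈ ℬ, ∀ n ∈ 𝒩, ∃ c : k, ∃ b' ∈ Submodule.span k ℬ, ∃ n' ∈ Submodule.span k 𝒩,
      b * n = c • (n * b) + b' + n') {b : Module.End k V} (hb : b ∈ ℬ) {v : V}
    (hv : v ∈ stableClosure 𝒩 P) : b v ∈ stableClosure 𝒩 P := by
  -- The set `R` of vectors of the closure that `ℬ` maps into the closure contains `P`. It is stable
  -- under `𝒩` by `b n v = c n (b v) + b' v + n' v`, so minimality of the closure applies.
  let R : Submodule k V :=
    { carrier := {v | v ∈ stableClosure 𝒩 P ∧ ∀ b ∈ ℬ, b v ∈ stableClosure 𝒩 P}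
      add_mem' := fun ha hb => ⟨add_mem ha.1 hb.1, fun x hx => by
        rw [map_add]; exact add_mem (ha.2 x hx) (hb.2 x hx)⟩
      zero_mem' := ⟨zero_mem _, fun x _ => by rw [map_zero]; exact zero_mem _⟩
      smul_mem' := fun c v hv => ⟨Submodule.smul_mem _ c hv.1, fun x hx => by
        rw [map_smul]; exact Submodule.smul_mem _ c (hv.2 x hx)⟩ }
  have hspan : ∀ {S : Set (Module.End k V)} {v : V}, (∀ s ∈ S, s v ∈ stableClosure 𝒩 P) →
      ∀ s ∈ Submodule.span k S, s v ∈ stableClosure 𝒩 P := by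
    intro S v h s hs
    induction hs using Submodule.span_induction with
    | mem s hs => exact h s hs
    | zero => exact zero_mem _
    | add a b _ _ ha hb => exact add_mem ha hb
    | smul c a _ ha => exact Submodule.smul_mem _ c ha
  have h : stableClosure 𝒩 P ≤ R := by
    refine stableClosure_le (fun p hp => ⟨le_stableClosure hp, fun b hb =>
      le_stableClosure (hP b hb p hp)⟩) ?_
    rintro n hn v ⟨hv, hv'⟩
    refine ⟨stableClosure_stable hn hv, fun b hb => ?_⟩
    obtain ⟨c, b', hb', n', hn', e⟩ := hcomm b hb n hn
    change (b * n) v ∈ _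
    rw [e, LinearMap.add_apply, LinearMap.add_apply, LinearMap.smul_apply, Module.End.mul_apply]
    exact add_mem (add_mem (Submodule.smul_mem _ c (stableClosure_stable hn (hv' b hb)))
      (hspan hv' b' hb')) (hspan (fun n hn => stableClosure_stable hn hv) n' hn')
  exact (h hv).2 b hb

end Lowering

variable {k : Type u} {L : Type u} [Field k] [LieRing L] [LieAlgebra k L]
  {H : LieSubalgebra k L} {X : Type*} [AddCommGroup X] [Module k X] [LieRingModule L X]
  [LieModule k L X]

theorem iSupIndep_wt {V W : Type*} [AddCommGroup V] [Module k V] [AddCommGroup W] [Module k W]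
    (ρ : V →ₗ[k] Module.End k W) : iSupIndep (wt ρ) := by
  rw [iSupIndep_def]
  intro μ
  rw [Submodule.disjoint_def]
  intro x hx hx'
  exact mem_of_mem_sup_wt (A := ⊥) (S := {ν | ν ≠ μ}) bot_le (by simp) le_rfl hx
    (Submodule.mem_sup_right hx')

/-- The weights of a module. -/
def weights (H : LieSubalgebra k L) (X : Type*) [AddCommGroup X] [Module k X] [LieRingModule L X]
    [LieModule k L X] : Set (Module.Dual k H) := {μ | wt (act H X) μ ≠ ⊥}

theorem mem_weights {μ : Module.Dual k H} {x : X} (hx : x ∈ wt (act H X) μ) (hx0 : x ≠ 0) :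
    μ ∈ weights H X := (Submodule.ne_bot_iff _).2 ⟨x, hx, hx0⟩

theorem finite_weights [FiniteDimensional k X] : (weights H X).Finite :=
  WellFoundedGT.finite_ne_bot_of_iSupIndep (iSupIndep_wt (act H X))

theorem pow_mem_wt {α μ : Module.Dual k H} {x : L} (hx : x ∈ wt (act H L) α) {v : X}
    (hv : v ∈ wt (act H X) μ) (n : ℕ) : (toEnd k L X x ^ n) v ∈ wt (act H X) (μ + n • α) := by
  induction n with
  | zero => simpa using hv
  | succ n ih =>
    rw [pow_succ', Module.End.mul_apply, succ_nsmul', ← add_assoc, add_comm μ α, add_assoc]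
    exact lie_mem_wt hx ih

/-- `x` acts locally nilpotently. -/
def IsLocallyNilpotent (k : Type*) {L : Type*} [Field k] [LieRing L] [LieAlgebra k L] (X : Type*)
    [AddCommGroup X] [Module k X] [LieRingModule L X] [LieModule k L X] (x : L) : Prop :=
  ∀ v : X, ∃ n : ℕ, (toEnd k L X x ^ n) v = 0

theorem pow_apply_eq_zero_of_le {x : Module.End k X} {v : X} {m n : ℕ} (h : m ≤ n)
    (hm : (x ^ m) v = 0) : (x ^ n) v = 0 := by
  rw [← Nat.sub_add_cancel h, pow_add, Module.End.mul_apply, hm, map_zero]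

/-- The `n`-th power of `x` moves weight `μ` to `μ + n α`, which fails to be a weight for some `n`.
The vectors killed by some power form a subspace, so weight vectors suffice. -/
theorem isLocallyNilpotent_of_wt (hX : IsWeighted (act H X)) {α : Module.Dual k H} {x : L}
    (hx : x ∈ wt (act H L) α) (h : ∀ μ, {n : ℕ | μ + n • α ∈ weights H X}.Finite) :
    IsLocallyNilpotent k X x := by
  intro v
  let R : Submodule k X :=
    { carrier := {v | ∃ n : ℕ, (toEnd k L X x ^ n) v = 0}
      add_mem' := by
        rintro a b ⟨m, hm⟩ ⟨n, hn⟩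
        refine ⟨max m n, ?_⟩
        rw [map_add, pow_apply_eq_zero_of_le (le_max_left _ _) hm,
          pow_apply_eq_zero_of_le (le_max_right _ _) hn, add_zero]
      zero_mem' := ⟨0, map_zero _⟩
      smul_mem' := by
        rintro c v ⟨n, hn⟩
        exact ⟨n, by rw [map_smul, hn, smul_zero]⟩ }
  have hR : ⨆ μ, wt (act H X) μ ≤ R := by
    refine iSup_le fun μ v hv => ?_
    obtain ⟨n, hn⟩ := (h μ).exists_notMem
    refine ⟨n, ?_⟩
    by_contra h0
    exact hn (mem_weights (pow_mem_wt hx hv n) h0)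
  exact hR (hX ▸ Submodule.mem_top : v ∈ ⨆ μ, wt (act H X) μ)

theorem finite_string [CharZero k] {S : Set (Module.Dual k H)} (hS : S.Finite)
    {α : Module.Dual k H} (hα : α ≠ 0) (μ : Module.Dual k H) : {n : ℕ | μ + n • α ∈ S}.Finite := by
  refine hS.preimage (f := fun n : ℕ => μ + n • α) (Function.Injective.injOn fun m n h => ?_)
  have h1 := add_left_cancel h
  rw [← Nat.cast_smul_eq_nsmul k, ← Nat.cast_smul_eq_nsmul k] at h1
  exact Nat.cast_injective (smul_left_injective k hα h1)

/-- The vectors on which a locally ad-nilpotent element acts nilpotently. -/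
def nilpotentPart (X : Type*) [AddCommGroup X] [Module k X] [LieRingModule L X] [LieModule k L X]
    {x : L} (hx : IsLocallyNilpotent k L x) : LieSubmodule k L X where
  carrier := {v | ∃ n : ℕ, (toEnd k L X x ^ n) v = 0}
  add_mem' := by
    rintro a b ⟨m, hm⟩ ⟨n, hn⟩
    refine ⟨max m n, ?_⟩
    rw [map_add, pow_apply_eq_zero_of_le (le_max_left _ _) hm,
      pow_apply_eq_zero_of_le (le_max_right _ _) hn, add_zero]
  zero_mem' := ⟨0, map_zero _⟩
  smul_mem' := by
    rintro c v ⟨n, hn⟩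
    exact ⟨n, by rw [map_smul, hn, smul_zero]⟩
  lie_mem := by
    rintro y v ⟨n, hn⟩
    obtain ⟨m, hm⟩ := hx y
    refine ⟨m + n, ?_⟩
    -- In the Leibniz expansion of `x^(m+n) [y, v]`, each term has either at least `m` factors `x`
    -- on `y` or more than `n` on `v`.
    rw [toEnd_pow_lie]
    refine Finset.sum_eq_zero fun ij hij => ?_
    rw [Finset.HasAntidiagonal.mem_antidiagonal] at hij
    rcases le_or_gt m ij.1 with h | h
    · have : ((LieAlgebra.ad k L) x ^ ij.1) y = 0 := pow_apply_eq_zero_of_le h hm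
      rw [this, zero_lie, smul_zero]
    · rw [pow_apply_eq_zero_of_le (by omega) hn, lie_zero, smul_zero]

/-! ### The action of the Weyl group on the weights -/

theorem IsSl2Triple.wt_apply [CharZero k] {α : Module.Dual k H} {y : H} {e g : L}
    (ht : IsSl2Triple (y : L) e g) (he : e ∈ wt (act H L) α) : α y = 2 := by
  have h := mem_wt_act.1 he y
  rw [ht.lie_h_e_smul k] at h
  exact (smul_left_injective k ht.e_ne_zero h).symm

/-- Here `p` is the last exponent with `e^p v ≠ 0`, and `q` the last with `g^q e^p v ≠ 0`. The
primitive vector `e^p v` has `h`-eigenvalue `μ(y) + 2p`, and the end of its string identifies this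
with `q`. If `p ≤ q`, the vector `g^(q-p) e^p v` is nonzero and has the reflected weight. -/
theorem exists_string [CharZero k] {α μ : Module.Dual k H} {y : H} {e g : L}
    (ht : IsSl2Triple (y : L) e g) (he : e ∈ wt (act H L) α) (hg : g ∈ wt (act H L) (-α))
    (heX : IsLocallyNilpotent k X e) (hgX : IsLocallyNilpotent k X g) (hμ : μ ∈ weights H X) :
    ∃ p q : ℕ, μ y = q - 2 * p ∧ (p ≤ q → μ - μ y • α ∈ weights H X) := by
  obtain ⟨v, hv, hv0⟩ := (Submodule.ne_bot_iff _).1 hμ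
  obtain ⟨p, hp, hp'⟩ := Nat.exists_not_and_succ_of_not_zero_of_exists
    (p := fun n => (toEnd k L X e ^ n) v = 0) hv0 (heX v)
  obtain ⟨q, hq, hq'⟩ := Nat.exists_not_and_succ_of_not_zero_of_exists
    (p := fun n => (toEnd k L X g ^ n) ((toEnd k L X e ^ p) v) = 0) hp (hgX _)
  have hu := pow_mem_wt he hv p
  have hα := IsSl2Triple.wt_apply ht he
  have P : ht.HasPrimitiveVectorWith ((toEnd k L X e ^ p) v) (μ y + 2 * p : k) :=
    { ne_zero := hp
      lie_h := by
        rw [mem_wt_act.1 hu y, LinearMap.add_apply, LinearMap.smul_apply, hα, nsmul_eq_mul, mul_comm]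
      lie_e := by rw [pow_succ', Module.End.mul_apply] at hp'; exact hp' }
  -- `e g^(q+1) u = (q+1)(μ(y) + 2p - q) g^q u`, where the left side is zero and `g^q u` is not.
  have h := P.lie_e_pow_succ_toEnd_f q
  rw [hq', lie_zero] at h
  have h1 := (smul_eq_zero.1 h.symm).resolve_right hq
  have h2 : μ y + 2 * p - q = 0 := (mul_eq_zero.1 h1).resolve_left (Nat.cast_add_one_ne_zero q)
  have h3 : μ y = q - 2 * p := by linear_combination h2
  refine ⟨p, q, h3, fun hpq => ?_⟩
  have hz := pow_mem_wt hg hu (q - p)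
  have hz0 : (toEnd k L X g ^ (q - p)) ((toEnd k L X e ^ p) v) ≠ 0 := fun h0 =>
    hq (pow_apply_eq_zero_of_le (Nat.sub_le q p) h0)
  have := mem_weights hz hz0
  convert this using 1
  refine LinearMap.ext fun z => ?_
  simp only [h3, LinearMap.sub_apply, LinearMap.add_apply, LinearMap.smul_apply, smul_eq_mul,
    nsmul_eq_mul, LinearMap.neg_apply, Nat.cast_sub hpq]
  ring

/-- The set of weights is stable under the reflection `μ ↦ μ - μ(h) α`. -/
theorem sub_smul_mem_weights [CharZero k] {α μ : Module.Dual k H} {y : H} {e g : L}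
    (ht : IsSl2Triple (y : L) e g) (he : e ∈ wt (act H L) α) (hg : g ∈ wt (act H L) (-α))
    (heX : IsLocallyNilpotent k X e) (hgX : IsLocallyNilpotent k X g) (hμ : μ ∈ weights H X) :
    (∃ n : ℤ, μ y = n) ∧ μ - μ y • α ∈ weights H X := by
  obtain ⟨p, q, h1, h2⟩ := exists_string ht he hg heX hgX hμ
  refine ⟨⟨q - 2 * p, by rw [h1]; push_cast; rfl⟩, ?_⟩
  rcases le_or_gt p q with h | h
  · exact h2 h
  -- For `q < p` the opposite triple is used. It defines the same reflection, and comparing the two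
  -- values of `μ(y)` gives `q' - 2p' = 2p - q > 0`, so its inequality `p' ≤ q'` holds.
  have ht' : IsSl2Triple ((-y : H) : L) g e := ht.symm
  obtain ⟨p', q', h1', h2'⟩ := exists_string (α := -α) ht' hg (by rwa [neg_neg]) hgX heX hμ
  rw [map_neg, neg_smul_neg] at h2'
  refine h2' ?_
  rw [map_neg, h1] at h1'
  have h3 : ((-(q - 2 * p) : ℤ) : k) = ((q' - 2 * p' : ℤ) : k) := by push_cast; exact h1'
  have h4 := Int.cast_injective h3
  omega

/-- The roots of `L`. -/
def lieRoots (H : LieSubalgebra k L) : Set (Module.Dual k H) := {α | α ≠ 0 ∧ α ∈ weights H L}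

theorem finite_lieRoots [FiniteDimensional k L] : (lieRoots H).Finite :=
  finite_weights.subset fun _ h => h.2

theorem isLocallyNilpotent_ad [CharZero k] [FiniteDimensional k L] (hH : IsSplitCartan H)
    {α : Module.Dual k H} (hα : α ≠ 0) {x : L} (hx : x ∈ wt (act H L) α) :
    IsLocallyNilpotent k L x :=
  isLocallyNilpotent_of_wt hH.isWeighted hx fun μ => finite_string finite_weights hα μ

theorem mem_lieRoots_of_triple {α : Module.Dual k H} {y : H} {e g : L} [CharZero k]
    (ht : IsSl2Triple (y : L) e g) (he : e ∈ wt (act H L) α) : α ∈ lieRoots H := by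
  refine ⟨?_, mem_weights he ht.e_ne_zero⟩
  rintro rfl
  have := IsSl2Triple.wt_apply ht he
  simp at this

theorem root_reflect [CharZero k] [FiniteDimensional k L] (hH : IsSplitCartan H)
    {α β : Module.Dual k H} {y : H} {e g : L} (ht : IsSl2Triple (y : L) e g)
    (he : e ∈ wt (act H L) α) (hg : g ∈ wt (act H L) (-α)) (hβ : β ∈ weights H L) :
    (∃ n : ℤ, β y = n) ∧ β - β y • α ∈ weights H L := by
  have hα := (mem_lieRoots_of_triple ht he).1
  exact sub_smul_mem_weights ht he hg (isLocallyNilpotent_ad hH hα he)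
    (isLocallyNilpotent_ad hH (neg_ne_zero.2 hα) hg) hβ

/-! ### Positivity -/

theorem exists_weight_basis [FiniteDimensional k L] (hH : IsSplitCartan H) :
    ∃ (ι : Type u) (_ : Fintype ι) (b : Module.Basis ι k L) (μ : ι → Module.Dual k H),
      ∀ i, b i ∈ wt (act H L) (μ i) := by
  have hs : ⊤ ≤ Submodule.span k {x : L | ∃ μ, x ∈ wt (act H L) μ} := by
    rw [← hH.isWeighted]
    exact iSup_le fun μ x hx => Submodule.subset_span ⟨μ, hx⟩
  let b := Module.Basis.ofSpan hs
  have hb : ∀ i, ∃ μ, b i ∈ wt (act H L) μ := fun i =>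
    Module.Basis.ofSpan_subset hs ⟨i, rfl⟩
  choose μ hμ using hb
  exact ⟨_, FiniteDimensional.fintypeBasisIndex b, b, μ, hμ⟩

/-- In a basis of weight vectors, `(ad y)²` is diagonal with entries squares of integers, and `[y,
e] = 2e` prevents all of them from vanishing. -/
theorem killingForm_self_pos [CharZero k] [FiniteDimensional k L] (hH : IsSplitCartan H)
    {α : Module.Dual k H} {y : H} {e g : L} (ht : IsSl2Triple (y : L) e g)
    (he : e ∈ wt (act H L) α) (hg : g ∈ wt (act H L) (-α)) :
    ∃ N : ℤ, 0 < N ∧ killingForm k L y y = N := by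
  classical
  obtain ⟨ι, _, b, μ, hb⟩ := exists_weight_basis hH
  have hn : ∀ i, ∃ n : ℤ, μ i y = n := fun i =>
    (root_reflect hH ht he hg (mem_weights (hb i) (b.ne_zero i))).1
  choose n hn using hn
  have hbn : ∀ i, ⁅(y : L), b i⁆ = (n i : k) • b i := fun i => by
    rw [mem_wt_act.1 (hb i) y, hn]
  refine ⟨∑ i, n i ^ 2, ?_, ?_⟩
  · obtain ⟨i, hi⟩ : ∃ i, n i ≠ 0 := by
      by_contra! h
      have h0 : LieAlgebra.ad k L (y : L) = 0 := b.ext fun i => by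
        rw [LieAlgebra.ad_apply, hbn, h, Int.cast_zero, zero_smul, LinearMap.zero_apply]
      have h1 := ht.lie_h_e_smul k
      rw [← LieAlgebra.ad_apply (R := k), h0, LinearMap.zero_apply] at h1
      exact (smul_eq_zero.1 h1.symm).elim two_ne_zero ht.e_ne_zero
    exact Finset.sum_pos' (fun i _ => sq_nonneg _) ⟨i, Finset.mem_univ i, by positivity⟩
  · rw [killingForm_apply_apply, LinearMap.trace_eq_matrix_trace k b, Matrix.trace, Int.cast_sum]
    refine Finset.sum_congr rfl fun i _ => ?_
    rw [Matrix.diag_apply, LinearMap.toMatrix_apply, LinearMap.comp_apply, LieAlgebra.ad_apply,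
      LieAlgebra.ad_apply, hbn, lie_smul, hbn, smul_smul, map_smul, Module.Basis.repr_self,
      Finsupp.smul_single, Finsupp.single_eq_same, smul_eq_mul, mul_one]
    push_cast
    ring

/-- By invariance `κ([e, g], z) = κ(e, [g, z])`, so up to a factor the coroot represents `α` under
the Killing form. -/
theorem killingForm_triple {α : Module.Dual k H} {y : H} {e g : L}
    (ht : IsSl2Triple (y : L) e g) (hg : g ∈ wt (act H L) (-α)) (z : H) :
    killingForm k L y z = α z * killingForm k L e g := by
  have h := mem_wt_act.1 hg z
  rw [LinearMap.neg_apply, neg_smul] at h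
  rw [← ht.lie_e_f, LieModule.traceForm_apply_lie_apply, ← lie_skew, h, neg_neg, map_smul,
    smul_eq_mul]

/-- The pairings of two roots with each other's coroots have the same sign. -/
theorem pairing_pos [CharZero k] [FiniteDimensional k L] (hH : IsSplitCartan H)
    {α β : Module.Dual k H} {y z : H} {e g e' g' : L}
    (ht : IsSl2Triple (y : L) e g) (he : e ∈ wt (act H L) α) (hg : g ∈ wt (act H L) (-α))
    (ht' : IsSl2Triple (z : L) e' g') (he' : e' ∈ wt (act H L) β) (hg' : g' ∈ wt (act H L) (-β))
    {p q : ℤ} (hp : β y = p) (hq : α z = q) (hq0 : 0 < q) : 0 < p := by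
  obtain ⟨N, hN, eN⟩ := killingForm_self_pos hH ht he hg
  obtain ⟨N', hN', eN'⟩ := killingForm_self_pos hH ht' he' hg'
  rw [killingForm_triple ht hg, IsSl2Triple.wt_apply ht he] at eN
  rw [killingForm_triple ht' hg', IsSl2Triple.wt_apply ht' he'] at eN'
  have h1 := killingForm_triple ht hg z
  rw [LieModule.traceForm_comm, killingForm_triple ht' hg', hp, hq] at h1
  -- Both sides are twice `κ(y, z)`, computed from either triple using `N = 2 κ(e, g)` and `N' = 2
  -- κ(e', g')`.
  have h2 : (p : k) * N' = q * N := by rw [← eN, ← eN']; linear_combination 2 * h1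
  have h3 : p * N' = q * N := by exact_mod_cast h2
  have h4 : 0 < p * N' := by rw [h3]; positivity
  exact pos_of_mul_pos_left h4 hN'.le

/-! ### Positive systems -/

variable (f : Module.Dual k H →+ ℝ)

/-- The positive roots for a functional `f`. -/
def posRoots : Set (Module.Dual k H) := {α ∈ lieRoots H | 0 < f α}

/-- The positive roots which are not sums of two positive roots. -/
def simpleRoots : Set (Module.Dual k H) :=
  {α ∈ posRoots f | ¬ ∃ β ∈ posRoots f, ∃ γ ∈ posRoots f, α = β + γ}

variable {f}

/-- There are finitely many positive roots, so the order of their `f`-values is well-founded even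
though `f` is real-valued. -/
theorem posRoots_induction [FiniteDimensional k L] {p : Module.Dual k H → Prop}
    (h : ∀ β ∈ posRoots f, (∀ γ ∈ posRoots f, f γ < f β → p γ) → p β) : ∀ β ∈ posRoots f, p β := by
  have hfin : (posRoots f).Finite := finite_lieRoots.subset fun _ h => h.1
  have : IsStrictOrder (Module.Dual k H) (fun a b => f a < f b) :=
    { irrefl := fun a => lt_irrefl (f a)
      trans := fun a b c => lt_trans }
  intro β hβ
  exact hfin.wellFoundedOn.induction (r := fun a b => f a < f b) hβ h

theorem posRoots_subset_closure [FiniteDimensional k L] :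
    ∀ β ∈ posRoots f, β ∈ AddSubmonoid.closure (simpleRoots f) := by
  refine posRoots_induction fun β hβ ih => ?_
  by_cases hs : β ∈ simpleRoots f
  · exact AddSubmonoid.subset_closure hs
  · have : ∃ γ ∈ posRoots f, ∃ δ ∈ posRoots f, β = γ + δ := by
      by_contra h
      exact hs ⟨hβ, h⟩
    obtain ⟨γ, hγ, δ, hδ, rfl⟩ := this
    rw [map_add] at ih
    exact add_mem (ih γ hγ (lt_add_of_pos_right _ hδ.2)) (ih δ hδ (lt_add_of_pos_left _ hγ.2))

/-- Every positive root pairs positively with some simple coroot. -/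
theorem exists_simple_pairing_pos [IsAlgClosed k] [CharZero k] [FiniteDimensional k L]
    (hL : IsReductive k L) (hH : IsSplitCartan H) {β : Module.Dual k H} (hβ : β ∈ posRoots f) :
    ∃ α ∈ simpleRoots f, ∀ (y : H) (e g : L), IsSl2Triple (y : L) e g → e ∈ wt (act H L) α →
      g ∈ wt (act H L) (-α) → ∃ n : ℕ, 0 < n ∧ β y = n := by
  obtain ⟨z, e', g', ht', he', hg'⟩ := exists_isSl2Triple hL hH hβ.1.1 hβ.1.2
  obtain ⟨α, hα, hpos⟩ : ∃ α ∈ simpleRoots f, ∃ q : ℤ, 0 < q ∧ α z = q := by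
    -- If no simple root were positive on the coroot `z` of `β`, then neither would be `β`, a sum of
    -- simple roots; but `β(z) = 2`.
    by_contra! h
    have h1 : AddSubmonoid.closure (simpleRoots f) ≤
        { carrier := {γ : Module.Dual k H | ∃ q : ℤ, q ≤ 0 ∧ γ z = q}
          add_mem' := by
            rintro a b ⟨m, hm, em⟩ ⟨n, hn, en⟩
            exact ⟨m + n, by omega, by rw [LinearMap.add_apply, em, en]; push_cast; rfl⟩
          zero_mem' := ⟨0, le_rfl, by simp⟩ } := by
      rw [AddSubmonoid.closure_le]
      intro γ hγ
      obtain ⟨q, hq⟩ := (root_reflect hH ht' he' hg' hγ.1.1.2).1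
      refine ⟨q, ?_, hq⟩
      by_contra hq0
      exact h γ hγ q (by omega) hq
    obtain ⟨q, hq, hq'⟩ := h1 (posRoots_subset_closure β hβ)
    rw [IsSl2Triple.wt_apply ht' he'] at hq'
    have : (2 : ℤ) = q := by exact_mod_cast hq'
    omega
  obtain ⟨q, hq0, hq⟩ := hpos
  refine ⟨α, hα, fun y e g ht he hg => ?_⟩
  obtain ⟨p, hp⟩ := (root_reflect hH ht he hg hβ.1.2).1
  have := pairing_pos hH ht he hg ht' he' hg' hp hq hq0
  exact ⟨p.toNat, by omega, by rw [hp, ← Int.cast_natCast, Int.toNat_of_nonneg this.le]⟩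

/-- In a weighted module with bounded weights on which the simple root vectors act locally
nilpotently, all strings of weights are finite. -/
theorem finite_strings [IsAlgClosed k] [CharZero k] [FiniteDimensional k L]
    (hL : IsReductive k L) (hH : IsSplitCartan H) (hf : ∀ α ∈ lieRoots H, f α ≠ 0)
    {c : ℝ} (hc : ∀ μ ∈ weights H X, f μ ≤ c)
    (hX : IsWeighted (act H X))
    (hs : ∀ α ∈ simpleRoots f, ∃ (y : H) (e g : L), IsSl2Triple (y : L) e g ∧
      e ∈ wt (act H L) α ∧ g ∈ wt (act H L) (-α) ∧ IsLocallyNilpotent k X g) :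
    ∀ β ∈ posRoots f, ∀ μ, {n : ℕ | μ + n • (-β) ∈ weights H X}.Finite := by
  -- Strings in a direction where `f` increases are cut off by the bound `c`.
  have hpos : ∀ β : Module.Dual k H, 0 < f β → ∀ μ, {n : ℕ | μ + n • β ∈ weights H X}.Finite := by
    intro β hβ μ
    obtain ⟨N, hN⟩ := exists_nat_gt ((c - f μ) / f β)
    refine (Set.finite_Iio N).subset fun n hn => ?_
    have h1 := hc _ hn
    rw [map_add, map_nsmul, nsmul_eq_mul, ← le_sub_iff_add_le', ← le_div_iff₀ hβ] at h1
    exact Nat.cast_lt.1 (h1.trans_lt hN)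
  -- The simple reflection permutes the weights, so it carries the string in direction `γ` to a
  -- string in the reflected direction, with the same parameters `n`.
  have hrefl : ∀ α ∈ simpleRoots f, ∀ (y : H) (e g : L), IsSl2Triple (y : L) e g →
      e ∈ wt (act H L) α → g ∈ wt (act H L) (-α) → IsLocallyNilpotent k X g → ∀ γ,
      (∀ μ, {n : ℕ | μ + n • (γ - γ y • α) ∈ weights H X}.Finite) →
      ∀ μ, {n : ℕ | μ + n • γ ∈ weights H X}.Finite := by
    intro α hα y e g ht he hg hgX γ h μ
    have heX : IsLocallyNilpotent k X e := isLocallyNilpotent_of_wt hX he (hpos α hα.1.2)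
    refine (h (μ - μ y • α)).subset fun n hn => ?_
    have h1 := (sub_smul_mem_weights ht he hg heX hgX hn).2
    have h2 : μ + n • γ - (μ + n • γ) y • α = μ - μ y • α + n • (γ - γ y • α) := by
      ext z
      simp only [LinearMap.sub_apply, LinearMap.add_apply, LinearMap.smul_apply, smul_eq_mul,
        nsmul_eq_mul]
      ring
    rwa [h2] at h1
  refine posRoots_induction fun β hβ ih => ?_
  obtain ⟨α, hα, hp⟩ := exists_simple_pairing_pos hL hH hβ
  obtain ⟨y, e, g, ht, he, hg, hgX⟩ := hs α hα
  obtain ⟨n, hn0, hn⟩ := hp y e g ht he hg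
  -- Since `β(y) > 0`, the reflected root `β - β(y) α` has a smaller `f`-value than `β`, which is
  -- what the induction needs.
  refine hrefl α hα y e g ht he hg hgX (-β) ?_
  have hs : β - β y • α ∈ weights H L := (root_reflect hH ht he hg hβ.1.2).2
  have e1 : -β - (-β) y • α = -(β - β y • α) := by
    refine LinearMap.ext fun z => ?_
    simp only [LinearMap.sub_apply, LinearMap.smul_apply, smul_eq_mul, LinearMap.neg_apply]
    ring
  rw [e1]
  have hfs : f (β - β y • α) < f β := by
    rw [map_sub, hn, Nat.cast_smul_eq_nsmul, map_nsmul, nsmul_eq_mul]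
    have := mul_pos (Nat.cast_pos (α := ℝ).2 hn0) hα.1.2
    linarith
  -- If the reflected root were zero, then `β = n α` would give `n = β(y) = 2n`, contrary to `n >
  -- 0`.
  by_cases h0 : β - β y • α = 0
  · have hneg : 0 < f (-(-α)) := by rw [neg_neg]; exact hα.1.2
    rw [h0, neg_zero]
    have hβn : β = n • α := by rw [sub_eq_zero, hn, Nat.cast_smul_eq_nsmul] at h0; exact h0
    have h2 : β y = n * 2 := by
      rw [hβn, LinearMap.smul_apply, IsSl2Triple.wt_apply ht he, nsmul_eq_mul]
    rw [hn] at h2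
    have h3 : n = n * 2 := by exact_mod_cast h2
    omega
  -- If the reflected root is negative, its opposite is an increasing direction; if it is positive,
  -- the induction hypothesis applies.
  rcases lt_or_gt_of_ne (hf _ ⟨h0, hs⟩) with h | h
  · exact hpos _ (by rw [map_neg]; linarith)
  · exact ih _ ⟨⟨h0, hs⟩, h⟩ hfs

/-! ### Finite-dimensionality -/

/-- All `b^n q`, with `q` in a finite spanning set of `Q`, span a finite-dimensional space because
`b` is locally nilpotent. It stays stable under `I` by `x b v = [x, b] v + b x v` and `[I, b] ⊆ I`.
-/
theorem exists_stable_adjoin (I : Submodule k L) {b : L} (hb : ∀ x ∈ I, ⁅x, b⁆ ∈ I)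
    (hbX : IsLocallyNilpotent k X b) {Q : Submodule k X} [FiniteDimensional k Q]
    (hQ : ∀ x ∈ I, ∀ q ∈ Q, ⁅x, q⁆ ∈ Q) :
    ∃ Q' : Submodule k X, FiniteDimensional k Q' ∧ Q ≤ Q' ∧ (∀ x ∈ I, ∀ q ∈ Q', ⁅x, q⁆ ∈ Q') ∧
      ∀ q ∈ Q', ⁅b, q⁆ ∈ Q' := by
  classical
  obtain ⟨B, hB⟩ : ∃ B : Finset X, Submodule.span k ↑B = Q :=
    (Submodule.fg_iff_finiteDimensional Q).2 inferInstance
  let S : Set X := ⋃ q ∈ B, Set.range fun n : ℕ => (toEnd k L X b ^ n) q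
  have hS : S.Finite := by
    refine Set.Finite.biUnion B.finite_toSet fun q _ => ?_
    obtain ⟨N, hN⟩ := hbX q
    refine (((Finset.range N).image fun n => (toEnd k L X b ^ n) q).finite_toSet.union
      (Set.finite_singleton 0)).subset ?_
    rintro _ ⟨n, rfl⟩
    rcases lt_or_ge n N with h | h
    · exact Or.inl (Finset.mem_coe.2 (Finset.mem_image_of_mem _ (Finset.mem_range.2 h)))
    · exact Or.inr (pow_apply_eq_zero_of_le h hN)
  have hQS : Q ≤ Submodule.span k S := by
    rw [← hB]
    exact Submodule.span_mono fun q hq => Set.mem_biUnion hq ⟨0, rfl⟩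
  have hstab : ∀ x : L, (∀ q ∈ S, ⁅x, q⁆ ∈ Submodule.span k S) →
      ∀ q ∈ Submodule.span k S, ⁅x, q⁆ ∈ Submodule.span k S := by
    intro x h q hq
    induction hq using Submodule.span_induction with
    | mem q hq => exact h q hq
    | zero => rw [lie_zero]; exact zero_mem _
    | add a b _ _ ha hb => rw [lie_add]; exact add_mem ha hb
    | smul c a _ ha => rw [lie_smul]; exact Submodule.smul_mem _ c ha
  have hb' : ∀ q ∈ Submodule.span k S, ⁅b, q⁆ ∈ Submodule.span k S := by
    refine hstab b fun q hq => ?_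
    obtain ⟨q₀, hq₀, n, rfl⟩ := Set.mem_iUnion₂.1 hq
    refine Submodule.subset_span (Set.mem_biUnion hq₀ ⟨n + 1, ?_⟩)
    exact congrArg (fun e : Module.End k X => e q₀) (pow_succ' (toEnd k L X b) n)
  refine ⟨Submodule.span k S, FiniteDimensional.span_of_finite k hS, hQS, fun x hx =>
    hstab x fun q hq => ?_, hb'⟩
  obtain ⟨q₀, hq₀, n, rfl⟩ := Set.mem_iUnion₂.1 hq
  induction n generalizing x with
  | zero => exact hQS (hQ x hx q₀ (hB ▸ Submodule.subset_span hq₀))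
  | succ n ih =>
    have e : (fun n : ℕ => (toEnd k L X b ^ n) q₀) (n + 1) = ⁅b, (toEnd k L X b ^ n) q₀⁆ :=
      congrArg (fun e : Module.End k X => e q₀) (pow_succ' (toEnd k L X b) n)
    rw [e, leibniz_lie]
    exact add_mem (ih _ (hb x hx) (Set.mem_biUnion hq₀ ⟨n, rfl⟩))
      (hb' _ (ih x hx (Set.mem_biUnion hq₀ ⟨n, rfl⟩)))

/-- The elements of a finite spanning set of `E` are adjoined one at a time. Each of them maps `I`,
enlarged by its predecessors, into `I`. -/
theorem exists_stable_sup (I E : Submodule k L) [FiniteDimensional k E]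
    (hEI : ∀ x ∈ I, ∀ b ∈ E, ⁅x, b⁆ ∈ I) (hEE : ∀ x ∈ E, ∀ b ∈ E, ⁅x, b⁆ ∈ I)
    (hE : ∀ b ∈ E, IsLocallyNilpotent k X b) {Q : Submodule k X} [FiniteDimensional k Q]
    (hQ : ∀ x ∈ I, ∀ q ∈ Q, ⁅x, q⁆ ∈ Q) :
    ∃ Q' : Submodule k X, FiniteDimensional k Q' ∧ Q ≤ Q' ∧ (∀ x ∈ I, ∀ q ∈ Q', ⁅x, q⁆ ∈ Q') ∧
      ∀ x ∈ E, ∀ q ∈ Q', ⁅x, q⁆ ∈ Q' := by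
  classical
  obtain ⟨B, hB⟩ : ∃ B : Finset L, Submodule.span k ↑B = E :=
    (Submodule.fg_iff_finiteDimensional E).2 inferInstance
  suffices h : ∀ B' : Finset L, (B' : Set L) ⊆ E → ∃ Q' : Submodule k X, FiniteDimensional k Q' ∧
      Q ≤ Q' ∧ ∀ x ∈ I ⊔ Submodule.span k (B' : Set L), ∀ q ∈ Q', ⁅x, q⁆ ∈ Q' by
    obtain ⟨Q', h1, h2, h3⟩ := h B (hB ▸ Submodule.subset_span)
    rw [hB] at h3
    exact ⟨Q', h1, h2, fun x hx => h3 x (Submodule.mem_sup_left hx),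
      fun x hx => h3 x (Submodule.mem_sup_right hx)⟩
  intro B'
  induction B' using Finset.induction_on with
  | empty => exact fun _ => ⟨Q, inferInstance, le_rfl, by simpa using hQ⟩
  | insert b B' _ ih =>
    intro hB'
    rw [Finset.coe_insert, Set.insert_subset_iff] at hB'
    obtain ⟨Q₁, _, h2, h3⟩ := ih hB'.2
    obtain ⟨Q₂, h4, h5, h6, h7⟩ := exists_stable_adjoin (X := X)
      (I ⊔ Submodule.span k (B' : Set L)) (b := b) (by
        intro x hx
        obtain ⟨x₁, hx₁, x₂, hx₂, rfl⟩ := Submodule.mem_sup.1 hx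
        rw [add_lie]
        exact Submodule.mem_sup_left (add_mem (hEI x₁ hx₁ b hB'.1)
          (hEE x₂ (Submodule.span_le.2 hB'.2 hx₂) b hB'.1))) (hE b hB'.1) h3
    refine ⟨Q₂, h4, h2.trans h5, ?_⟩
    rw [Finset.coe_insert, Submodule.span_insert, sup_left_comm]
    intro x hx q hq
    obtain ⟨x₁, hx₁, x₂, hx₂, rfl⟩ := Submodule.mem_sup.1 hx
    obtain ⟨c, rfl⟩ := Submodule.mem_span_singleton.1 hx₁
    rw [add_lie, smul_lie]
    exact add_mem (Submodule.smul_mem _ c (h7 q hq)) (h6 x₂ hx₂ q hq)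

/-- Finite-dimensionality of a highest-weight module on which the negative root vectors of the simple
roots act locally nilpotently. -/
theorem finiteDimensional_of_generated [IsAlgClosed k] [CharZero k] [FiniteDimensional k L]
    (hL : IsReductive k L) (hH : IsSplitCartan H) (hf : ∀ α ∈ lieRoots H, f α ≠ 0)
    {w : X} (hgen : ∀ N : LieSubmodule k L X, w ∈ N → N = ⊤) {lam : Module.Dual k H}
    (hw : w ∈ wt (act H X) lam) (hn : ∀ α ∈ posRoots f, ∀ x ∈ wt (act H L) α, ⁅x, w⁆ = 0)
    (hs : ∀ α ∈ simpleRoots f, ∃ (y : H) (e g : L) (n : ℕ), IsSl2Triple (y : L) e g ∧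
      e ∈ wt (act H L) α ∧ g ∈ wt (act H L) (-α) ∧ (toEnd k L X g ^ n) w = 0) :
    FiniteDimensional k X := by
  classical
  have hX : IsWeighted (act H X) := by
    have := hgen (weightSum hH X) (Submodule.mem_iSup_of_mem lam hw)
    rw [← LieSubmodule.toSubmodule_eq_top] at this
    exact this
  -- `𝒩` holds the lowering operators, `ℬ` those of `H` and of the positive root vectors.
  let 𝒩 : Set (Module.End k X) := {n | ∃ α ∈ lieRoots H, f α < 0 ∧ ∃ x ∈ wt (act H L) α,
    n = toEnd k L X x}
  let ℬ : Set (Module.End k X) := {b | ∃ α, (α = 0 ∨ α ∈ posRoots f) ∧ ∃ x ∈ wt (act H L) α,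
    b = toEnd k L X x}
  let P : Submodule k X := Submodule.span k {w}
  have hall : ∀ x : L, ∃ b : Module.End k X, b ∈ Submodule.span k ℬ ∧
      ∃ n : Module.End k X, n ∈ Submodule.span k 𝒩 ∧ toEnd k L X x = b + n := by
    intro x
    suffices h : (⨆ μ, wt (act H L) μ : Submodule k L) ≤
        Submodule.comap (toEnd k L X : L →ₗ[k] Module.End k X)
          (Submodule.span k ℬ ⊔ Submodule.span k 𝒩) by
      have hx : x ∈ ⨆ μ, wt (act H L) μ := by rw [hH.isWeighted]; trivial
      obtain ⟨b, hb, n, hn, e⟩ := Submodule.mem_sup.1 (h hx)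
      exact ⟨b, hb, n, hn, e.symm⟩
    refine iSup_le fun μ x hx => ?_
    change toEnd k L X x ∈ Submodule.span k ℬ ⊔ Submodule.span k 𝒩
    by_cases h0 : μ = 0
    · exact Submodule.mem_sup_left (Submodule.subset_span ⟨μ, Or.inl h0, x, hx, rfl⟩)
    by_cases hx0 : x = 0
    · rw [hx0, map_zero]; exact zero_mem _
    have hμ : μ ∈ lieRoots H := ⟨h0, mem_weights hx hx0⟩
    rcases lt_or_gt_of_ne (hf μ hμ) with h | h
    · exact Submodule.mem_sup_right (Submodule.subset_span ⟨μ, hμ, h, x, hx, rfl⟩)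
    · exact Submodule.mem_sup_left (Submodule.subset_span ⟨μ, Or.inr ⟨hμ, h⟩, x, hx, rfl⟩)
  have hPℬ : ∀ b ∈ ℬ, ∀ p ∈ P, b p ∈ P := by
    rintro _ ⟨α, hα, x, hx, rfl⟩ p hp
    obtain ⟨c, rfl⟩ := Submodule.mem_span_singleton.1 hp
    rw [map_smul]
    refine P.smul_mem c ?_
    change ⁅x, w⁆ ∈ P
    rcases hα with rfl | hα
    · have hxH : x ∈ H := (hH.mem_iff x).2 fun y => by
        rw [mem_wt_act.1 hx y, LinearMap.zero_apply, zero_smul]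
      rw [mem_wt_act.1 hw ⟨x, hxH⟩]
      exact P.smul_mem _ (Submodule.mem_span_singleton_self w)
    · rw [hn α hα x hx]
      exact P.zero_mem
  -- This is the statement that lowering operators alone generate `X` from `w`. The closure is
  -- `L`-stable because commuting an element of `ℬ` past one of `𝒩` only produces elements of their
  -- spans.
  have htop : stableClosure 𝒩 P = ⊤ := by
    have hst : ∀ x : L, ∀ v ∈ stableClosure 𝒩 P, ⁅x, v⁆ ∈ stableClosure 𝒩 P := by
      intro x v hv
      obtain ⟨b, hb, n, hn, e⟩ := hall x
      rw [← toEnd_apply_apply k L X, e, LinearMap.add_apply]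
      clear e
      refine add_mem ?_ ?_
      · induction hb using Submodule.span_induction with
        | mem b hb =>
          refine stableClosure_stable_of_comm hPℬ ?_ hb hv
          rintro _ ⟨α, hα, x, hx, rfl⟩ _ ⟨β, hβ, hβ', y, hy, rfl⟩
          obtain ⟨b', hb', n', hn', e'⟩ := hall ⁅x, y⁆
          refine ⟨1, b', hb', n', hn', ?_⟩
          rw [add_assoc, ← e', one_smul]
          refine LinearMap.ext fun v => ?_
          change ⁅x, ⁅y, v⁆⁆ = ⁅y, ⁅x, v⁆⁆ + ⁅⁅x, y⁆, v⁆
          rw [leibniz_lie, add_comm]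
        | zero => exact zero_mem _
        | add a b _ _ ha hb => exact add_mem ha hb
        | smul c a _ ha => exact Submodule.smul_mem _ c ha
      · induction hn using Submodule.span_induction with
        | mem n hn => exact stableClosure_stable hn hv
        | zero => exact zero_mem _
        | add a b _ _ ha hb => exact add_mem ha hb
        | smul c a _ ha => exact Submodule.smul_mem _ c ha
    have := hgen { stableClosure 𝒩 P with lie_mem := fun {x v} hv => hst x v hv }
      (le_stableClosure (Submodule.mem_span_singleton_self w))
    rw [← LieSubmodule.toSubmodule_eq_top] at this
    exact this
  have hbound : ∀ μ ∈ weights H X, f μ ≤ f lam := by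
    have h1 : stableClosure 𝒩 P ≤ ⨆ μ ∈ {μ : Module.Dual k H | f μ ≤ f lam}, wt (act H X) μ := by
      refine stableClosure_le ?_ ?_
      · rw [Submodule.span_singleton_le_iff_mem]
        exact Submodule.mem_iSup_of_mem lam (Submodule.mem_iSup_of_mem (le_refl (f lam)) hw)
      · rintro _ ⟨α, hα, hα', x, hx, rfl⟩ q hq
        suffices h : ⨆ μ ∈ {μ : Module.Dual k H | f μ ≤ f lam}, wt (act H X) μ ≤
            (⨆ μ ∈ {μ : Module.Dual k H | f μ ≤ f lam}, wt (act H X) μ).comap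
              (toEnd k L X x) from h hq
        refine iSup₂_le fun μ hμ v hv => ?_
        have hμ' : f (α + μ) ≤ f lam := by
          rw [map_add]
          have : f μ ≤ f lam := hμ
          linarith
        exact Submodule.mem_iSup_of_mem (α + μ) (Submodule.mem_iSup_of_mem hμ' (lie_mem_wt hx hv))
    rw [htop] at h1
    intro μ hμ
    by_contra h
    exact hμ (wt_eq_bot_of_notMem (top_le_iff.1 h1) h)
  -- The vectors on which a simple lowering operator is nilpotent form a submodule containing `w`,
  -- hence all of `X`.
  have hstr := finite_strings hL hH hf hbound hX (fun α hα => by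
    obtain ⟨y, e, g, n, ht, he, hg, hgw⟩ := hs α hα
    refine ⟨y, e, g, ht, he, hg, fun v => ?_⟩
    have := hgen (nilpotentPart X (isLocallyNilpotent_ad hH (neg_ne_zero.2 hα.1.1.1) hg)) ⟨n, hgw⟩
    exact (this ▸ LieSubmodule.mem_top v : v ∈ nilpotentPart X _))
  have hneg : ∀ α ∈ lieRoots H, f α < 0 → ∀ x ∈ wt (act H L) α, IsLocallyNilpotent k X x := by
    intro α hα hα' x hx
    refine isLocallyNilpotent_of_wt hX hx ?_
    obtain ⟨y, e, g, ht, he, hg⟩ := exists_isSl2Triple hL hH hα.1 hα.2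
    have := hstr (-α) ⟨⟨neg_ne_zero.2 hα.1, mem_weights hg ht.f_ne_zero⟩, by
      rw [map_neg]; linarith⟩
    simpa only [neg_neg] using this
  have hfinneg : {α ∈ lieRoots H | f α < 0}.Finite := finite_lieRoots.subset fun _ h => h.1
  -- The set `S` of negative roots is closed downwards for `f`. It grows by adding the highest new
  -- root last, so brackets with the new root space fall into root spaces already treated.
  suffices hmain : ∀ S : Finset (Module.Dual k H), (∀ γ ∈ S, γ ∈ lieRoots H ∧ f γ < 0) →
      (∀ γ ∈ S, ∀ δ ∈ lieRoots H, f δ < f γ → δ ∈ S) → ∃ Q : Submodule k X,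
      FiniteDimensional k Q ∧ w ∈ Q ∧ ∀ γ ∈ S, ∀ x ∈ wt (act H L) γ, ∀ q ∈ Q, ⁅x, q⁆ ∈ Q by
    obtain ⟨Q, hQ, hwQ, hQs⟩ := hmain hfinneg.toFinset (by simp) (by
      intro γ hγ δ hδ hlt
      rw [Set.Finite.mem_toFinset] at hγ ⊢
      exact ⟨hδ, hlt.trans hγ.2⟩)
    have hle : stableClosure 𝒩 P ≤ Q := by
      refine stableClosure_le ((Submodule.span_singleton_le_iff_mem _ _).2 hwQ) ?_
      rintro _ ⟨α, hα, hα', x, hx, rfl⟩ q hq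
      exact hQs α ((Set.Finite.mem_toFinset _).2 ⟨hα, hα'⟩) x hx q hq
    rw [htop, top_le_iff] at hle
    subst hle
    exact (Submodule.topEquiv (R := k) (M := X)).finiteDimensional
  intro S
  induction S using Finset.induction_on_max_value f with
  | empty =>
    exact fun _ _ => ⟨P, inferInstance, Submodule.mem_span_singleton_self w, by simp⟩
  | insert a S haS hmax ih =>
    intro h1 h2
    have hS : ∀ γ ∈ S, ∀ δ ∈ lieRoots H, f δ < f γ → δ ∈ S := by
      intro γ hγ δ hδ hlt
      refine (Finset.mem_insert.1 (h2 γ (Finset.mem_insert_of_mem hγ) δ hδ hlt)).resolve_left ?_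
      rintro rfl
      exact absurd (hmax γ hγ) (not_le.2 hlt)
    have haS' : ∀ δ ∈ lieRoots H, f δ < f a → δ ∈ S := by
      intro δ hδ hlt
      refine (Finset.mem_insert.1 (h2 a (Finset.mem_insert_self _ _) δ hδ hlt)).resolve_left ?_
      rintro rfl
      exact lt_irrefl _ hlt
    obtain ⟨Q, _, hwQ, hQs⟩ := ih (fun γ hγ => h1 γ (Finset.mem_insert_of_mem hγ)) hS
    obtain ⟨ha, ha'⟩ := h1 a (Finset.mem_insert_self _ _)
    let I : Submodule k L := ⨆ γ ∈ S, wt (act H L) γ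
    have hIQ : ∀ x ∈ I, ∀ q ∈ Q, ⁅x, q⁆ ∈ Q := by
      intro x hx q hq
      suffices h : I ≤ Q.comap ((toEnd k L X : L →ₗ[k] Module.End k X).flip q) from h hx
      exact iSup₂_le fun γ hγ x hx => hQs γ hγ x hx q hq
    -- As `f a < 0`, a weight below `a` is never zero, so a nonzero weight space there is a root
    -- space belonging to `S`.
    have hmem : ∀ γ : Module.Dual k H, f γ < f a → wt (act H L) γ ≤ I := by
      intro γ hγ x hx
      by_cases hx0 : x = 0
      · rw [hx0]; exact zero_mem _
      have hγ0 : γ ≠ 0 := by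
        rintro rfl
        rw [map_zero] at hγ
        linarith
      exact Submodule.mem_iSup_of_mem γ (Submodule.mem_iSup_of_mem
        (haS' γ ⟨hγ0, mem_weights hx hx0⟩ hγ) hx)
    have hI : ∀ x ∈ I, ∀ b ∈ wt (act H L) a, ⁅x, b⁆ ∈ I := by
      intro x hx b hb
      suffices h : I ≤ I.comap ((toEnd k L L : L →ₗ[k] Module.End k L).flip b) from h hx
      refine iSup₂_le fun γ hγ x hx => hmem (γ + a) ?_ (lie_mem_wt hx hb)
      rw [map_add]
      linarith [(h1 γ (Finset.mem_insert_of_mem hγ)).2]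
    obtain ⟨Q', hQ', hQQ', h3, h4⟩ := exists_stable_sup (X := X) I (wt (act H L) a) hI
      (fun x hx b hb => hmem (a + a) (by rw [map_add]; linarith) (lie_mem_wt hx hb))
      (hneg a ha ha') hIQ
    refine ⟨Q', hQ', hQQ' hwQ, fun γ hγ x hx q hq => ?_⟩
    rcases Finset.mem_insert.1 hγ with rfl | hγ
    · exact h4 x hx q hq
    · exact h3 x (Submodule.mem_iSup_of_mem γ (Submodule.mem_iSup_of_mem hγ hx)) q hq

/-- The submodule generated by `w` is a highest-weight module, so it is itself the required
finite-dimensional submodule. -/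
theorem mem_locallyFinitePart_of_highestWeight [IsAlgClosed k] [CharZero k] [FiniteDimensional k L]
    (hL : IsReductive k L) (hH : IsSplitCartan H) (hf : ∀ α ∈ lieRoots H, f α ≠ 0)
    {w : X} {lam : Module.Dual k H}
    (hw : w ∈ wt (act H X) lam) (hn : ∀ α ∈ posRoots f, ∀ x ∈ wt (act H L) α, ⁅x, w⁆ = 0)
    (hs : ∀ α ∈ simpleRoots f, ∃ (y : H) (e g : L) (n : ℕ), IsSl2Triple (y : L) e g ∧
      e ∈ wt (act H L) α ∧ g ∈ wt (act H L) (-α) ∧ (toEnd k L X g ^ n) w = 0) :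
    w ∈ locallyFinitePart k L X := by
  let N : LieSubmodule k L X := LieSubmodule.lieSpan k L {w}
  have hwN : w ∈ N := LieSubmodule.subset_lieSpan rfl
  refine ⟨N, ?_, hwN⟩
  refine finiteDimensional_of_generated (X := N) hL hH hf (w := ⟨w, hwN⟩) (lam := lam) ?_ ?_ ?_ ?_
  · intro N' hN'
    have h1 : N ≤ N'.map N.incl := by
      rw [LieSubmodule.lieSpan_le, Set.singleton_subset_iff]
      exact (LieSubmodule.mem_map _).2 ⟨_, hN', rfl⟩
    rw [eq_top_iff]
    intro v _
    obtain ⟨v', hv', e⟩ := (LieSubmodule.mem_map _).1 (h1 v.2)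
    rwa [← Subtype.ext (show (v' : X) = v from e)]
  · exact fun y => Subtype.ext (hw y)
  · exact fun α hα x hx => Subtype.ext (hn α hα x hx)
  · intro α hα
    obtain ⟨y, e, g, n, ht, he, hg, h⟩ := hs α hα
    refine ⟨y, e, g, n, ht, he, hg, Subtype.ext ?_⟩
    rw [LieSubmodule.coe_toEnd_pow]
    exact h

end Integrable

/-! ### Irreducible modules of the reductive part -/

section Separation

variable {k : Type u} [Field k]

/-- An element of a Lie algebra which acts by zero in every finite-dimensional irreducible module. -/
def ActsTrivially (k : Type u) {L : Type u} [Field k] [LieRing L] [LieAlgebra k L] (x : L) : Prop :=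
  ∀ (V : Type u) [AddCommGroup V] [Module k V] [LieRingModule L V] [LieModule k L V]
    [FiniteDimensional k V] [LieModule.IsIrreducible k L V], ∀ v : V, ⁅x, v⁆ = 0

variable {L : Type u} [LieRing L] [LieAlgebra k L] {V : Type u} [AddCommGroup V] [Module k V]

/-- The Lie ring module given by a representation. -/
abbrev repLieRingModule (ρ : L →ₗ[k] Module.End k V)
    (hρ : ∀ x y v, ρ ⁅x, y⁆ v = ρ x (ρ y v) - ρ y (ρ x v)) : LieRingModule L V where
  bracket x v := ρ x v
  add_lie x y v := LinearMap.congr_fun (map_add ρ x y) v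
  lie_add x v w := map_add (ρ x) v w
  leibniz_lie x y v := by
    change ρ x (ρ y v) = ρ ⁅x, y⁆ v + ρ y (ρ x v)
    rw [hρ, sub_add_cancel]

theorem repLieModule (ρ : L →ₗ[k] Module.End k V)
    (hρ : ∀ x y v, ρ ⁅x, y⁆ v = ρ x (ρ y v) - ρ y (ρ x v)) :
    letI := repLieRingModule ρ hρ
    LieModule k L V :=
  letI := repLieRingModule ρ hρ
  { smul_lie := fun c x v => LinearMap.congr_fun (map_smul ρ c x) v
    lie_smul := fun c x v => map_smul (ρ x) c v }

variable [FiniteDimensional k V] {x : L}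

theorem ActsTrivially.apply_eq_zero [Nontrivial V] (hx : ActsTrivially k x)
    (ρ : L →ₗ[k] Module.End k V) (hρ : ∀ x y v, ρ ⁅x, y⁆ v = ρ x (ρ y v) - ρ y (ρ x v))
    (hirr : ∀ N : Submodule k V, (∀ x, ∀ v ∈ N, ρ x v ∈ N) → N = ⊥ ∨ N = ⊤) (v : V) :
    ρ x v = 0 := by
  let _ := repLieRingModule ρ hρ
  have := repLieModule ρ hρ
  have : LieModule.IsIrreducible k L V := LieModule.IsIrreducible.mk fun N hN => by
    rcases hirr N.toSubmodule fun x v hv => N.lie_mem hv with h | h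
    · exact absurd ((LieSubmodule.toSubmodule_eq_bot N).1 h) hN
    · exact (LieSubmodule.toSubmodule_eq_top N).1 h
  exact hx V v

/-- A completely reducible module is the sum of its irreducible submodules. -/
theorem ActsTrivially.apply_eq_zero_of_complemented (hx : ActsTrivially k x)
    (ρ : L →ₗ[k] Module.End k V) (hρ : ∀ x y v, ρ ⁅x, y⁆ v = ρ x (ρ y v) - ρ y (ρ x v))
    (hc : ∀ N : Submodule k V, (∀ x, ∀ v ∈ N, ρ x v ∈ N) →
      ∃ N' : Submodule k V, (∀ x, ∀ v ∈ N', ρ x v ∈ N') ∧ N ⊓ N' = ⊥ ∧ N ⊔ N' = ⊤) (v : V) :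
    ρ x v = 0 := by
  let _ := repLieRingModule ρ hρ
  have := repLieModule ρ hρ
  have : ComplementedLattice (LieSubmodule k L V) := ⟨fun N => by
    obtain ⟨N', hN', h, h'⟩ := hc N.toSubmodule fun x v hv => N.lie_mem hv
    refine ⟨{ N' with lie_mem := fun {x v} hv => hN' x v hv }, ?_⟩
    constructor
    · rwa [disjoint_iff, ← LieSubmodule.toSubmodule_eq_bot, LieSubmodule.inf_toSubmodule]
    · rwa [codisjoint_iff, ← LieSubmodule.toSubmodule_eq_top, LieSubmodule.sup_toSubmodule]⟩
  have h1 : sSup {N : LieSubmodule k L V | IsAtom N} = ⊤ := sSup_atoms_eq_top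
  rw [← LieSubmodule.toSubmodule_eq_top, LieSubmodule.sSup_toSubmodule] at h1
  have h2 : (⊤ : Submodule k V) ≤ LinearMap.ker (ρ x) := by
    rw [← h1]
    refine sSup_le ?_
    rintro _ ⟨N, hN, rfl⟩ w hw
    have := isIrreducible_of_isAtom hN
    exact congrArg Subtype.val (hx N ⟨w, hw⟩)
  exact h2 (Submodule.mem_top (x := v))

theorem isSeparated_iff :
    IsSeparatedByIrreducibles k L ↔ ∀ x : L, ActsTrivially k x → x = 0 := Iff.rfl

end Separation

/-! ### Subalgebras of the even part, and separation for the classical and special linear types. -/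

section Inclusion

variable {k g : Type u} [Field k] [CharZero k] [AddCommGroup g] [Module k g] [LieSuperalgebra k g]

/-- The inclusion of a subalgebra of the even part. -/
def subIncl (r : LieSubalgebra k (EvenPart k g)) : r →ₗ[k] g :=
  EvenPart.incl k g ∘ₗ r.toSubmodule.subtype

variable {r : LieSubalgebra k (EvenPart k g)}

theorem subIncl_mem (x : r) : subIncl r x ∈ gr k g 0 := EvenPart.incl_mem k g _

theorem subIncl_injective : Function.Injective (subIncl r) :=
  (EvenPart.incl_injective k g).comp Subtype.coe_injective

theorem subIncl_lie (x y : r) : subIncl r ⁅x, y⁆ = br k g (subIncl r x) (subIncl r y) := rfl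

theorem exists_subIncl_top {x : g} (hx : x ∈ gr k g 0) :
    ∃ y : (⊤ : LieSubalgebra k (EvenPart k g)), subIncl ⊤ y = x := ⟨⟨⟨x, hx⟩, trivial⟩, rfl⟩

theorem jacobi_even {x y : g} (hx : x ∈ gr k g 0) (hy : y ∈ gr k g 0) (z : g) :
    br k g (br k g x y) z = br k g x (br k g y z) - br k g y (br k g x z) := by
  have h := LieSuperalgebra.jacobi (k := k) z hx hy
  rw [show sgn k 0 0 = 1 by simp [sgn], one_smul] at h
  exact (sub_eq_of_eq_add h).symm

/-! ### The classical case -/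

/-- An element killed by all irreducible modules annihilates the odd part, which is completely
reducible. The even elements that annihilate the odd part form a graded ideal, so simplicity leaves
two cases: the ideal is zero, or the superalgebra is purely even and its adjoint module is
irreducible and faithful. -/
theorem isSeparated_of_classical [FiniteDimensional k g] (hs : IsSimple k g)
    (hc : OddPartCompletelyReducible k g) :
    IsSeparatedByIrreducibles k (⊤ : LieSubalgebra k (EvenPart k g)) := by
  rw [isSeparated_iff]
  intro x hx
  let R : LieSubalgebra k (EvenPart k g) := ⊤
  have hbr1 : ∀ x : R, ∀ y ∈ gr k g 1, br k g (subIncl R x) y ∈ gr k g 1 := fun x y hy => by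
    have := LieSuperalgebra.br_mem (k := k) (subIncl_mem x) hy
    rwa [zero_add] at this
  let ρ : R →ₗ[k] Module.End k (gr k g 1) :=
    LinearMap.mk₂ k (fun x y => ⟨br k g (subIncl R x) y, hbr1 x y y.2⟩)
      (fun _ _ _ => Subtype.ext (by simp)) (fun _ _ _ => Subtype.ext (by simp))
      (fun _ _ _ => Subtype.ext (by simp)) (fun _ _ _ => Subtype.ext (by simp))
  have h1 : ∀ y ∈ gr k g 1, br k g (subIncl R x) y = 0 := by
    intro y hy
    refine congrArg Subtype.val (hx.apply_eq_zero_of_complemented ρ ?_ ?_ ⟨y, hy⟩)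
    · exact fun x y v => Subtype.ext (jacobi_even (subIncl_mem x) (subIncl_mem y) (v : g))
    · intro N hN
      obtain ⟨N', hN'1, hN', hinf, hsup⟩ := hc (N.map (gr k g 1).subtype)
        (Submodule.map_subtype_le _ _) (by
          rintro z hz _ ⟨v, hv, rfl⟩
          obtain ⟨z, rfl⟩ := exists_subIncl_top hz
          exact ⟨ρ z v, hN z v hv, rfl⟩)
      refine ⟨N'.comap (gr k g 1).subtype, fun z v hv => hN' _ (subIncl_mem z) _ hv, ?_, ?_⟩
      · rw [Submodule.eq_bot_iff] at hinf ⊢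
        exact fun v hv => Subtype.ext (hinf v ⟨⟨v, hv.1, rfl⟩, hv.2⟩)
      · rw [eq_top_iff]
        rintro ⟨v, hv⟩ _
        rw [← hsup] at hv
        obtain ⟨_, ⟨a, ha, rfl⟩, b, hb, e⟩ := Submodule.mem_sup.1 hv
        exact Submodule.mem_sup.2 ⟨a, ha, ⟨b, hN'1 hb⟩, hb, Subtype.ext e⟩
  let K : Submodule k g :=
    { carrier := {z | z ∈ gr k g 0 ∧ ∀ y ∈ gr k g 1, br k g z y = 0}
      add_mem' := fun ha hb => ⟨add_mem ha.1 hb.1, fun y hy => by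
        rw [map_add, LinearMap.add_apply, ha.2 y hy, hb.2 y hy, add_zero]⟩
      zero_mem' := ⟨zero_mem _, fun y hy => by rw [map_zero, LinearMap.zero_apply]⟩
      smul_mem' := fun c z hz => ⟨Submodule.smul_mem _ c hz.1, fun y hy => by
        rw [map_smul, LinearMap.smul_apply, hz.2 y hy, smul_zero]⟩ }
  have hK : ∀ a, ∀ z ∈ K, br k g a z ∈ K := by
    intro a z hz
    obtain ⟨a0, h0, a1, h1, rfl⟩ := (LieSuperalgebra.grading (k := k) (g := g)).exists_add a
    rw [map_add, LinearMap.add_apply]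
    refine add_mem ⟨?_, fun y hy => ?_⟩ ?_
    · have := LieSuperalgebra.br_mem (k := k) h0 hz.1
      rwa [add_zero] at this
    · have hy' := LieSuperalgebra.br_mem (k := k) h0 hy
      rw [zero_add] at hy'
      rw [jacobi_even h0 hz.1, hz.2 y hy, map_zero,
        show br k g z (br k g a0 y) = 0 from hz.2 _ hy', sub_zero]
    · have : br k g a1 z = _ := LieSuperalgebra.br_skew (k := k) h1 hz.1
      rw [this, show LieSuperalgebra.br (k := k) z a1 = 0 from hz.2 a1 h1, smul_zero, neg_zero]
      exact zero_mem _
  rcases hs.2 K hK fun z hz => by rwa [TriangularDecomposition.par_of_even hz.1] with h | h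
  · have : subIncl R x ∈ K := ⟨subIncl_mem x, h1⟩
    rw [h, Submodule.mem_bot] at this
    exact subIncl_injective (this.trans (map_zero _).symm)
  -- Remaining case: there is no odd part. Every ideal is then graded, and the centre is zero
  -- because the bracket is not.
  have h0 : gr k g 0 = ⊤ := top_le_iff.1 (h ▸ fun z hz => hz.1)
  have hpar : ∀ z : g, par k z = z := fun z =>
    TriangularDecomposition.par_of_even (by rw [h0]; trivial)
  have : Nontrivial g := by
    obtain ⟨⟨a, b, hab⟩, -⟩ := hs
    exact ⟨⟨_, _, hab⟩⟩
  have h2 : ∀ z, br k g (subIncl R x) z = 0 := by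
    refine hx.apply_eq_zero (br k g ∘ₗ subIncl R)
      (fun x y v => jacobi_even (subIncl_mem x) (subIncl_mem y) v) fun N hN => ?_
    refine hs.2 N (fun a y hy => ?_) fun y hy => by rwa [hpar]
    obtain ⟨a, rfl⟩ := exists_subIncl_top (x := a) (by rw [h0]; trivial)
    exact hN a y hy
  rcases hs.2 (LinearMap.ker (br k g)) (fun a z hz => LinearMap.ext fun y => by
      rw [jacobi_even (by rw [h0]; trivial) (by rw [h0]; trivial), LinearMap.mem_ker.1 hz]
      simp) fun y hy => by rwa [hpar] with h3 | h3
  · have : subIncl R x ∈ LinearMap.ker (br k g) := LinearMap.ext h2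
    rw [h3, Submodule.mem_bot] at this
    exact subIncl_injective (this.trans (map_zero _).symm)
  · obtain ⟨⟨a, b, hab⟩, -⟩ := hs
    have ha : a ∈ LinearMap.ker (br k g) := by rw [h3]; trivial
    exact absurd (LinearMap.congr_fun ha b) hab

/-! ### The special linear Lie superalgebras -/

theorem single_mul_mulVec {n : ℕ} (i j : Fin n) (v : Fin n → k) :
    (Matrix.single i j (1 : k)).mulVec v = v j • Pi.single i 1 := by
  ext l
  simp [Matrix.single_mulVec, Pi.single_apply, Function.update_apply]

/-- A subspace of `k^n` which is stable under all matrix units off the diagonal is trivial. -/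
theorem eq_bot_or_top_of_stable {n : ℕ} (hn : 2 ≤ n) (N : Submodule k (Fin n → k))
    (hN : ∀ i j : Fin n, i ≠ j → ∀ v ∈ N, v j • Pi.single i (1 : k) ∈ N) : N = ⊥ ∨ N = ⊤ := by
  rw [or_iff_not_imp_left]
  intro h
  obtain ⟨v, hv, hv0⟩ := (Submodule.ne_bot_iff _).1 h
  obtain ⟨j, hj⟩ := Function.ne_iff.1 hv0
  -- The matrix units `E_ij` extract every basis vector other than the `j`-th from `v`; the `j`-th
  -- then comes from any of the others, which exists since `n ≥ 2`.
  have h1 : ∀ i, i ≠ j → Pi.single i (1 : k) ∈ N := fun i hi =>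
    (Submodule.smul_mem_iff _ hj).1 (hN i j hi v hv)
  have : Nontrivial (Fin n) := Fin.nontrivial_iff_two_le.2 hn
  obtain ⟨i, hi⟩ := exists_ne j
  have h2 : ∀ l, Pi.single l (1 : k) ∈ N := by
    intro l
    by_cases hl : l = j
    · subst hl
      have := hN l i hi.symm _ (h1 i hi)
      rwa [Pi.single_eq_same, one_smul] at this
    · exact h1 l hl
  rw [eq_top_iff]
  intro w _
  rw [← (Pi.basisFun k (Fin n)).sum_repr w]
  exact sum_mem fun l _ => Submodule.smul_mem _ _ (by rw [Pi.basisFun_apply]; exact h2 l)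

/-- The even part consists of the block-diagonal matrices of supertrace zero. Each diagonal block
gives a representation on `k^n`, irreducible because all off-diagonal matrix units occur, and the
two blocks together determine the matrix. -/
theorem isSeparated_of_isSpecialLinear (h : IsSpecialLinear k g) :
    IsSeparatedByIrreducibles k (⊤ : LieSubalgebra k (EvenPart k g)) := by
  obtain ⟨n, hn, φ, ⟨hinj, hgr, hbr⟩, hrange⟩ := h
  rw [isSeparated_iff]
  intro x hx
  let R : LieSubalgebra k (EvenPart k g) := ⊤
  have hoff : ∀ y : R, (φ (subIncl R y)).toBlocks₁₂ = 0 ∧ (φ (subIncl R y)).toBlocks₂₁ = 0 := by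
    intro y
    have := hgr 0 _ (subIncl_mem y)
    simpa [matGr] using this
  have hdiag : ∀ y : R, φ (subIncl R y) =
      Matrix.fromBlocks (φ (subIncl R y)).toBlocks₁₁ 0 0 (φ (subIncl R y)).toBlocks₂₂ := by
    intro y
    conv_lhs => rw [← Matrix.fromBlocks_toBlocks (φ (subIncl R y)), (hoff y).1, (hoff y).2]
  have hmul : ∀ y z : R, φ (subIncl R ⁅y, z⁆) =
      φ (subIncl R y) * φ (subIncl R z) - φ (subIncl R z) * φ (subIncl R y) := by
    intro y z
    rw [subIncl_lie, hbr 0 0 _ (subIncl_mem y) _ (subIncl_mem z), show sgn k 0 0 = 1 by simp [sgn],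
      one_smul]
  -- The odd component of a preimage of an even matrix has an image that is both even and odd, hence
  -- zero.
  have hex : ∀ M : Matrix (Fin n ⊕ Fin n) (Fin n ⊕ Fin n) k, M ∈ matGr k n 0 →
      supertrace M = 0 → ∃ y : R, φ (subIncl R y) = M := by
    intro M hM hs
    obtain ⟨z, rfl⟩ := (hrange M).2 hs
    obtain ⟨a, ha, b, hb, rfl⟩ := (LieSuperalgebra.grading (k := k) (g := g)).exists_add z
    have h1 := hgr 0 a ha
    have h2 := hgr 1 b hb
    have h3 : φ b ∈ matGr k n 0 := by
      have := sub_mem hM h1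
      rwa [map_add, add_sub_cancel_left] at this
    obtain ⟨y, rfl⟩ := exists_subIncl_top ha
    refine ⟨y, ?_⟩
    have h4 : φ b = 0 := by
      simp only [matGr, Submodule.mem_mk, AddSubmonoid.mem_mk, AddSubsemigroup.mem_mk,
        Set.mem_ofPred_eq, if_true, one_ne_zero, if_false] at h2 h3
      rw [← Matrix.fromBlocks_toBlocks (φ b), h2.1, h2.2, h3.1, h3.2, Matrix.fromBlocks_zero]
    rw [map_add, h4, add_zero]
  have : Nonempty (Fin n) := ⟨⟨0, by omega⟩⟩
  -- `B` stands for the extraction of either diagonal block, which is multiplicative on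
  -- block-diagonal matrices.
  have key : ∀ (B : Matrix (Fin n ⊕ Fin n) (Fin n ⊕ Fin n) k →ₗ[k] Matrix (Fin n) (Fin n) k),
      (∀ y z : R, B (φ (subIncl R y) * φ (subIncl R z)) =
        B (φ (subIncl R y)) * B (φ (subIncl R z))) →
      (∀ i j : Fin n, i ≠ j → ∃ y : R, B (φ (subIncl R y)) = Matrix.single i j 1) →
      B (φ (subIncl R x)) = 0 := by
    intro B hB hB'
    have h1 := hx.apply_eq_zero (V := Fin n → k)
      ((Matrix.toLin' : Matrix (Fin n) (Fin n) k ≃ₗ[k] _).toLinearMap ∘ₗ B ∘ₗ φ ∘ₗ subIncl R)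
      (fun y z v => by
        simp only [LinearMap.comp_apply, LinearEquiv.coe_coe, hmul, map_sub, hB,
          Matrix.toLin'_mul, LinearMap.sub_apply]) (fun N hN => by
        refine eq_bot_or_top_of_stable hn N fun i j hij v hv => ?_
        obtain ⟨y, hy⟩ := hB' i j hij
        have := hN y v hv
        simp only [LinearMap.comp_apply, LinearEquiv.coe_coe, hy, Matrix.toLin'_apply,
          single_mul_mulVec] at this
        exact this)
    exact Matrix.toLin'.injective ((LinearMap.ext h1).trans (map_zero _).symm)
  have e1 : (φ (subIncl R x)).toBlocks₁₁ = 0 := by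
    refine key ⟨⟨fun M => M.toBlocks₁₁, fun _ _ => rfl⟩, fun _ _ => rfl⟩ (fun y z => ?_)
      fun i j hij => ?_
    · change (φ (subIncl R y) * φ (subIncl R z)).toBlocks₁₁ =
        (φ (subIncl R y)).toBlocks₁₁ * (φ (subIncl R z)).toBlocks₁₁
      rw [hdiag y, hdiag z, Matrix.fromBlocks_multiply]
      simp
    · obtain ⟨y, hy⟩ := hex (Matrix.fromBlocks (Matrix.single i j 1) 0 0 0) (by simp [matGr]) (by
        simp [supertrace, Matrix.trace_single_eq_of_ne, hij])
      refine ⟨y, ?_⟩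
      rw [hy]
      rfl
  have e2 : (φ (subIncl R x)).toBlocks₂₂ = 0 := by
    refine key ⟨⟨fun M => M.toBlocks₂₂, fun _ _ => rfl⟩, fun _ _ => rfl⟩ (fun y z => ?_)
      fun i j hij => ?_
    · change (φ (subIncl R y) * φ (subIncl R z)).toBlocks₂₂ =
        (φ (subIncl R y)).toBlocks₂₂ * (φ (subIncl R z)).toBlocks₂₂
      rw [hdiag y, hdiag z, Matrix.fromBlocks_multiply]
      simp
    · obtain ⟨y, hy⟩ := hex (Matrix.fromBlocks 0 0 0 (Matrix.single i j 1)) (by simp [matGr]) (by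
        simp [supertrace, Matrix.trace_single_eq_of_ne, hij])
      refine ⟨y, ?_⟩
      rw [hy]
      rfl
  apply subIncl_injective
  apply hinj
  rw [map_zero, map_zero, hdiag x, e1, e2, Matrix.fromBlocks_zero]

end Inclusion

/-! ### Superderivations of exterior algebras -/

section Exterior

variable {k : Type u} [Field k] {n : ℕ}

theorem involute_of_mem {i : ZMod 2} {x : Ext k n} (hx : x ∈ (extGrading k n).gr i) :
    CliffordAlgebra.involute x = sgn k i 1 • x := by
  rcases zmod_two_cases i with rfl | rfl
  · rw [sgn_zero_one, one_smul]; exact CliffordAlgebra.involute_eq_of_mem_even hx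
  · rw [sgn_one_one, neg_one_smul]; exact CliffordAlgebra.involute_eq_of_mem_odd hx

theorem parity_ext (x : Ext k n) :
    (extGrading k n).parity x = CliffordAlgebra.involute x := by
  obtain ⟨a, ha, b, hb, rfl⟩ := (extGrading k n).exists_add x
  rw [map_add, map_add, Z2Grading.parity_of_mem _ ha, Z2Grading.parity_of_mem _ hb,
    involute_of_mem ha, involute_of_mem hb]

theorem mem_extGrading [CharZero k] {i : ZMod 2} {x : Ext k n} :
    x ∈ (extGrading k n).gr i ↔ CliffordAlgebra.involute x = sgn k i 1 • x :=
  ⟨involute_of_mem, fun h => Z2Grading.mem_of_parity _ (by rw [parity_ext, h])⟩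

theorem ι_mem_gr (v : Fin n → k) : ExteriorAlgebra.ι k v ∈ (extGrading k n).gr 1 :=
  CliffordAlgebra.ι_mem_evenOdd_one _ v

theorem ext_mul_mem {i j : ZMod 2} {x y : Ext k n} (hx : x ∈ (extGrading k n).gr i)
    (hy : y ∈ (extGrading k n).gr j) : x * y ∈ (extGrading k n).gr (i + j) :=
  CliffordAlgebra.evenOdd_mul_le _ i j (Submodule.mul_mem_mul hx hy)

theorem mul_ι (x : Ext k n) (v : Fin n → k) :
    x * ExteriorAlgebra.ι k v = ExteriorAlgebra.ι k v * CliffordAlgebra.involute x := by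
  induction x using ExteriorAlgebra.induction with
  | algebraMap r => rw [AlgHom.commutes, Algebra.commutes]
  | ι w =>
    have := CliffordAlgebra.involute_ι (Q := (0 : QuadraticForm k (Fin n → k))) w
    rw [show CliffordAlgebra.involute (ExteriorAlgebra.ι k w) = -ExteriorAlgebra.ι k w from this,
      mul_neg]
    exact eq_neg_of_add_eq_zero_left (ExteriorAlgebra.ι_add_mul_swap w v)
  | mul a b ha hb => rw [map_mul, mul_assoc, hb, ← mul_assoc, ha, mul_assoc]
  | add a b ha hb => rw [map_add, add_mul, mul_add, ha, hb]

theorem ext_mul_comm {i j : ZMod 2} {x y : Ext k n} (hx : x ∈ (extGrading k n).gr i)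
    (hy : y ∈ (extGrading k n).gr j) : x * y = sgn k i j • (y * x) := by
  have h0 : x ∈ (extGrading k n).gr 0 → ∀ z, x * z = z * x := by
    intro hx z
    induction z using ExteriorAlgebra.induction with
    | algebraMap r => exact (Algebra.commutes r x).symm
    | ι w => rw [mul_ι, involute_of_mem hx, sgn_zero_one, one_smul]
    | mul a b ha hb => rw [← mul_assoc, ha, mul_assoc, hb, mul_assoc]
    | add a b ha hb => rw [add_mul, mul_add, ha, hb]
  have h1 : x ∈ (extGrading k n).gr 1 → ∀ z, x * z = CliffordAlgebra.involute z * x := by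
    intro hx z
    induction z using ExteriorAlgebra.induction with
    | algebraMap r => rw [AlgHom.commutes, Algebra.commutes]
    | ι w =>
      have := CliffordAlgebra.involute_ι (Q := (0 : QuadraticForm k (Fin n → k))) w
      rw [show CliffordAlgebra.involute (ExteriorAlgebra.ι k w) = -ExteriorAlgebra.ι k w from this,
        mul_ι, involute_of_mem hx, sgn_one_one, neg_one_smul, mul_neg, neg_mul]
    | mul a b ha hb => rw [map_mul, ← mul_assoc, ha, mul_assoc, hb, mul_assoc]
    | add a b ha hb => rw [map_add, add_mul, mul_add, ha, hb]
  rcases zmod_two_cases i with rfl | rfl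
  · rw [h0 hx, show sgn k 0 j = 1 by simp [sgn], one_smul]
  · rw [h1 hx, involute_of_mem hy, smul_mul_assoc]
    rcases zmod_two_cases j with rfl | rfl <;> simp [sgn]

variable (k n) in
/-- The superderivations of degree `i`. -/
noncomputable def superDer (i : ZMod 2) : Submodule k (Module.End k (Ext k n)) where
  carrier := {D | D ∈ endGr (extGrading k n) i ∧
    ∀ j, ∀ x ∈ (extGrading k n).gr j, ∀ y, D (x * y) = D x * y + sgn k i j • (x * D y)}
  add_mem' hD hE := ⟨add_mem hD.1 hE.1, fun j x hx y => by
    rw [LinearMap.add_apply, LinearMap.add_apply, LinearMap.add_apply, hD.2 j x hx y,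
      hE.2 j x hx y, add_mul, mul_add, smul_add]
    abel⟩
  zero_mem' := ⟨zero_mem _, fun j x hx y => by simp⟩
  smul_mem' c D hD := ⟨Submodule.smul_mem _ c hD.1, fun j x hx y => by
    rw [LinearMap.smul_apply, LinearMap.smul_apply, LinearMap.smul_apply, hD.2 j x hx y,
      smul_add, smul_mul_assoc, mul_smul_comm, smul_comm c]⟩

theorem superDer_le_cartanW (i : ZMod 2) : superDer k n i ≤ cartanW k n := fun _ hD =>
  Submodule.subset_span ⟨i, hD⟩

theorem endGr_disjoint {V : Type u} [AddCommGroup V] [Module k V] (G : Z2Grading k V)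
    {D : Module.End k V} (h0 : D ∈ endGr G 0) (h1 : D ∈ endGr G 1) : D = 0 := by
  have key : ∀ j, ∀ v ∈ G.gr j, D v = 0 := by
    intro j v hv
    have e0 := h0 j v hv
    have e1 := h1 j v hv
    rcases zmod_two_cases j with rfl | rfl
    · exact Submodule.disjoint_def.1 G.isCompl.disjoint _ e0 e1
    · exact Submodule.disjoint_def.1 G.isCompl.disjoint _ e1 e0
  refine LinearMap.ext fun v => ?_
  obtain ⟨a, ha, b, hb, rfl⟩ := G.exists_add v
  rw [map_add, key 0 a ha, key 1 b hb, add_zero, LinearMap.zero_apply]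

/-- An element of `W(n)` is a sum of an even and an odd superderivation; for a homogeneous element
the part of the wrong parity is both even and odd, so it vanishes. -/
theorem mem_superDer {i : ZMod 2} {D : Module.End k (Ext k n)} (hD : D ∈ cartanW k n)
    (hDi : D ∈ endGr (extGrading k n) i) : D ∈ superDer k n i := by
  have h1 : cartanW k n ≤ superDer k n 0 ⊔ superDer k n 1 := by
    refine Submodule.span_le.2 ?_
    rintro D ⟨i, hD⟩
    rcases zmod_two_cases i with rfl | rfl
    · exact Submodule.mem_sup_left hD
    · exact Submodule.mem_sup_right hD
  obtain ⟨D0, h0, D1, h1, rfl⟩ := Submodule.mem_sup.1 (h1 hD)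
  rcases zmod_two_cases i with rfl | rfl
  · have h2 : D1 ∈ endGr (extGrading k n) 0 := by
      have := sub_mem hDi h0.1
      rwa [add_sub_cancel_left] at this
    rwa [endGr_disjoint _ h2 h1.1, add_zero]
  · have h2 : D0 ∈ endGr (extGrading k n) 1 := by
      have := sub_mem hDi h1.1
      rwa [add_sub_cancel_right] at this
    rwa [endGr_disjoint _ h0.1 h2, zero_add]

theorem mul_mem_superDer {i j : ZMod 2} {f : Ext k n} (hf : f ∈ (extGrading k n).gr i)
    {D : Module.End k (Ext k n)} (hD : D ∈ superDer k n j) :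
    LinearMap.mulLeft k f ∘ₗ D ∈ superDer k n (i + j) := by
  refine ⟨fun a x hx => ?_, fun a x hx y => ?_⟩
  · rw [add_assoc]
    exact ext_mul_mem hf (hD.1 a x hx)
  · simp only [LinearMap.comp_apply, LinearMap.mulLeft_apply]
    rw [hD.2 a x hx y, mul_add, mul_smul_comm, ← mul_assoc f x, ext_mul_comm hf hx, mul_assoc,
      smul_mul_assoc, smul_smul, mul_assoc]
    congr 2
    rcases zmod_two_cases i with rfl | rfl <;> rcases zmod_two_cases j with rfl | rfl <;>
      rcases zmod_two_cases a with rfl | rfl <;> simp [sgn, show (1 : ZMod 2) + 1 = 0 from rfl]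

theorem endGr_mul {V : Type u} [AddCommGroup V] [Module k V] {G : Z2Grading k V} {i j : ZMod 2}
    {D E : Module.End k V} (hD : D ∈ endGr G i) (hE : E ∈ endGr G j) : D * E ∈ endGr G (i + j) :=
  fun a v hv => by rw [add_assoc]; exact hD _ _ (hE a v hv)

theorem commutator_mem_superDer {i j : ZMod 2} {D E : Module.End k (Ext k n)}
    (hD : D ∈ superDer k n i) (hE : E ∈ superDer k n j) :
    D * E - sgn k i j • (E * D) ∈ superDer k n (i + j) := by
  refine ⟨sub_mem (endGr_mul hD.1 hE.1) (Submodule.smul_mem _ _ ?_), fun a x hx y => ?_⟩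
  · rw [add_comm]; exact endGr_mul hE.1 hD.1
  · simp only [LinearMap.sub_apply, LinearMap.smul_apply, Module.End.mul_apply]
    rw [hE.2 a x hx y, hD.2 a x hx y, map_add, map_add, map_smul, map_smul,
      hD.2 _ _ (hE.1 a x hx), hD.2 a x hx, hE.2 _ _ (hD.1 a x hx), hE.2 a x hx]
    simp only [sub_mul, mul_sub, smul_add, smul_sub, smul_smul, smul_mul_assoc, mul_smul_comm]
    -- The sign identity is verified in each of the eight combinations of parities.
    rcases zmod_two_cases i with rfl | rfl <;> rcases zmod_two_cases j with rfl | rfl <;>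
      rcases zmod_two_cases a with rfl | rfl <;>
      simp [sgn, show (1 : ZMod 2) + 1 = 0 from rfl] <;> abel

theorem pd_mul (i : Fin n) (x y : Ext k n) :
    pd k n i (x * y) = pd k n i x * y + CliffordAlgebra.involute x * pd k n i y := by
  induction x using ExteriorAlgebra.induction generalizing y with
  | algebraMap r =>
    rw [AlgHom.commutes, show pd k n i (algebraMap k _ r) = 0 from
      CliffordAlgebra.contractLeft_algebraMap _ _ r, zero_mul, zero_add]
    exact CliffordAlgebra.contractLeft_algebraMap_mul _ r y
  | ι w =>
    have h1 := CliffordAlgebra.involute_ι (Q := (0 : QuadraticForm k (Fin n → k))) w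
    have h2 := CliffordAlgebra.contractLeft_ι_mul (Q := (0 : QuadraticForm k (Fin n → k)))
      (d := LinearMap.proj i) w y
    have h3 := CliffordAlgebra.contractLeft_ι (Q := (0 : QuadraticForm k (Fin n → k)))
      (d := LinearMap.proj i) w
    refine h2.trans ?_
    rw [show CliffordAlgebra.involute (ExteriorAlgebra.ι k w) = -ExteriorAlgebra.ι k w from h1,
      show pd k n i (ExteriorAlgebra.ι k w) = _ from h3, neg_mul, ← sub_eq_add_neg,
      Algebra.smul_def]
    rfl
  | mul a b ha hb => rw [mul_assoc, ha, hb, ha b, map_mul, mul_add, add_mul, add_assoc, mul_assoc,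
      mul_assoc, mul_assoc]
  | add a b ha hb => rw [map_add, map_add, add_mul, map_add, ha, hb, add_mul, add_mul]; abel

theorem pd_ι (i : Fin n) (v : Fin n → k) :
    pd k n i (ExteriorAlgebra.ι k v) = algebraMap k _ (v i) :=
  CliffordAlgebra.contractLeft_ι _ _ v

theorem involute_pd (i : Fin n) (x : Ext k n) :
    CliffordAlgebra.involute (pd k n i x) = -pd k n i (CliffordAlgebra.involute x) := by
  induction x using ExteriorAlgebra.induction with
  | algebraMap r =>
    rw [AlgHom.commutes, show pd k n i (algebraMap k _ r) = 0 from
      CliffordAlgebra.contractLeft_algebraMap _ _ r, map_zero, neg_zero]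
  | ι w =>
    have h1 := CliffordAlgebra.involute_ι (Q := (0 : QuadraticForm k (Fin n → k))) w
    rw [show CliffordAlgebra.involute (ExteriorAlgebra.ι k w) = -ExteriorAlgebra.ι k w from h1,
      map_neg, neg_neg, pd_ι, AlgHom.commutes]
  | mul a b ha hb =>
    rw [pd_mul, map_add, map_mul, map_mul, map_mul, pd_mul, ha, hb, neg_mul, mul_neg, neg_add]
  | add a b ha hb => rw [map_add, map_add, map_add, map_add, ha, hb, neg_add]

theorem pd_mem_superDer [CharZero k] (i : Fin n) : pd k n i ∈ superDer k n 1 := by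
  refine ⟨fun j x hx => ?_, fun j x hx y => ?_⟩
  · rw [mem_extGrading] at hx ⊢
    rw [involute_pd, hx, map_smul, ← neg_smul, sgn_add, sgn_one_one, neg_one_mul]
  · rw [pd_mul, involute_of_mem hx, smul_mul_assoc]
    rcases zmod_two_cases j with rfl | rfl <;> simp [sgn]

theorem mul_pd_mem_cartanW [CharZero k] (f : Ext k n) (i : Fin n) :
    LinearMap.mulLeft k f ∘ₗ pd k n i ∈ cartanW k n := by
  obtain ⟨a, ha, b, hb, rfl⟩ := (extGrading k n).exists_add f
  rw [show LinearMap.mulLeft k (a + b) = LinearMap.mulLeft k a + LinearMap.mulLeft k b from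
    LinearMap.ext fun x => add_mul a b x, LinearMap.add_comp]
  exact add_mem (superDer_le_cartanW _ (mul_mem_superDer ha (pd_mem_superDer i)))
    (superDer_le_cartanW _ (mul_mem_superDer hb (pd_mem_superDer i)))

theorem cartanHTilde_le [CharZero k] : cartanHTilde k n ≤ cartanW k n := by
  refine Submodule.span_le.2 ?_
  rintro _ ⟨x, rfl⟩
  exact sum_mem fun i _ => mul_pd_mem_cartanW _ i

theorem cartanH_le [CharZero k] : cartanH k n ≤ cartanW k n := by
  refine Submodule.span_le.2 ?_
  rintro _ ⟨i, j, D, hD, E, hE, rfl⟩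
  exact superDer_le_cartanW _ (commutator_mem_superDer
    (mem_superDer (cartanHTilde_le hD.1) hD.2) (mem_superDer (cartanHTilde_le hE.1) hE.2))

theorem IsCartanFamily.le_cartanW [CharZero k] {L : Submodule k (Module.End k (Ext k n))}
    (h : IsCartanFamily k n L) : L ≤ cartanW k n := by
  rcases h with ⟨-, rfl⟩ | ⟨-, rfl⟩ | ⟨-, -, rfl⟩ | ⟨-, rfl⟩
  · exact le_rfl
  · exact inf_le_left
  · exact inf_le_left
  · exact cartanH_le

/-- An even superderivation is an ordinary derivation, so it kills `1` and is determined by its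
values on generators. -/
theorem eq_zero_of_superDer {D : Module.End k (Ext k n)} (hD : D ∈ superDer k n 0)
    (h : ∀ v, D (ExteriorAlgebra.ι k v) = 0) : D = 0 := by
  have hmul : ∀ x y, D (x * y) = D x * y + x * D y := by
    intro x y
    obtain ⟨a, ha, b, hb, rfl⟩ := (extGrading k n).exists_add x
    rw [add_mul, map_add, hD.2 0 a ha, hD.2 1 b hb, sgn_zero_one, show sgn k 0 0 = 1 by simp [sgn],
      one_smul, one_smul, map_add, add_mul, add_mul]
    abel
  have h1 : D 1 = 0 := by
    have := hmul 1 1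
    rw [mul_one, mul_one, one_mul] at this
    exact left_eq_add.1 this
  refine LinearMap.ext fun x => ?_
  rw [LinearMap.zero_apply]
  induction x using ExteriorAlgebra.induction with
  | algebraMap r => rw [Algebra.algebraMap_eq_smul_one, map_smul, h1, smul_zero]
  | ι w => exact h w
  | mul a b ha hb => rw [hmul, ha, hb, zero_mul, mul_zero, add_zero]
  | add a b ha hb => rw [map_add, ha, hb, add_zero]

/-- The exterior powers beyond the `n`-th vanish, leaving a finite sum of finite-dimensional ones.
-/
instance : FiniteDimensional k (Ext k n) := by
  have h1 : ⨆ i : ℕ, ⋀[k]^i (Fin n → k) = ⊤ :=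
    (DirectSum.Decomposition.isInternal fun i : ℕ => ⋀[k]^i (Fin n → k)).submodule_iSup_eq_top
  have h2 : ⨆ i : ℕ, ⋀[k]^i (Fin n → k) ≤ ⨆ i : Fin (n + 1), ⋀[k]^(i : ℕ) (Fin n → k) := by
    refine iSup_le fun i => ?_
    rcases lt_or_ge i (n + 1) with h | h
    · exact le_iSup (fun i : Fin (n + 1) => ⋀[k]^(i : ℕ) (Fin n → k)) ⟨i, h⟩
    · have : Subsingleton (⋀[k]^i (Fin n → k)) := by
        apply (Module.finrank_zero_iff (R := k)).1
        rw [exteriorPower.finrank_eq, Module.finrank_fin_fun]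
        exact Nat.choose_eq_zero_of_lt h
      rw [Submodule.eq_bot_of_subsingleton (p := ⋀[k]^i (Fin n → k))]
      exact bot_le
  rw [h1, top_le_iff] at h2
  have : FiniteDimensional k (⊤ : Submodule k (Ext k n)) := by rw [← h2]; infer_instance
  exact (Submodule.topEquiv (R := k) (M := Ext k n)).finiteDimensional

theorem pd_ξ (i j : Fin n) : pd k n i (ξ k n j) = if i = j then 1 else 0 := by
  rw [ξ, pd_ι, Pi.single_apply]
  split_ifs <;> simp

/-- The product is alternating in its `n + 1` factors and repeats `ξ_i`. -/
theorem ξ_mul_ξTop (i : Fin n) : ξ k n i * ξTop k n = 0 := by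
  have h := ExteriorAlgebra.ιMulti_succ_apply (R := k)
    (Fin.cons (Pi.single i 1) fun j : Fin n => (Pi.single j 1 : Fin n → k))
  rw [ExteriorAlgebra.ιMulti_apply (n := n)] at h
  refine Eq.trans ?_ (h.symm.trans ?_)
  · rfl
  · exact AlternatingMap.map_eq_zero_of_eq _ _ (i := 0) (j := i.succ) (by simp)
      (Fin.succ_ne_zero i).symm

/-- The superderivation `ξ_j ∂_i`. -/
noncomputable def unitDer (k : Type u) [Field k] {n : ℕ} (j i : Fin n) : Module.End k (Ext k n) :=
  LinearMap.mulLeft k (ξ k n j) ∘ₗ pd k n i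

theorem unitDer_apply (j i : Fin n) (x : Ext k n) :
    unitDer k j i x = ξ k n j * pd k n i x := rfl

theorem unitDer_ι (j i : Fin n) (v : Fin n → k) :
    unitDer k j i (ExteriorAlgebra.ι k v) = ExteriorAlgebra.ι k (v i • Pi.single j 1) := by
  rw [unitDer_apply, pd_ι, ← Algebra.commutes, ← Algebra.smul_def, map_smul]
  rfl

theorem unitDer_mem_superDer [CharZero k] (j i : Fin n) : unitDer k j i ∈ superDer k n 0 := by
  have h := mul_mem_superDer (f := ξ k n j) (ι_mem_gr (Pi.single j 1)) (pd_mem_superDer i)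
  rwa [show (1 : ZMod 2) + 1 = 0 from rfl] at h

theorem divergence_unitDer {j i : Fin n} (h : i ≠ j) : divergence k n (unitDer k j i) = 0 := by
  simp only [divergence, LinearMap.sum_apply, LinearMap.comp_apply, LinearMap.applyₗ_apply_apply]
  refine Finset.sum_eq_zero fun l _ => ?_
  rw [unitDer_apply, pd_ξ]
  split_ifs with hl
  · rw [mul_one, pd_ξ, if_neg (hl ▸ h)]
  · rw [mul_zero, map_zero]

/-- Apply `∂_i` to `ξ_j ξ_1 ⋯ ξ_n = 0`; the term `∂_i ξ_j` vanishes for `i ≠ j`. -/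
theorem unitDer_ξTop [CharZero k] {j i : Fin n} (h : i ≠ j) : unitDer k j i (ξTop k n) = 0 := by
  have h1 := (pd_mem_superDer (k := k) i).2 1 (ξ k n j) (ι_mem_gr _) (ξTop k n)
  rw [ξ_mul_ξTop, map_zero, pd_ξ, if_neg h, zero_mul, zero_add, sgn_one_one, neg_one_smul] at h1
  exact neg_eq_zero.1 h1.symm

/-- The quadratic Hamiltonians act on the generators as elementary skew-symmetric matrices. -/
theorem hamiltonian_ξ_mul_ξ {i j : Fin n} (h : i ≠ j) :
    hamiltonian k n (ξ k n i * ξ k n j) = unitDer k j i - unitDer k i j := by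
  have h1 : ∀ l, pd k n l (ξ k n i * ξ k n j) =
      (if l = i then ξ k n j else 0) - if l = j then ξ k n i else 0 := by
    intro l
    have := CliffordAlgebra.involute_ι (Q := (0 : QuadraticForm k (Fin n → k))) (Pi.single i 1)
    rw [pd_mul, pd_ξ, pd_ξ, show CliffordAlgebra.involute (ξ k n i) = -ξ k n i from this]
    by_cases hi : l = i <;> by_cases hj : l = j
    · exact absurd (hi.symm.trans hj) h
    all_goals simp [hi, hj, h, h.symm]
  refine LinearMap.ext fun x => ?_
  simp only [hamiltonian, LinearMap.sum_apply, LinearMap.comp_apply, LinearMap.mulLeft_apply, h1,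
    sub_mul, ite_mul, zero_mul, Finset.sum_sub_distrib, Finset.sum_ite_eq',
    Finset.mem_univ, if_true]
  rfl

/-- The generators of the Lie algebra of skew-symmetric matrices. -/
noncomputable def skewDer (k : Type u) [Field k] {n : ℕ} (i j : Fin n) : Module.End k (Ext k n) :=
  unitDer k j i - unitDer k i j

theorem skewDer_ι (i j : Fin n) (v : Fin n → k) :
    skewDer k i j (ExteriorAlgebra.ι k v) =
      ExteriorAlgebra.ι k (v i • Pi.single j 1 - v j • Pi.single i 1) := by
  rw [skewDer, LinearMap.sub_apply, unitDer_ι, unitDer_ι, map_sub]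

/-- `H(n)` is spanned by brackets, so elementary skew-symmetric matrices are reached in it as
commutators through an auxiliary third index. -/
theorem commutator_skewDer_mem [CharZero k] {i j l : Fin n} (hij : i ≠ j) (hjl : j ≠ l) :
    skewDer k i j * skewDer k j l - skewDer k j l * skewDer k i j ∈ cartanH k n := by
  have h : ∀ i j : Fin n, i ≠ j → skewDer k i j ∈ cartanHTilde k n ⊓ endGr (extGrading k n) 0 :=
    fun i j hij => ⟨Submodule.subset_span ⟨_, hamiltonian_ξ_mul_ξ hij⟩,
      sub_mem (unitDer_mem_superDer j i).1 (unitDer_mem_superDer i j).1⟩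
  refine Submodule.subset_span ⟨0, 0, _, h i j hij, _, h j l hjl, ?_⟩
  rw [show sgn k 0 0 = 1 by simp [sgn], one_smul]

theorem commutator_skewDer_ι {i j l : Fin n} (hij : i ≠ j) (hjl : j ≠ l) (hil : i ≠ l)
    (v : Fin n → k) :
    (skewDer k i j * skewDer k j l - skewDer k j l * skewDer k i j) (ExteriorAlgebra.ι k v) =
      ExteriorAlgebra.ι k (v l • Pi.single i 1 - v i • Pi.single l 1) := by
  rw [LinearMap.sub_apply, Module.End.mul_apply, Module.End.mul_apply, skewDer_ι, skewDer_ι,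
    skewDer_ι, skewDer_ι, ← map_sub]
  congr 1
  simp [hij, hjl, hil, hij.symm, hjl.symm, hil.symm]

/-- Take `v_i ≠ 0` and three distinct indices `i, l, j`. The skew matrices for `(i, l)` and then
`(j, l)` turn `v` into `-v_i e_j`, and from `e_j` every other basis vector is reached. -/
theorem eq_bot_or_top_of_skew_stable (hn : 3 ≤ n) (N : Submodule k (Fin n → k))
    (hN : ∀ i l : Fin n, i ≠ l → ∀ v ∈ N, v l • Pi.single i (1 : k) - v i • Pi.single l 1 ∈ N) :
    N = ⊥ ∨ N = ⊤ := by
  rw [or_iff_not_imp_left]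
  intro h
  obtain ⟨v, hv, hv0⟩ := (Submodule.ne_bot_iff _).1 h
  obtain ⟨i, hi⟩ := Function.ne_iff.1 hv0
  have hex : ∀ a b : Fin n, ∃ c, c ≠ a ∧ c ≠ b := by
    intro a b
    have : ({a, b} : Finset (Fin n)).card < (Finset.univ : Finset (Fin n)).card := by
      rw [Finset.card_univ, Fintype.card_fin]
      exact Finset.card_le_two.trans_lt hn
    obtain ⟨c, -, hc⟩ := Finset.exists_mem_notMem_of_card_lt_card this
    simp only [Finset.mem_insert, Finset.mem_singleton, not_or] at hc
    exact ⟨c, hc⟩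
  obtain ⟨l, hl, -⟩ := hex i i
  obtain ⟨j, hji, hjl⟩ := hex i l
  have h1 := hN j l hjl _ (hN i l hl.symm v hv)
  simp only [Pi.sub_apply, Pi.smul_apply, Pi.single_apply, hl, hjl, hji, if_true, if_false,
    smul_eq_mul, mul_zero, mul_one, zero_sub, sub_zero, zero_smul] at h1
  have h2 : Pi.single j (1 : k) ∈ N := (Submodule.smul_mem_iff _ (neg_ne_zero.2 hi)).1 h1
  have h3 : ∀ m, Pi.single m (1 : k) ∈ N := by
    intro m
    by_cases hm : m = j
    · exact hm ▸ h2
    · have := hN m j hm _ h2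
      rwa [Pi.single_eq_same, one_smul, Pi.single_eq_of_ne hm, zero_smul, sub_zero] at this
  rw [eq_top_iff]
  intro w _
  rw [← (Pi.basisFun k (Fin n)).sum_repr w]
  exact sum_mem fun m _ => Submodule.smul_mem _ _ (by rw [Pi.basisFun_apply]; exact h3 m)

/-- The elements of degree zero of a Lie superalgebra of Cartan type act irreducibly on the span of
the generators. -/
theorem IsCartanFamily.eq_bot_or_top [CharZero k] {L : Submodule k (Module.End k (Ext k n))}
    (h : IsCartanFamily k n L) (N : Submodule k (Fin n → k))
    (hN : ∀ D ∈ L ⊓ endGr (extGrading k n) 0, ∀ F : Module.End k (Fin n → k),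
      (∀ v, D (ExteriorAlgebra.ι k v) = ExteriorAlgebra.ι k (F v)) → ∀ v ∈ N, F v ∈ N) :
    N = ⊥ ∨ N = ⊤ := by
  have key : 2 ≤ n → (∀ i j : Fin n, i ≠ j → unitDer k i j ∈ L) → N = ⊥ ∨ N = ⊤ := by
    intro hn hu
    refine eq_bot_or_top_of_stable hn N fun i j hij v hv => ?_
    exact hN _ ⟨hu i j hij, (unitDer_mem_superDer i j).1⟩
      ((LinearMap.proj j : (Fin n → k) →ₗ[k] k).smulRight (Pi.single i 1)) (unitDer_ι i j) v hv
  have hdiv : ∀ i j : Fin n, i ≠ j → unitDer k i j ∈ cartanS k n := fun i j hij =>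
    ⟨superDer_le_cartanW _ (unitDer_mem_superDer i j), divergence_unitDer hij.symm⟩
  rcases h with ⟨hn, rfl⟩ | ⟨hn, rfl⟩ | ⟨hn, -, rfl⟩ | ⟨hn, rfl⟩
  · exact key hn fun i j _ => superDer_le_cartanW _ (unitDer_mem_superDer i j)
  · exact key (by omega) hdiv
  -- For `i ≠ j` the derivation `ξ_i ∂_j` has divergence zero and also kills `ξ_1 ⋯ ξ_n`, so the
  -- twisted condition holds term by term.
  · refine key (by omega) fun i j hij => ⟨(hdiv i j hij).1, LinearMap.mem_ker.2 ?_⟩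
    rw [LinearMap.add_apply, LinearMap.comp_apply, divergence_unitDer hij.symm,
      map_zero, zero_add]
    exact unitDer_ξTop hij.symm
  -- The degree-zero part of `H(n)` contains only skew-symmetric operators, so the matrix units are
  -- not available here.
  · refine eq_bot_or_top_of_skew_stable (by omega) N fun i l hil v hv => ?_
    obtain ⟨j, hji, hjl⟩ : ∃ j, j ≠ i ∧ j ≠ l := by
      have : ({i, l} : Finset (Fin n)).card < (Finset.univ : Finset (Fin n)).card := by
        rw [Finset.card_univ, Fintype.card_fin]
        exact Finset.card_le_two.trans_lt (by omega)
      obtain ⟨c, -, hc⟩ := Finset.exists_mem_notMem_of_card_lt_card this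
      simp only [Finset.mem_insert, Finset.mem_singleton, not_or] at hc
      exact ⟨c, hc⟩
    have hm : ∀ i j : Fin n, skewDer k i j ∈ endGr (extGrading k n) 0 := fun i j =>
      sub_mem (unitDer_mem_superDer j i).1 (unitDer_mem_superDer i j).1
    exact hN _ ⟨commutator_skewDer_mem hji.symm hjl,
      sub_mem (endGr_mul (i := 0) (j := 0) (hm _ _) (hm _ _))
        (endGr_mul (i := 0) (j := 0) (hm _ _) (hm _ _))⟩
      ((LinearMap.proj l : (Fin n → k) →ₗ[k] k).smulRight (Pi.single i 1) -
        (LinearMap.proj i : (Fin n → k) →ₗ[k] k).smulRight (Pi.single l 1))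
      (commutator_skewDer_ι hji.symm hjl hil) v hv

theorem IsCartanFamily.two_le {L : Submodule k (Module.End k (Ext k n))}
    (h : IsCartanFamily k n L) : 2 ≤ n := by
  rcases h with ⟨h, -⟩ | ⟨h, -⟩ | ⟨h, -⟩ | ⟨h, -⟩ <;> omega

end Exterior

/-! ### Separation for Cartan type, and all types together. -/

section ReductivePart

variable {k g : Type u} [Field k] [CharZero k] [AddCommGroup g] [Module k g] [LieSuperalgebra k g]
  {r : LieSubalgebra k (EvenPart k g)}

/-- The span of the generators is an irreducible module for `r`. It is faithful because an even
superderivation is determined by its values there. -/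
theorem isSeparated_of_isCartanTypeWith (h : IsCartanTypeWith r) :
    IsSeparatedByIrreducibles k r := by
  obtain ⟨n, L, hL, φ, ⟨hinj, hgr, hbr⟩, hrange, hr⟩ := h
  rw [isSeparated_iff]
  intro x hx
  have hn : Nonempty (Fin n) := ⟨⟨0, by have := hL.two_le; omega⟩⟩
  -- Elements of `r` preserve the span of the generators, so `ιInv` loses nothing when it reads off
  -- coordinates.
  let ρ : r →ₗ[k] Module.End k (Fin n → k) :=
    { toFun := fun y => ExteriorAlgebra.ιInv ∘ₗ φ (subIncl r y) ∘ₗ ExteriorAlgebra.ι k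
      map_add' := fun y z => by rw [map_add, map_add, LinearMap.add_comp, LinearMap.comp_add]
      map_smul' := fun c y => by
        rw [map_smul, map_smul, LinearMap.smul_comp, LinearMap.comp_smul, RingHom.id_apply] }
  have hρ : ∀ (y : r) (v : Fin n → k),
      φ (subIncl r y) (ExteriorAlgebra.ι k v) = ExteriorAlgebra.ι k (ρ y v) := by
    intro y v
    have h1 : ∀ v, φ (subIncl r y) (ExteriorAlgebra.ι k v) ∈
        LinearMap.range (ExteriorAlgebra.ι k : (Fin n → k) →ₗ[k] _) := by
      intro v
      rw [← (Pi.basisFun k (Fin n)).sum_repr v, map_sum, map_sum]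
      refine sum_mem fun i _ => ?_
      rw [map_smul, map_smul, Pi.basisFun_apply]
      refine Submodule.smul_mem _ _ ?_
      have := (hr y).1 y.2 i
      rwa [ExteriorAlgebra.exteriorPower, pow_one] at this
    obtain ⟨w, hw⟩ := h1 v
    change _ = ExteriorAlgebra.ι k (ExteriorAlgebra.ιInv (φ (subIncl r y) (ExteriorAlgebra.ι k v)))
    rw [← hw, ExteriorAlgebra.ι_leftInverse]
  have hmul : ∀ y z v, ρ ⁅y, z⁆ v = ρ y (ρ z v) - ρ z (ρ y v) := by
    intro y z v
    apply (ExteriorAlgebra.ι_leftInverse (R := k)).injective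
    rw [← hρ, map_sub, ← hρ, ← hρ, ← hρ, ← hρ, subIncl_lie,
      hbr 0 0 _ (subIncl_mem y) _ (subIncl_mem z), show sgn k 0 0 = 1 by simp [sgn], one_smul]
    rfl
  have h0 := hx.apply_eq_zero ρ hmul fun N hN => by
    refine hL.eq_bot_or_top N fun D hD F hF v hv => ?_
    obtain ⟨y, rfl⟩ : ∃ y, φ y = D := by
      have := hD.1
      rwa [← hrange] at this
    obtain ⟨a, ha, b, hb, rfl⟩ := (LieSuperalgebra.grading (k := k) (g := g)).exists_add y
    -- Both `D` and `φ a` are even, so `φ b` is even as well as odd.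
    have h1 : φ b = 0 := by
      refine endGr_disjoint _ ?_ (hgr 1 b hb)
      have := sub_mem hD.2 (hgr 0 a ha)
      rwa [map_add, add_sub_cancel_left] at this
    rw [map_add, h1, add_zero] at hF
    let a' : EvenPart k g := ⟨a, ha⟩
    have h2 : a' ∈ r := (hr a').2 fun i => by
      rw [ExteriorAlgebra.exteriorPower, pow_one]
      exact ⟨_, (hF (Pi.single i 1)).symm⟩
    have h3 : F v = ρ ⟨a', h2⟩ v := by
      apply (ExteriorAlgebra.ι_leftInverse (R := k)).injective
      rw [← hρ, ← hF]
      rfl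
    rw [h3]
    exact hN _ v hv
  apply subIncl_injective
  apply hinj
  rw [map_zero, map_zero]
  refine eq_zero_of_superDer (mem_superDer (hL.le_cartanW ?_) (hgr 0 _ (subIncl_mem x))) fun v => by
    rw [hρ, h0, map_zero]
  rw [← hrange]
  exact ⟨_, rfl⟩

theorem IsReductivePart.finiteDimensional (h : IsReductivePart r) : FiniteDimensional k g := by
  rcases h with ⟨⟨n, -, φ, ⟨h, -⟩, -⟩, -⟩ | ⟨h, -⟩ | ⟨n, L, -, φ, ⟨h, -⟩, -⟩
  · exact FiniteDimensional.of_injective φ h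
  · exact h
  · exact FiniteDimensional.of_injective φ h

theorem IsReductivePart.isSeparated (h : IsReductivePart r) : IsSeparatedByIrreducibles k r := by
  rcases h with ⟨h, rfl⟩ | ⟨_, hs, hc, -, rfl⟩ | h
  · exact isSeparated_of_isSpecialLinear h
  · exact isSeparated_of_classical hs hc
  · exact isSeparated_of_isCartanTypeWith h

end ReductivePart

/-! ### Modules over enveloping superalgebras -/

section Enveloping

variable {k g : Type u} [Field k] [AddCommGroup g] [Module k g] [LieSuperalgebra k g]

theorem U.induction {C : U k g → Prop} (algebraMap : ∀ c, C (algebraMap k _ c))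
    (ι : ∀ x, C (U.ι k x)) (mul : ∀ a b, C a → C b → C (a * b))
    (add : ∀ a b, C a → C b → C (a + b)) (u : U k g) : C u := by
  obtain ⟨t, rfl⟩ := RingQuot.mkAlgHom_surjective k (URel k g) u
  induction t using TensorAlgebra.induction with
  | algebraMap c => rw [AlgHom.commutes]; exact algebraMap c
  | ι x => exact ι x
  | mul a b ha hb => rw [map_mul]; exact mul _ _ ha hb
  | add a b ha hb => rw [map_add]; exact add _ _ ha hb

theorem U.ι_mul_ι_of_even {y : g} (hy : y ∈ gr k g 0) (x : g) :
    U.ι k y * U.ι k x = U.ι k x * U.ι k y + U.ι k (br k g y x) := by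
  obtain ⟨a, ha, b, hb, rfl⟩ := (LieSuperalgebra.grading (k := k) (g := g)).exists_add x
  have h1 := U.ι_mul_ι hy ha
  have h2 := U.ι_mul_ι hy hb
  rw [show sgn k 0 0 = 1 by simp [sgn], one_smul] at h1
  rw [sgn_zero_one, one_smul] at h2
  simp only [map_add, mul_add, add_mul]
  rw [h1, h2]
  abel

variable {M : Type*} [AddCommGroup M] [Module k M] [Module (U k g) M] [IsScalarTower k (U k g) M]

/-- A subspace which is stable under `g` is stable under `U(g)`. -/
theorem U.smul_mem {N : Submodule k M} (hN : ∀ x : g, ∀ m ∈ N, U.ι k x • m ∈ N) (u : U k g) :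
    ∀ m ∈ N, u • m ∈ N := by
  induction u using U.induction with
  | algebraMap c => intro m hm; rw [algebraMap_smul]; exact N.smul_mem c hm
  | ι x => exact hN x
  | mul a b ha hb => intro m hm; rw [mul_smul]; exact ha _ (hb m hm)
  | add a b ha hb => intro m hm; rw [add_smul]; exact add_mem (ha m hm) (hb m hm)

theorem U.ι_smul_ι_smul_of_even {y : g} (hy : y ∈ gr k g 0) (x : g) (m : M) :
    U.ι k y • U.ι k x • m = U.ι k x • U.ι k y • m + U.ι k (br k g y x) • m := by
  rw [← mul_smul, ι_mul_ι_of_even hy, add_smul, mul_smul]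

end Enveloping

namespace TriangularDecomposition

variable {k g : Type u} [Field k] [CharZero k] [AddCommGroup g] [Module k g] [LieSuperalgebra k g]
  (T : TriangularDecomposition k g) {A : Type u} [CommRing A] [Algebra k A]

/-! ### The root space decomposition of the reductive part -/

theorem inclR_injective : Function.Injective T.inclR := subIncl_injective

/-- The adjoint action of `h` on `g`. -/
def adH : T.h →ₗ[k] Module.End k g := br k g ∘ₗ T.inclH

theorem isWeighted_adH : IsWeighted T.adH := T.iSup_rootSpace

/-- That `h` is its own centralizer is the equality of the zero root space with `h`;
diagonalizability passes from `g` to the stable subspace `r`. -/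
theorem isSplitCartan : IsSplitCartan T.h where
  mem_iff x := by
    constructor
    · intro hx y
      exact T.inclR_injective ((T.br_inclH y ⟨x, hx⟩).trans (map_zero _).symm)
    · intro h
      have h1 : T.inclR x ∈ rootSpace T.h 0 := fun y => by
        rw [LinearMap.zero_apply, zero_smul]
        exact (congrArg T.inclR (h y)).trans (map_zero _)
      rw [T.rootSpace_zero] at h1
      obtain ⟨y, hy⟩ := h1
      rw [← T.inclR_injective (show T.inclR y = T.inclR x from hy)]
      exact y.2
  isWeighted := T.isWeighted_adH.of_injective (φ := T.inclR) (fun _ _ => rfl) T.inclR_injective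

theorem mem_wt_r {α : Module.Dual k T.h} {x : T.r} :
    x ∈ wt (act T.h T.r) α ↔ T.inclR x ∈ rootSpace T.h α := by
  rw [mem_wt_act]
  refine forall_congr' fun y => ?_
  rw [← T.inclR_injective.eq_iff, map_smul]
  rfl

theorem rootSpace_inf_ne_bot {α : Module.Dual k T.h} :
    rootSpace T.h α ⊓ LinearMap.range T.inclR ≠ ⊥ ↔ wt (act T.h T.r) α ≠ ⊥ := by
  rw [Submodule.ne_bot_iff, Submodule.ne_bot_iff]
  constructor
  · rintro ⟨_, ⟨hx, ⟨x, rfl⟩⟩, h0⟩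
    exact ⟨x, T.mem_wt_r.2 hx, fun h => h0 (by rw [h, map_zero])⟩
  · rintro ⟨x, hx, h0⟩
    exact ⟨_, ⟨T.mem_wt_r.1 hx, ⟨x, rfl⟩⟩, fun h => h0 (T.inclR_injective (h.trans (map_zero _).symm))⟩

theorem mem_roots_of_lieRoots {α : Module.Dual k T.h} (hα : α ∈ lieRoots T.h) :
    α ∈ roots T.h :=
  ⟨hα.1, fun h => T.rootSpace_inf_ne_bot.2 hα.2 (by rw [h, bot_inf_eq])⟩

variable {T} in
/-- A functional which defines the positive system. -/
structure IsRegular (f : Module.Dual k T.h →+ ℝ) : Prop where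
  ne_zero : ∀ α ∈ roots T.h, f α ≠ 0
  pos_eq : T.pos = {α ∈ roots T.h | 0 < f α}

theorem exists_isRegular : ∃ f : Module.Dual k T.h →+ ℝ, IsRegular f := by
  obtain ⟨f, h1, h2⟩ := T.exists_regular
  exact ⟨f, h1, h2⟩

variable {T} {f : Module.Dual k T.h →+ ℝ}

theorem IsRegular.mem_pos (hf : IsRegular f) {α : Module.Dual k T.h} :
    α ∈ T.pos ↔ α ∈ roots T.h ∧ 0 < f α := by rw [hf.pos_eq]; rfl

theorem IsRegular.posR_eq (hf : IsRegular f) : T.posR = posRoots f := by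
  ext α
  constructor
  · rintro ⟨h1, h2⟩
    rw [hf.mem_pos] at h1
    exact ⟨⟨h1.1.1, T.rootSpace_inf_ne_bot.1 h2⟩, h1.2⟩
  · rintro ⟨h1, h2⟩
    exact ⟨hf.mem_pos.2 ⟨T.mem_roots_of_lieRoots h1, h2⟩, T.rootSpace_inf_ne_bot.2 h1.2⟩

theorem IsRegular.simpleR_eq (hf : IsRegular f) : T.simpleR = simpleRoots f := by
  rw [simpleR, simpleRoots, hf.posR_eq]

theorem IsRegular.nonneg (hf : IsRegular f) {μ : Module.Dual k T.h}
    (hμ : μ ∈ AddSubmonoid.closure T.pos) : 0 ≤ f μ := by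
  induction hμ using AddSubmonoid.closure_induction with
  | mem α hα => exact (hf.mem_pos.1 hα).2.le
  | zero => rw [map_zero]
  | add a b _ _ ha hb => rw [map_add]; exact add_nonneg ha hb

/-- A regular functional is nonnegative on sums of positive roots but negative on `-α`. -/
theorem not_le_add {α lam : Module.Dual k T.h} (hα : α ∈ T.pos) : ¬ T.le (α + lam) lam := by
  intro h
  obtain ⟨f, hf⟩ := T.exists_isRegular
  have h1 := hf.nonneg h
  rw [map_sub, map_add] at h1
  have := (hf.mem_pos.1 hα).2
  linarith

/-! ### Modules over the map superalgebra as modules over the reductive part -/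

noncomputable instance (M : SuperMod k (U k (g ⊗[k] A))) : LieRingModule T.r M where
  bracket x m := U.ι k (T.inclR x ⊗ₜ[k] (1 : A)) • m
  add_lie x y m := by
    change U.ι k (T.inclR (x + y) ⊗ₜ[k] (1 : A)) • m = _ • m + _ • m
    rw [map_add, TensorProduct.add_tmul, map_add, add_smul]
  lie_add x m n := smul_add _ m n
  leibniz_lie x y m := by
    rw [U.ι_smul_ι_smul_of_even (tmul_mem_mapGr (T.inclR_mem x) 1), add_comm]
    congr 3
    exact (mapBr_tmul k g A _ _ 1 1).trans (by rw [mul_one]; rfl)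

theorem lie_def {M : SuperMod k (U k (g ⊗[k] A))} (x : T.r) (m : M) :
    ⁅x, m⁆ = U.ι k (T.inclR x ⊗ₜ[k] (1 : A)) • m := rfl

instance (M : SuperMod k (U k (g ⊗[k] A))) : LieModule k T.r M where
  smul_lie c x m := by
    rw [lie_def, lie_def, map_smul, ← TensorProduct.smul_tmul', map_smul, smul_assoc]
  lie_smul c x m := by rw [lie_def, lie_def, smul_algebra_smul_comm]

theorem isFinitelySemisimple_iff (M : SuperMod k (U k (g ⊗[k] A))) :
    T.IsFinitelySemisimple M ↔
      sSup {N : LieSubmodule k T.r M | FiniteDimensional k N ∧ IsAtom N} = ⊤ := by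
  rw [IsFinitelySemisimple, ← LieSubmodule.toSubmodule_eq_top, LieSubmodule.sSup_toSubmodule]
  refine Eq.congr_left (congrArg sSup (Set.ext fun N => ?_))
  constructor
  · rintro ⟨h1, h2, h3, h4⟩
    let N' : LieSubmodule k T.r M := { N with lie_mem := fun {x m} hm => h3 x m hm }
    refine ⟨N', ⟨h1, fun h => h2 ?_, fun P hP => ?_⟩, rfl⟩
    · exact congrArg LieSubmodule.toSubmodule h
    · rcases h4 P.toSubmodule hP.le fun x m hm => P.lie_mem hm with h | h
      · exact (LieSubmodule.toSubmodule_eq_bot P).1 h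
      · exact absurd (LieSubmodule.toSubmodule_injective h) hP.ne
  · rintro ⟨N, ⟨h1, h2⟩, rfl⟩
    refine ⟨h1, fun h => h2.1 ((LieSubmodule.toSubmodule_eq_bot N).1 h),
      fun x m hm => N.lie_mem hm, fun P hP hP' => ?_⟩
    let P' : LieSubmodule k T.r M := { P with lie_mem := fun {x m} hm => hP' x m hm }
    rcases h2.le_iff.1 (show P' ≤ N from hP) with h | h
    · exact Or.inl (congrArg LieSubmodule.toSubmodule h)
    · exact Or.inr (congrArg LieSubmodule.toSubmodule h)

theorem upperPart_eq_bot_iff {M : SuperMod k (U k (g ⊗[k] A))} {lam : Module.Dual k T.h} :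
    T.upperPart lam M = ⊥ ↔ ∀ μ, ¬ T.le μ lam → wt (act T.h M) μ = ⊥ := by
  rw [upperPart, Submodule.span_eq_bot]
  constructor
  · exact fun h μ hμ => (Submodule.eq_bot_iff _).2 fun m hm => h m ⟨μ, hμ, hm⟩
  · rintro h m ⟨μ, hμ, hm⟩
    exact (Submodule.eq_bot_iff _).1 (h μ hμ) m hm

/-- The three conditions on the right are inherited by sums of homomorphic images and can be tested
on generators, unlike the existence of a decomposition into irreducibles. -/
theorem catC_iff [IsAlgClosed k] [FiniteDimensional k T.r] (hr : IsReductive k T.r)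
    {lam : Module.Dual k T.h} {M : SuperMod k (U k (g ⊗[k] A))} :
    T.catC A lam M ↔ locallyFinitePart k T.r M = ⊤ ∧ IsWeighted (act T.h M) ∧
      ∀ μ, ¬ T.le μ lam → wt (act T.h M) μ = ⊥ := by
  rw [catC, isFinitelySemisimple_iff, sSup_irreducible_eq_top_iff hr T.isSplitCartan,
    upperPart_eq_bot_iff, and_assoc]

/-- Root vectors shift weights. -/
theorem tmul_smul_mem_wt {M : SuperMod k (U k (g ⊗[k] A))} {α μ : Module.Dual k T.h} {x : g}
    (hx : x ∈ rootSpace T.h α) (a : A) {m : M} (hm : m ∈ wt (act T.h M) μ) :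
    U.ι k (x ⊗ₜ[k] a) • m ∈ wt (act T.h M) (α + μ) := by
  intro y
  have h1 : br k (g ⊗[k] A) (T.inclH y ⊗ₜ 1) (x ⊗ₜ a) = α y • (x ⊗ₜ a) := by
    refine (mapBr_tmul k g A _ _ 1 a).trans ?_
    rw [one_mul, show br k g (T.inclH y) x = α y • x from hx y, TensorProduct.smul_tmul']
  refine (U.ι_smul_ι_smul_of_even (tmul_mem_mapGr (T.inclH_mem y) 1) _ m).trans ?_
  rw [h1, show U.ι k (T.inclH y ⊗ₜ[k] (1 : A)) • m = μ y • m from hm y, smul_algebra_smul_comm,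
    map_smul, smul_assoc, ← add_smul, add_comm, LinearMap.add_apply]

/-- Applying a positive root vector to a vector of weight `λ` gives weight `α + λ`, which is not `≤
λ`. -/
theorem tmul_smul_eq_zero {lam : Module.Dual k T.h} {M : SuperMod k (U k (g ⊗[k] A))}
    (hM : T.upperPart lam M = ⊥) {m : M} (hm : m ∈ wt (act T.h M) lam) {x : g}
    (hx : x ∈ T.nPlus) (a : A) : U.ι k (x ⊗ₜ[k] a) • m = 0 := by
  rw [upperPart_eq_bot_iff] at hM
  suffices h : T.nPlus ≤ LinearMap.ker ((LinearMap.toSpanSingleton (U k (g ⊗[k] A)) M m).restrictScalars k ∘ₗ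
      U.ι k ∘ₗ (TensorProduct.mk k g A).flip a) from h hx
  refine iSup₂_le fun α hα x hx => ?_
  have := tmul_smul_mem_wt hx a hm
  rw [hM _ (not_le_add hα)] at this
  exact this

theorem g_induction {p : g → Prop} (h0 : p 0) (hadd : ∀ x y, p x → p y → p (x + y))
    (h : ∀ α, ∀ x ∈ rootSpace T.h α, p x) (x : g) : p x := by
  obtain ⟨s, v, hv, rfl⟩ := T.isWeighted_adH.exists_sum x
  classical
  induction s using Finset.induction_on with
  | empty => exact h0
  | insert a s ha ih => rw [Finset.sum_insert ha]; exact hadd _ _ (h _ _ (hv a)) ih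

theorem mapSuper_induction {p : g ⊗[k] A → Prop} (h0 : p 0)
    (hadd : ∀ x y, p x → p y → p (x + y))
    (h : ∀ α, ∀ x ∈ rootSpace T.h α, ∀ a, p (x ⊗ₜ a)) (t : g ⊗[k] A) : p t := by
  induction t with
  | zero => exact h0
  | add s t hs ht => exact hadd _ _ hs ht
  | tmul x a =>
    refine T.g_induction (p := fun x => p (x ⊗ₜ a)) ?_ ?_ (fun α x hx => h α x hx a) x
    · rwa [TensorProduct.zero_tmul]
    · intro x y hx hy
      rw [TensorProduct.add_tmul]
      exact hadd _ _ hx hy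

/-- The sum of the weight spaces is stable under `U(g ⊗ A)`. -/
theorem smul_mem_iSup_wt {M : SuperMod k (U k (g ⊗[k] A))} (u : U k (g ⊗[k] A)) :
    ∀ m ∈ ⨆ μ, wt (act T.h M) μ, u • m ∈ ⨆ μ, wt (act T.h M) μ := by
  refine U.smul_mem (fun t m hm => ?_) u
  refine T.mapSuper_induction (p := fun t => U.ι k t • m ∈ ⨆ μ, wt (act T.h M) μ) ?_ ?_ ?_ t
  · rw [map_zero, zero_smul]; exact zero_mem _
  · intro x y hx hy
    rw [map_add, add_smul]; exact add_mem hx hy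
  · intro α x hx a
    suffices h : ⨆ μ, wt (act T.h M) μ ≤
        (⨆ μ, wt (act T.h M) μ).comap (Algebra.lsmul k k M (U.ι k (x ⊗ₜ[k] a))) from h hm
    exact iSup_le fun μ m hm => Submodule.mem_iSup_of_mem (α + μ) (tmul_smul_mem_wt hx a hm)

/-- A module generated by a weight vector is weighted. -/
theorem isWeighted_of_generated {M : SuperMod k (U k (g ⊗[k] A))} {μ : Module.Dual k T.h} {w : M}
    (hw : w ∈ wt (act T.h M) μ) (hgen : ∀ m : M, ∃ u : U k (g ⊗[k] A), u • w = m) :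
    IsWeighted (act T.h M) := by
  rw [IsWeighted, eq_top_iff]
  intro m _
  obtain ⟨u, rfl⟩ := hgen m
  exact smul_mem_iSup_wt u w (Submodule.mem_iSup_of_mem μ hw)

/-- The locally finite part is stable under `U(g ⊗ A)`. -/
theorem smul_mem_locallyFinitePart [FiniteDimensional k g] {M : SuperMod k (U k (g ⊗[k] A))}
    (u : U k (g ⊗[k] A)) :
    ∀ m ∈ (locallyFinitePart k T.r M).toSubmodule, u • m ∈ (locallyFinitePart k T.r M).toSubmodule := by
  refine U.smul_mem (fun t m hm => ?_) u
  induction t with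
  | zero => rw [map_zero, zero_smul]; exact zero_mem _
  | add s t hs ht => rw [map_add, add_smul]; exact add_mem hs ht
  | tmul x a =>
    obtain ⟨N, hN, hm⟩ := hm
    have : FiniteDimensional k N.toSubmodule := hN
    -- With `a` fixed, the vectors `(z ⊗ a) n` span an image of `g ⊗ N`, which is
    -- finite-dimensional. It is `r`-stable since `y (z ⊗ a) n = (z ⊗ a) y n + ([y, z] ⊗ a) n`.
    let φ : g ⊗[k] N.toSubmodule →ₗ[k] M := TensorProduct.lift
      (LinearMap.mk₂ k (fun x n => U.ι k (x ⊗ₜ[k] a) • (n : M))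
        (fun x y n => by rw [TensorProduct.add_tmul, map_add, add_smul])
        (fun c x n => by rw [← TensorProduct.smul_tmul', map_smul, smul_assoc])
        (fun x n n' => by rw [Submodule.coe_add, smul_add])
        (fun c x n => by rw [Submodule.coe_smul, smul_algebra_smul_comm]))
    have hφ : ∀ x (n : N.toSubmodule), φ (x ⊗ₜ n) = U.ι k (x ⊗ₜ[k] a) • (n : M) := fun _ _ => rfl
    refine ⟨{ LinearMap.range φ with lie_mem := ?_ }, ?_, ?_⟩
    · rintro y _ ⟨t, rfl⟩
      change ⁅y, φ t⁆ ∈ LinearMap.range φ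
      induction t with
      | zero => rw [map_zero, lie_zero]; exact zero_mem _
      | add s t hs ht => rw [map_add, lie_add]; exact add_mem hs ht
      | tmul z n =>
        rw [hφ, lie_def, U.ι_smul_ι_smul_of_even (tmul_mem_mapGr (T.inclR_mem y) 1)]
        refine add_mem ⟨z ⊗ₜ ⟨_, N.lie_mem (x := y) n.2⟩, rfl⟩ ⟨br k g (T.inclR y) z ⊗ₜ n, ?_⟩
        rw [hφ]
        congr 2
        exact ((mapBr_tmul k g A _ _ 1 a).trans (by rw [one_mul])).symm
    · exact LinearMap.finiteDimensional_range φ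
    · exact ⟨x ⊗ₜ ⟨m, hm⟩, rfl⟩

theorem locallyFinitePart_eq_top_of_generated [FiniteDimensional k g]
    {M : SuperMod k (U k (g ⊗[k] A))} {w : M} (hw : w ∈ locallyFinitePart k T.r M)
    (hgen : ∀ m : M, ∃ u : U k (g ⊗[k] A), u • w = m) : locallyFinitePart k T.r M = ⊤ := by
  rw [eq_top_iff]
  intro m _
  obtain ⟨u, rfl⟩ := hgen m
  exact smul_mem_locallyFinitePart u w hw

/-- A `g ⊗ A`-linear map. -/
theorem map_lie_of_linear {M N : SuperMod k (U k (g ⊗[k] A))} (φ : M →ₗ[U k (g ⊗[k] A)] N) (x : T.r)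
    (m : M) : φ ⁅x, m⁆ = ⁅x, φ m⁆ := map_smul φ _ m

/-- A module which is the sum of homomorphic images of objects of `C_A^lam` belongs to `C_A^lam`. -/
theorem catC_of_images [IsAlgClosed k] [FiniteDimensional k T.r] (hr : IsReductive k T.r)
    {lam : Module.Dual k T.h} {N : SuperMod k (U k (g ⊗[k] A))}
    (h : ∀ P : Submodule k N, (∀ M, T.catC A lam M → ∀ (φ : M →ₗ[U k (g ⊗[k] A)] N) (m : M),
      φ m ∈ P) → P = ⊤) : T.catC A lam N := by
  have hw : ⨆ μ ∈ {μ | T.le μ lam}, wt (act T.h N) μ = ⊤ := by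
    refine h _ fun M hM φ m => ?_
    rw [catC_iff hr] at hM
    have h1 := hM.2.1.iSup_eq_top (S := {μ | T.le μ lam}) hM.2.2
    suffices h2 : ⨆ μ ∈ {μ | T.le μ lam}, wt (act T.h M) μ ≤
        (⨆ μ ∈ {μ | T.le μ lam}, wt (act T.h N) μ).comap (φ.restrictScalars k) by
      rw [h1] at h2
      exact h2 (Submodule.mem_top (x := m))
    refine iSup₂_le fun μ hμ m hm => Submodule.mem_iSup_of_mem μ (Submodule.mem_iSup_of_mem hμ ?_)
    exact map_mem_wt (φ := φ.restrictScalars k) (fun y m => map_lie_of_linear φ _ m) hm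
  refine (catC_iff hr).2 ⟨?_, ?_, fun μ hμ => wt_eq_bot_of_notMem hw hμ⟩
  · rw [← LieSubmodule.toSubmodule_eq_top]
    refine h _ fun M hM φ m => ?_
    rw [catC_iff hr] at hM
    obtain ⟨F, hF, hmF⟩ : m ∈ locallyFinitePart k T.r M := by rw [hM.1]; trivial
    have : FiniteDimensional k F.toSubmodule := hF
    refine ⟨{ F.toSubmodule.map (φ.restrictScalars k) with lie_mem := ?_ }, ?_, ⟨m, hmF, rfl⟩⟩
    · rintro x _ ⟨n, hn, rfl⟩
      exact ⟨⁅x, n⁆, F.lie_mem hn, map_lie_of_linear φ x n⟩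
    · change FiniteDimensional k (F.toSubmodule.map (φ.restrictScalars k))
      infer_instance
  · rw [IsWeighted, eq_top_iff, ← hw]
    exact iSup₂_le fun μ _ => le_iSup (wt (act T.h N)) μ

end TriangularDecomposition

namespace TriangularDecomposition

variable {k g : Type u} [Field k] [CharZero k] [AddCommGroup g] [Module k g] [LieSuperalgebra k g]
  {T : TriangularDecomposition k g} {A : Type u} [CommRing A] [Algebra k A]
  {lam : Module.Dual k T.h}

/-! ### Relations in highest-weight vectors -/

/-- The value of a dominant weight on the coroot of a root of the reductive part is a natural number. -/
theorem exists_triple [IsAlgClosed k] [FiniteDimensional k T.r] (hr : IsReductive k T.r)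
    (hlam : lam ∈ T.dominantWeights) {α : Module.Dual k T.h} (hα : α ∈ T.posR) :
    ∃ (y : T.h) (e f : T.r) (N : ℕ), IsSl2Triple (y : T.r) e f ∧ e ∈ wt (act T.h T.r) α ∧
      f ∈ wt (act T.h T.r) (-α) ∧ lam y = N := by
  obtain ⟨F, hF⟩ := T.exists_isRegular
  have hα' : α ∈ lieRoots T.h := by
    rw [hF.posR_eq] at hα
    exact hα.1
  obtain ⟨y, e, f, ht, he, hf⟩ := exists_isSl2Triple hr T.isSplitCartan hα'.1 hα'.2
  obtain ⟨V, ⟨hV, -, -⟩, v, hv0, hnv, hhv⟩ := hlam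
  let ρ : T.r →ₗ[k] Module.End k V :=
    (Algebra.lsmul k k V : U k g →ₐ[k] Module.End k V).toLinearMap ∘ₗ U.ι k ∘ₗ T.inclR
  have hρ : ∀ (x : T.r) (m : V), ρ x m = U.ι k (T.inclR x) • m := fun _ _ => rfl
  have hρ' : ∀ x y m, ρ ⁅x, y⁆ m = ρ x (ρ y m) - ρ y (ρ x m) := by
    intro x y m
    simp only [hρ]
    rw [U.ι_smul_ι_smul_of_even (T.inclR_mem x), add_sub_cancel_left]
    rfl
  let _ := repLieRingModule ρ hρ'
  have := repLieModule ρ hρ'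
  -- The highest-weight vector is primitive for the triple, and finite-dimensionality forces a
  -- natural eigenvalue.
  have P : ht.HasPrimitiveVectorWith v (lam y) :=
    { ne_zero := hv0
      lie_h := hhv y
      lie_e := hnv _ (Submodule.mem_iSup_of_mem α (Submodule.mem_iSup_of_mem hα.1
        (T.mem_wt_r.1 he))) }
  have : FiniteDimensional k V := hV
  obtain ⟨N, hN⟩ := P.exists_nat
  exact ⟨y, e, f, N, ht, he, hf, hN⟩

theorem toEnd_pow_eq {M : SuperMod k (U k (g ⊗[k] A))} (x : T.r) (n : ℕ) (m : M) :
    (LieModule.toEnd k T.r M x ^ n) m = (U.ι k (T.inclR x ⊗ₜ[k] (1 : A)) ^ n) • m := by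
  induction n with
  | zero => rw [pow_zero, pow_zero, one_smul]; rfl
  | succ n ih => rw [pow_succ', pow_succ', mul_smul, ← ih]; rfl

/-- A vector satisfying the defining relations of the generalized Kac module. -/
def IsKacVector {M : SuperMod k (U k (g ⊗[k] A))} (lam : Module.Dual k T.h) (v : M) : Prop :=
  ∀ s ∈ T.kacRelations lam, UIncl k g A s • v = 0

/-- Membership in the category supplies both ingredients: bounded weights kill `n⁺ v`, and local
finiteness over `r` lets `sl(2)`-theory give the vanishing of the `(N + 1)`-st power. -/
theorem isKacVector_of_mem_wt [IsAlgClosed k] [FiniteDimensional k T.r] (hr : IsReductive k T.r)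
    {M : SuperMod k (U k (g ⊗[k] A))} (hM : T.catC A lam M) {v : M}
    (hv : v ∈ T.weightSpace M lam) : IsKacVector lam v := by
  rintro s ((⟨x, hx, rfl⟩ | ⟨y, rfl⟩) | ⟨α, hα, e, f, y, N, he, hf, ht, hN, rfl⟩)
  · rw [UIncl_ι]
    exact tmul_smul_eq_zero hM.2 hv hx 1
  · rw [map_sub, UIncl_ι, AlgHom.commutes, sub_smul, algebraMap_smul, sub_eq_zero]
    exact hv y
  · by_cases hv0 : v = 0
    · rw [hv0, smul_zero]
    obtain ⟨F, hF, hvF⟩ : v ∈ locallyFinitePart k T.r M := by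
      rw [((catC_iff hr).1 hM).1]; trivial
    have P : ht.HasPrimitiveVectorWith (⟨v, hvF⟩ : F) (N : k) :=
      { ne_zero := fun h => hv0 (congrArg Subtype.val h)
        lie_h := Subtype.ext (by rw [← hN]; exact hv y)
        lie_e := Subtype.ext (tmul_smul_eq_zero hM.2 hv
          (Submodule.mem_iSup_of_mem α (Submodule.mem_iSup_of_mem hα.1.1 he)) 1) }
    have : FiniteDimensional k F := hF
    have h1 := congrArg Subtype.val (P.pow_toEnd_f_eq_zero_of_eq_nat rfl)
    rw [LieSubmodule.coe_toEnd_pow] at h1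
    rw [map_pow, UIncl_ι]
    rwa [toEnd_pow_eq] at h1

theorem IsKacVector.smul_eq_zero {M : SuperMod k (U k (g ⊗[k] A))} {v : M} (hv : IsKacVector lam v)
    {s : U k g} (hs : s ∈ Submodule.span (U k g) (T.kacRelations lam)) :
    UIncl k g A s • v = 0 := by
  induction hs using Submodule.span_induction with
  | mem s hs => exact hv s hs
  | zero => rw [map_zero, zero_smul]
  | add a b _ _ ha hb => rw [map_add, add_smul, ha, hb, add_zero]
  | smul c a _ ha => rw [smul_eq_mul, map_mul, mul_smul, ha, smul_zero]

/-! ### The universal property of the global Weyl module -/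

/-- The homomorphism `K(lam) → M` given by a vector which satisfies the relations. -/
noncomputable def kacLift {M : SuperMod k (U k (g ⊗[k] A))} {v : M} (hv : IsKacVector lam v) :
    T.kac lam →ₗ[k] M :=
  Submodule.liftQ ((Submodule.span (U k g) (T.kacRelations lam)).restrictScalars k)
    ((LinearMap.toSpanSingleton (U k (g ⊗[k] A)) M v).restrictScalars k ∘ₗ
      (UIncl k g A).toLinearMap) fun _ hs => hv.smul_eq_zero hs

/-- The homomorphism `P_A(K(lam)) → M` given by a vector which satisfies the relations. -/
noncomputable def inducedLift {M : SuperMod k (U k (g ⊗[k] A))} {v : M} (hv : IsKacVector lam v) :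
    induced A (T.kac lam) →ₗ[U k (g ⊗[k] A)] M :=
  Submodule.liftQ (Submodule.span (U k (g ⊗[k] A)) (balancing A (T.kac lam)))
    (TensorProduct.AlgebraTensorModule.lift
      { toFun := fun u => u • kacLift hv
        map_add' := fun u u' => add_smul u u' _
        map_smul' := fun u u' => by rw [smul_eq_mul, mul_smul]; rfl }) (by
    refine Submodule.span_le.2 ?_
    rintro _ ⟨u, s, x, rfl⟩
    obtain ⟨t, rfl⟩ := Submodule.Quotient.mk_surjective _ x
    change U k g at t
    rw [SetLike.mem_coe, LinearMap.mem_ker, map_sub]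
    change (u * UIncl k g A s) • UIncl k g A t • v - u • UIncl k g A (s * t) • v = 0
    rw [map_mul, mul_smul, mul_smul, sub_self])

/-- The generator of `P_A(K(lam))`. -/
noncomputable def inducedGen (T : TriangularDecomposition k g) (A : Type u) [CommRing A]
    [Algebra k A] (lam : Module.Dual k T.h) : induced A (T.kac lam) :=
  Submodule.Quotient.mk (p := Submodule.span (U k (g ⊗[k] A)) (balancing A (T.kac lam)))
    ((1 : U k (g ⊗[k] A)) ⊗ₜ[k]
      Submodule.Quotient.mk (p := Submodule.span (U k g) (T.kacRelations lam)) (1 : U k g))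

theorem inducedLift_gen {M : SuperMod k (U k (g ⊗[k] A))} {v : M} (hv : IsKacVector lam v) :
    inducedLift hv (inducedGen T A lam) = v := by
  change (1 : U k (g ⊗[k] A)) • UIncl k g A 1 • v = v
  rw [map_one, one_smul, one_smul]

theorem smul_inducedGen (u : U k (g ⊗[k] A)) (s : U k g) :
    (u * UIncl k g A s) • inducedGen T A lam =
      Submodule.Quotient.mk (p := Submodule.span (U k (g ⊗[k] A)) (balancing A (T.kac lam)))
        (u ⊗ₜ[k] Submodule.Quotient.mk (p := Submodule.span (U k g) (T.kacRelations lam)) s) := by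
  let x : T.kac lam :=
    Submodule.Quotient.mk (p := Submodule.span (U k g) (T.kacRelations lam)) (1 : U k g)
  let y : T.kac lam := Submodule.Quotient.mk (p := Submodule.span (U k g) (T.kacRelations lam)) s
  have h1 : (u * UIncl k g A s) • ((1 : U k (g ⊗[k] A)) ⊗ₜ[k] x) = (u * UIncl k g A s) ⊗ₜ[k] x := by
    rw [TensorProduct.smul_tmul', smul_eq_mul, mul_one]
  have h2 : s • x = y :=
    congrArg (Submodule.Quotient.mk (p := Submodule.span (U k g) (T.kacRelations lam)))
      (mul_one (M := U k g) s)
  refine (Submodule.Quotient.eq _).2 (Submodule.subset_span ⟨u, s, x, ?_⟩)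
  exact congrArg₂ (· - ·) h1 (congrArg (u ⊗ₜ[k] ·) h2.symm)

theorem inducedGen_generates (m : induced A (T.kac lam)) :
    ∃ u : U k (g ⊗[k] A), u • inducedGen T A lam = m := by
  obtain ⟨t, rfl⟩ := Submodule.Quotient.mk_surjective _ m
  change U k (g ⊗[k] A) ⊗[k] (T.kac lam) at t
  induction t with
  | zero => exact ⟨0, by rw [zero_smul]; rfl⟩
  | add s t hs ht =>
    obtain ⟨a, ha⟩ := hs
    obtain ⟨b, hb⟩ := ht
    exact ⟨a + b, by rw [add_smul, ha, hb]; rfl⟩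
  | tmul u v =>
    obtain ⟨s, rfl⟩ := Submodule.Quotient.mk_surjective _ v
    exact ⟨_, smul_inducedGen u s⟩

theorem isKacVector_inducedGen : IsKacVector lam (inducedGen T A lam) := by
  intro s hs
  have h := smul_inducedGen (T := T) (A := A) (lam := lam) 1 s
  rw [one_mul] at h
  rw [h]
  let x : T.kac lam := Submodule.Quotient.mk (p := Submodule.span (U k g) (T.kacRelations lam)) s
  have h0 : x = 0 := (Submodule.Quotient.mk_eq_zero _).2 (Submodule.subset_span hs)
  change Submodule.Quotient.mk (p := Submodule.span (U k (g ⊗[k] A)) (balancing A (T.kac lam)))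
    ((1 : U k (g ⊗[k] A)) ⊗ₜ[k] x) = 0
  rw [h0, TensorProduct.tmul_zero]
  rfl

theorem map_mem_wt_of_linear {M N : SuperMod k (U k (g ⊗[k] A))} (φ : M →ₗ[U k (g ⊗[k] A)] N)
    {μ : Module.Dual k T.h} {m : M} (hm : m ∈ wt (act T.h M) μ) : φ m ∈ wt (act T.h N) μ :=
  map_mem_wt (ρ := act T.h M) (ρ' := act T.h N) (φ := φ.restrictScalars k)
    (fun y m => map_lie_of_linear φ (y : T.r) m) hm

theorem IsKacVector.mem_wt {M : SuperMod k (U k (g ⊗[k] A))} {v : M} (hv : IsKacVector lam v) :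
    v ∈ wt (act T.h M) lam := by
  intro y
  have h := hv _ (Or.inl (Or.inr ⟨y, rfl⟩))
  rw [map_sub, UIncl_ι, AlgHom.commutes, sub_smul, algebraMap_smul, sub_eq_zero] at h
  exact h

theorem IsKacVector.map {M N : SuperMod k (U k (g ⊗[k] A))} {v : M} (hv : IsKacVector lam v)
    (φ : M →ₗ[U k (g ⊗[k] A)] N) : IsKacVector lam (φ v) := fun s hs => by
  rw [← map_smul, hv s hs, map_zero]

/-- The projection of `P_A(K(lam))` onto the global Weyl module. -/
noncomputable def weylProj (T : TriangularDecomposition k g) (A : Type u) [CommRing A]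
    [Algebra k A] (lam : Module.Dual k T.h) :
    induced A (T.kac lam) →ₗ[U k (g ⊗[k] A)] T.weyl A lam :=
  (T.upperPart lam (induced A (T.kac lam))).mkQ

theorem weylProj_surjective : Function.Surjective (weylProj T A lam) :=
  Submodule.mkQ_surjective _

theorem isKacVector_weylGen : IsKacVector lam (T.weylGen A lam) :=
  isKacVector_inducedGen.map (weylProj T A lam)

theorem weylGen_mem_wt : T.weylGen A lam ∈ wt (act T.h (T.weyl A lam)) lam :=
  isKacVector_weylGen.mem_wt

theorem isWeighted_weyl : IsWeighted (act T.h (T.weyl A lam)) :=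
  isWeighted_of_generated weylGen_mem_wt (T.weyl_generated A lam)

/-- A quotient could acquire new vectors of forbidden weight. It does not, since the induced module
is weighted: each such vector lifts to a vector of the same weight, which the truncation has killed.
-/
theorem wt_weyl_eq_bot {μ : Module.Dual k T.h} (hμ : ¬ T.le μ lam) :
    wt (act T.h (T.weyl A lam)) μ = ⊥ := by
  rw [Submodule.eq_bot_iff]
  intro x hx
  obtain ⟨x, rfl⟩ := weylProj_surjective x
  have hind : IsWeighted (act T.h (induced A (T.kac lam))) :=
    isWeighted_of_generated isKacVector_inducedGen.mem_wt inducedGen_generates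
  obtain ⟨v, hv, e⟩ := hind.exists_lift (ρ' := act T.h (T.weyl A lam))
    (φ := (weylProj T A lam).restrictScalars k)
    (fun y m => map_lie_of_linear (weylProj T A lam) (y : T.r) m) hx
  refine e.symm.trans ?_
  exact (Submodule.Quotient.mk_eq_zero _).2 (Submodule.subset_span ⟨μ, hμ, hv⟩)

theorem upperPart_weyl : T.upperPart lam (T.weyl A lam) = ⊥ :=
  upperPart_eq_bot_iff.2 fun _ hμ => wt_weyl_eq_bot hμ

/-- The global Weyl module belongs to `C_A^lam`. -/
theorem weyl_mem_catC [IsAlgClosed k] [FiniteDimensional k g] [FiniteDimensional k T.r]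
    (hr : IsReductive k T.r) (hlam : lam ∈ T.dominantWeights) : T.catC A lam (T.weyl A lam) := by
  refine (catC_iff hr).2 ⟨?_, isWeighted_weyl, fun μ => wt_weyl_eq_bot⟩
  obtain ⟨F, hF⟩ := T.exists_isRegular
  -- Local finiteness needs to be checked on the generator only.
  refine locallyFinitePart_eq_top_of_generated ?_ (T.weyl_generated A lam)
  refine mem_locallyFinitePart_of_highestWeight (f := F) hr T.isSplitCartan
    (fun α hα => hF.ne_zero α (T.mem_roots_of_lieRoots hα)) weylGen_mem_wt ?_ ?_
  · intro α hα x hx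
    have hα' : α ∈ T.pos := hF.mem_pos.2 ⟨T.mem_roots_of_lieRoots hα.1, hα.2⟩
    exact tmul_smul_eq_zero upperPart_weyl weylGen_mem_wt
      (Submodule.mem_iSup_of_mem α (Submodule.mem_iSup_of_mem hα' (T.mem_wt_r.1 hx))) 1
  · intro α hα
    rw [← hF.simpleR_eq] at hα
    obtain ⟨y, e, f, N, ht, he, hf, hN⟩ := exists_triple hr hlam hα.1
    refine ⟨y, e, f, N + 1, ht, he, hf, ?_⟩
    have h := isKacVector_weylGen (T := T) (A := A) (lam := lam) _
      (Or.inr ⟨α, hα, e, f, y, N, T.mem_wt_r.1 he, T.mem_wt_r.1 hf, ht, hN, rfl⟩)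
    rwa [map_pow, UIncl_ι, ← toEnd_pow_eq] at h

/-- The homomorphism `W_A(lam) → M` which maps the generator to a given vector. -/
noncomputable def weylLift {M : SuperMod k (U k (g ⊗[k] A))} (hM : T.upperPart lam M = ⊥) {v : M}
    (hv : IsKacVector lam v) : T.weyl A lam →ₗ[U k (g ⊗[k] A)] M :=
  Submodule.liftQ (T.upperPart lam (induced A (T.kac lam))) (inducedLift hv) (by
    refine Submodule.span_le.2 ?_
    rintro m ⟨μ, hμ, hm⟩
    have h : inducedLift hv m ∈ wt (act T.h M) μ :=
      map_mem_wt_of_linear (inducedLift hv) hm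
    rw [upperPart_eq_bot_iff.1 hM μ hμ] at h
    exact h)

theorem weylLift_gen {M : SuperMod k (U k (g ⊗[k] A))} (hM : T.upperPart lam M = ⊥) {v : M}
    (hv : IsKacVector lam v) : weylLift hM hv (T.weylGen A lam) = v := inducedLift_gen hv

theorem exists_weylLift [IsAlgClosed k] [FiniteDimensional k T.r] (hr : IsReductive k T.r)
    {M : SuperMod k (U k (g ⊗[k] A))} (hM : T.catC A lam M) {v : M} (hv : v ∈ T.weightSpace M lam) :
    ∃ φ : T.weyl A lam →ₗ[U k (g ⊗[k] A)] M, φ (T.weylGen A lam) = v :=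
  ⟨weylLift hM.2 (isKacVector_of_mem_wt hr hM hv), weylLift_gen _ _⟩

/-- Every `v ∈ M_λ` is the image of `w` under a homomorphism, and relations of `w` persist. -/
theorem annActsTrivially [IsAlgClosed k] [FiniteDimensional k T.r] (hr : IsReductive k T.r) :
    T.AnnActsTrivially A lam := by
  intro M hM s hs v hv
  obtain ⟨φ, rfl⟩ := exists_weylLift hr hM hv
  rw [← map_smul, show (s : U k (g ⊗[k] A)) • T.weylGen A lam = 0 from hs, map_zero]

/-- The vector `s w` has weight `λ` in `W`, an object of the category, so an endomorphism `φ` of `W`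
sends `w` to `s w`. Then `u s w = φ(u w)`. -/
theorem rightActionWellDefined [IsAlgClosed k] [FiniteDimensional k g] [FiniteDimensional k T.r]
    (hr : IsReductive k T.r) (hlam : lam ∈ T.dominantWeights) : T.RightActionWellDefined A lam := by
  intro u s hu
  obtain ⟨φ, hφ⟩ := exists_weylLift hr (weyl_mem_catC (A := A) hr hlam)
    (cartanAlg_smul_mem (T.weyl A lam) s weylGen_mem_wt)
  rw [mul_smul, ← hφ, ← map_smul, hu, map_zero]

/-! ### The decomposition of the global Weyl module -/

/-- The subspace `U(h ⊗ A) w_lam`. -/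
noncomputable def weylTop (T : TriangularDecomposition k g) (A : Type u) [CommRing A]
    [Algebra k A] (lam : Module.Dual k T.h) : Submodule k (T.weyl A lam) :=
  (T.cartanAlg A).toSubmodule.map
    ((LinearMap.toSpanSingleton (U k (g ⊗[k] A)) _ (T.weylGen A lam)).restrictScalars k)

theorem weylTop_le_wt : weylTop T A lam ≤ wt (act T.h (T.weyl A lam)) lam := by
  rintro _ ⟨s, hs, rfl⟩
  exact cartanAlg_smul_mem (T.weyl A lam) ⟨s, hs⟩ weylGen_mem_wt

/-- The sum of the weight spaces on whose weights `f` is less than `f(lam)`. -/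
noncomputable def lowerPart (f : Module.Dual k T.h →+ ℝ) (lam : Module.Dual k T.h)
    (M : SuperMod k (U k (g ⊗[k] A))) : Submodule k M :=
  ⨆ μ ∈ {μ | f μ < f lam}, wt (act T.h M) μ

theorem par_mem_rootSpace {α : Module.Dual k T.h} {x : g} (hx : x ∈ rootSpace T.h α) :
    par k x ∈ rootSpace T.h α := by
  intro y
  have h := par_br_of_even (y := x) (T.inclH_mem y)
  rw [show br k g (T.inclH y) x = α y • x from hx y, map_smul] at h
  exact h.symm

/-- Root spaces are spanned by homogeneous vectors. -/
theorem exists_homogeneous {α : Module.Dual k T.h} {x : g} (hx : x ∈ rootSpace T.h α) :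
    ∃ a ∈ rootSpace T.h α ⊓ gr k g 0, ∃ b ∈ rootSpace T.h α ⊓ gr k g 1, x = a + b := by
  obtain ⟨a, ha, b, hb, rfl⟩ := (LieSuperalgebra.grading (k := k) (g := g)).exists_add x
  have h := par_mem_rootSpace hx
  rw [map_add, show par k a = _ from Z2Grading.parity_of_mem _ ha,
    show par k b = _ from Z2Grading.parity_of_mem _ hb, sgn_zero_one, sgn_one_one, one_smul,
    neg_one_smul] at h
  have h1 : a ∈ rootSpace T.h α := by
    have := Submodule.smul_mem _ (2 : k)⁻¹ (add_mem hx h)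
    rwa [show a + b + (a + -b) = (2 : k) • a by rw [two_smul]; abel, smul_smul,
      inv_mul_cancel₀ two_ne_zero, one_smul] at this
  have h2 : b ∈ rootSpace T.h α := by
    have := sub_mem hx h1
    rwa [add_sub_cancel_left] at this
  exact ⟨a, ⟨h1, ha⟩, b, ⟨h2, hb⟩, rfl⟩

/-- The closure of `U(h ⊗ A) w` under the operators of negative root vectors is stable under `g ⊗ A`
by the commutation relations, hence is all of `W`. Each lowering operator strictly decreases `f` on
weights. -/
theorem weyl_eq_top_sup_lower {f : Module.Dual k T.h →+ ℝ} (hf : IsRegular f) :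
    weylTop T A lam ⊔ lowerPart f lam (T.weyl A lam) = ⊤ := by
  let W := T.weyl A lam
  let op : g ⊗[k] A →ₗ[k] Module.End k W :=
    (Algebra.lsmul k k W : U k (g ⊗[k] A) →ₐ[k] Module.End k W).toLinearMap ∘ₗ U.ι k
  have hop : ∀ t (m : W), op t m = U.ι k t • m := fun _ _ => rfl
  -- Homogeneous root vectors are required, because the commutation relations involve a sign
  -- depending on parity.
  let 𝒩 : Set (Module.End k W) := {n | ∃ α, (α ∈ roots T.h ∧ f α < 0) ∧
    ∃ i, ∃ x ∈ rootSpace T.h α ⊓ gr k g i, ∃ a : A, n = op (x ⊗ₜ a)}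
  let ℬ : Set (Module.End k W) := {b | ∃ α, (α = 0 ∨ α ∈ T.pos) ∧
    ∃ i, ∃ x ∈ rootSpace T.h α ⊓ gr k g i, ∃ a : A, b = op (x ⊗ₜ a)}
  let P : Submodule k W := weylTop T A lam
  have hall : ∀ t, op t ∈ Submodule.span k ℬ ⊔ Submodule.span k 𝒩 := by
    intro t
    refine T.mapSuper_induction (p := fun t => op t ∈ Submodule.span k ℬ ⊔ Submodule.span k 𝒩)
      ?_ ?_ ?_ t
    · rw [map_zero]; exact zero_mem _
    · intro x y hx hy
      rw [map_add]; exact add_mem hx hy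
    · intro α x hx a
      have key : ∀ i, ∀ x ∈ rootSpace T.h α ⊓ gr k g i,
          op (x ⊗ₜ a) ∈ Submodule.span k ℬ ⊔ Submodule.span k 𝒩 := by
        intro i x hx
        by_cases h0 : α = 0
        · exact Submodule.mem_sup_left (Submodule.subset_span ⟨α, Or.inl h0, i, x, hx, a, rfl⟩)
        by_cases hx0 : x = 0
        · rw [hx0, TensorProduct.zero_tmul, map_zero]; exact zero_mem _
        have hα : α ∈ roots T.h := ⟨h0, fun h => hx0 (by
          have : x ∈ rootSpace T.h α := hx.1
          rwa [h, Submodule.mem_bot] at this)⟩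
        rcases lt_or_gt_of_ne (hf.ne_zero α hα) with h | h
        · exact Submodule.mem_sup_right (Submodule.subset_span ⟨α, ⟨hα, h⟩, i, x, hx, a, rfl⟩)
        · exact Submodule.mem_sup_left (Submodule.subset_span
            ⟨α, Or.inr (hf.mem_pos.2 ⟨hα, h⟩), i, x, hx, a, rfl⟩)
      obtain ⟨x0, h0, x1, h1, rfl⟩ := exists_homogeneous hx
      rw [TensorProduct.add_tmul, map_add]
      exact add_mem (key 0 x0 h0) (key 1 x1 h1)
  have hPℬ : ∀ b ∈ ℬ, ∀ p ∈ P, b p ∈ P := by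
    rintro _ ⟨α, hα, i, x, hx, a, rfl⟩ p hp
    rw [hop]
    rcases hα with rfl | hα
    · have hx1 := hx.1
      rw [T.rootSpace_zero] at hx1
      obtain ⟨y, rfl⟩ := hx1
      obtain ⟨s, hs, rfl⟩ := hp
      refine ⟨U.ι k (T.inclH y ⊗ₜ[k] a) * s,
        (T.cartanAlg A).mul_mem (Algebra.subset_adjoin ⟨y, a, rfl⟩) hs, mul_smul _ s (T.weylGen A lam)⟩
    · rw [tmul_smul_eq_zero upperPart_weyl (weylTop_le_wt hp)
        (Submodule.mem_iSup_of_mem α (Submodule.mem_iSup_of_mem hα hx.1)) a]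
      exact zero_mem _
  have hstab : ∀ t : g ⊗[k] A, ∀ v ∈ stableClosure 𝒩 P, U.ι k t • v ∈ stableClosure 𝒩 P := by
    intro t v hv
    obtain ⟨b, hb, n, hn, e⟩ := Submodule.mem_sup.1 (hall t)
    rw [← hop, ← e, LinearMap.add_apply]
    clear e
    refine add_mem ?_ ?_
    · induction hb using Submodule.span_induction with
      | mem b hb =>
        refine stableClosure_stable_of_comm hPℬ ?_ hb hv
        rintro _ ⟨α, hα, i, x, hx, a, rfl⟩ _ ⟨β, hβ, j, y, hy, c, rfl⟩
        obtain ⟨b', hb', n', hn', e'⟩ := Submodule.mem_sup.1 (hall (br k g x y ⊗ₜ (a * c)))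
        refine ⟨sgn k i j, b', hb', n', hn', ?_⟩
        rw [add_assoc, e']
        refine LinearMap.ext fun m => ?_
        have h := U.ι_mul_ι (k := k) (tmul_mem_mapGr (A := A) hx.2 a)
          (tmul_mem_mapGr (A := A) hy.2 c)
        rw [show br k (g ⊗[k] A) (x ⊗ₜ a) (y ⊗ₜ c) = _ from mapBr_tmul k g A x y a c] at h
        have h' := congrArg (· • m) h
        simp only [add_smul, mul_smul, smul_assoc] at h'
        exact h'
      | zero => exact zero_mem _
      | add a b _ _ ha hb => exact add_mem ha hb
      | smul c a _ ha => exact Submodule.smul_mem _ c ha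
    · induction hn using Submodule.span_induction with
      | mem n hn => exact stableClosure_stable hn hv
      | zero => exact zero_mem _
      | add a b _ _ ha hb => exact add_mem ha hb
      | smul c a _ ha => exact Submodule.smul_mem _ c ha
  have htop : stableClosure 𝒩 P = ⊤ := by
    rw [eq_top_iff]
    intro m _
    obtain ⟨u, rfl⟩ := T.weyl_generated A lam m
    refine U.smul_mem hstab u _ (le_stableClosure ⟨1, (T.cartanAlg A).one_mem, ?_⟩)
    exact one_smul (U k (g ⊗[k] A)) (T.weylGen A lam)
  rw [eq_top_iff, ← htop]
  refine stableClosure_le le_sup_left ?_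
  rintro _ ⟨α, ⟨-, hα⟩, i, x, hx, a, rfl⟩ q hq
  rw [hop]
  -- All weights involved have `f`-value at most `f(λ)`, so one lowering step lands in the lower
  -- part.
  have h1 : P ⊔ lowerPart f lam W ≤ ⨆ μ ∈ {μ | f μ ≤ f lam}, wt (act T.h W) μ := by
    refine sup_le ?_ (iSup₂_le fun μ hμ => ?_)
    · exact le_iSup₂_of_le lam (_root_.le_refl (f lam)) weylTop_le_wt
    · exact le_iSup₂_of_le μ (show f μ ≤ f lam from le_of_lt hμ) le_rfl
  refine Submodule.mem_sup_right ?_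
  suffices h2 : ⨆ μ ∈ {μ | f μ ≤ f lam}, wt (act T.h W) μ ≤
      (lowerPart f lam W).comap (op (x ⊗ₜ a)) from h2 (h1 hq)
  refine iSup₂_le fun μ hμ m hm => Submodule.mem_iSup_of_mem (α + μ)
    (Submodule.mem_iSup_of_mem ?_ (tmul_smul_mem_wt hx.1 a hm))
  have : f μ ≤ f lam := hμ
  change f (α + μ) < f lam
  rw [map_add]
  linarith

/-! ### Tensor products with the global Weyl module -/

/-- The homomorphism `w ↦ w ⊗ m`. -/
noncomputable def tensorRight (hR : T.RightActionWellDefined A lam) (M : SuperMod k (T.Alam A lam))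
    (m : M) : T.weyl A lam →ₗ[U k (g ⊗[k] A)] weylTensor hR M where
  toFun w := (show WeylBimodule hR from w) ⊗ₜ[T.Alam A lam] m
  map_add' _ _ := TensorProduct.add_tmul _ _ _
  map_smul' _ _ := rfl

/-- The pure tensors exhibit `W ⊗ M` as the sum of the images of `W` under `w ↦ w ⊗ m`. -/
theorem weylTensor_mem_catC [IsAlgClosed k] [FiniteDimensional k g] [FiniteDimensional k T.r]
    (hr : IsReductive k T.r) (hlam : lam ∈ T.dominantWeights)
    (hR : T.RightActionWellDefined A lam) (M : SuperMod k (T.Alam A lam)) :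
    T.catC A lam (weylTensor hR M) := by
  refine catC_of_images hr fun P hP => ?_
  rw [eq_top_iff]
  intro t ht
  clear ht
  change WeylBimodule hR ⊗[T.Alam A lam] M at t
  induction t with
  | zero => exact zero_mem _
  | add s t hs ht => exact add_mem hs ht
  | tmul w m => exact hP _ (weyl_mem_catC hr hlam) (tensorRight hR M m) w

end TriangularDecomposition

theorem Z2Grading.parity_ofInvolution {k V : Type u} [Field k] [CharZero k] [AddCommGroup V]
    [Module k V] (σ : V →ₗ[k] V) (hσ : ∀ v, σ (σ v) = v) (v : V) :
    (Z2Grading.ofInvolution σ hσ).parity v = σ v := by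
  obtain ⟨a, ha, b, hb, rfl⟩ := (Z2Grading.ofInvolution σ hσ).exists_add v
  rw [map_add, map_add, Z2Grading.parity_of_mem _ ha, Z2Grading.parity_of_mem _ hb,
    (Z2Grading.mem_ofInvolution σ hσ).1 ha, (Z2Grading.mem_ofInvolution σ hσ).1 hb]

/-! ### Morphisms of graded modules -/

section SuperMod

variable {k B : Type u} [Field k] [Ring B] [Algebra k B] [Superalgebra k B]

theorem SuperMod.Hom.parity_apply {M N : SuperMod k B} (f : M ⟶ N) (m : M) :
    N.grading.parity (SuperMod.Hom.toLinearMap f m) =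
      SuperMod.Hom.toLinearMap f (M.grading.parity m) := by
  obtain ⟨a, ha, b, hb, rfl⟩ := M.grading.exists_add m
  simp only [map_add]
  rw [N.grading.parity_of_mem (SuperMod.Hom.map_mem f ha), M.grading.parity_of_mem ha,
    N.grading.parity_of_mem (SuperMod.Hom.map_mem f hb), M.grading.parity_of_mem hb,
    LinearMap.map_smul_of_tower, LinearMap.map_smul_of_tower]

variable [CharZero k]

/-- A linear map which commutes with the parity operators is a homomorphism of graded modules. -/
def SuperMod.homOfParity {M N : SuperMod k B} (φ : M →ₗ[B] N)
    (hφ : ∀ m, N.grading.parity (φ m) = φ (M.grading.parity m)) : M ⟶ N where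
  toLinearMap := φ
  map_mem hm := Z2Grading.mem_of_parity _ (by
    rw [hφ, M.grading.parity_of_mem hm, LinearMap.map_smul_of_tower])

/-- A bijective homomorphism is an isomorphism. -/
noncomputable def SuperMod.isoOfBijective {M N : SuperMod k B} (f : M ⟶ N)
    (hf : Function.Bijective (SuperMod.Hom.toLinearMap f)) : M ≅ N where
  hom := f
  inv := SuperMod.homOfParity (LinearEquiv.ofBijective _ hf).symm.toLinearMap fun n => by
    obtain ⟨m, rfl⟩ := hf.2 n
    apply hf.1
    rw [SuperMod.Hom.parity_apply, ← SuperMod.Hom.parity_apply]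
    have h : ∀ m, (LinearEquiv.ofBijective (SuperMod.Hom.toLinearMap f) hf).symm
        (SuperMod.Hom.toLinearMap f m) = m := (LinearEquiv.ofBijective _ hf).symm_apply_apply
    rw [LinearEquiv.coe_coe, h, SuperMod.Hom.parity_apply, h]
  hom_inv_id := SuperMod.Hom.ext (LinearMap.ext fun m =>
    (LinearEquiv.ofBijective (SuperMod.Hom.toLinearMap f) hf).symm_apply_apply m)
  inv_hom_id := SuperMod.Hom.ext (LinearMap.ext fun n =>
    (LinearEquiv.ofBijective (SuperMod.Hom.toLinearMap f) hf).apply_symm_apply n)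

/-- The cokernel of a homomorphism. -/
def SuperMod.coker {M N : SuperMod k B} (f : M ⟶ N) : SuperMod k B :=
  N.quot (LinearMap.range (SuperMod.Hom.toLinearMap f)) (by
    rintro _ ⟨m, rfl⟩
    exact ⟨_, (SuperMod.Hom.parity_apply f m).symm⟩)

/-- The projection onto the cokernel. -/
def SuperMod.cokerProj {M N : SuperMod k B} (f : M ⟶ N) : N ⟶ SuperMod.coker f where
  toLinearMap := (LinearMap.range (SuperMod.Hom.toLinearMap f)).mkQ
  map_mem hm := SuperMod.mk_mem_quot _ _ _ hm

/-- The zero homomorphism. -/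
def SuperMod.zeroHom (M N : SuperMod k B) : M ⟶ N := ⟨0, fun _ => zero_mem _⟩

/-- Cancellation is assumed for this one pair of maps only, so the statement serves both for all
graded modules and for the full subcategory, once the cokernel is known to lie there. -/
theorem SuperMod.surjective_of_comp_eq {M N : SuperMod k B} (f : M ⟶ N)
    (h : f ≫ SuperMod.cokerProj f = f ≫ SuperMod.zeroHom N (SuperMod.coker f) →
      SuperMod.cokerProj f = SuperMod.zeroHom N (SuperMod.coker f)) :
    Function.Surjective (SuperMod.Hom.toLinearMap f) := by
  have h1 := h (SuperMod.Hom.ext (LinearMap.ext fun m =>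
    (Submodule.Quotient.mk_eq_zero _).2 ⟨m, rfl⟩))
  intro n
  exact (Submodule.Quotient.mk_eq_zero _).1
    (LinearMap.congr_fun (congrArg SuperMod.Hom.toLinearMap h1) n)

theorem SuperMod.epi_of_surjective {M N : SuperMod k B} (f : M ⟶ N)
    (h : Function.Surjective (SuperMod.Hom.toLinearMap f)) : Epi f where
  left_cancellation a b hab := SuperMod.Hom.ext (LinearMap.ext fun n => by
    obtain ⟨m, rfl⟩ := h n
    exact LinearMap.congr_fun (congrArg SuperMod.Hom.toLinearMap hab) m)

theorem SuperMod.surjective_of_epi {M N : SuperMod k B} (f : M ⟶ N) [Epi f] :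
    Function.Surjective (SuperMod.Hom.toLinearMap f) :=
  SuperMod.surjective_of_comp_eq f fun h => (cancel_epi f).1 h

end SuperMod

namespace TriangularDecomposition

variable {k g : Type u} [Field k] [CharZero k] [AddCommGroup g] [Module k g] [LieSuperalgebra k g]
  {T : TriangularDecomposition k g} {A : Type u} [CommRing A] [Algebra k A]
  {lam : Module.Dual k T.h}

open scoped IsMulCommutative

/-! ### The right action on the global Weyl module -/

section RightAction

variable (hR : T.RightActionWellDefined A lam)

/-- The generator of the global Weyl bimodule. -/
noncomputable def bimoduleGen : WeylBimodule hR := T.weylGen A lam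

theorem AlamMk_smul (s : T.cartanAlg A) (u : U k (g ⊗[k] A)) :
    T.AlamMk A lam s • (u • bimoduleGen hR) = (u * s) • bimoduleGen hR :=
  rightMul_apply hR s u

theorem bimodule_generated (x : WeylBimodule hR) :
    ∃ u : U k (g ⊗[k] A), u • bimoduleGen hR = x := T.weyl_generated A lam x

theorem algebraMap_Alam_smul (c : k) (x : WeylBimodule hR) :
    algebraMap k (T.Alam A lam) c • x = c • x := by
  obtain ⟨u, rfl⟩ := bimodule_generated hR x
  rw [← (T.AlamMk A lam).commutes, AlamMk_smul]
  change (u * algebraMap k (U k (g ⊗[k] A)) c) • bimoduleGen hR = _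
  rw [← Algebra.commutes, mul_smul, algebraMap_smul]

theorem tmul_smul_base {M : SuperMod k (T.Alam A lam)} (c : k) (x : WeylBimodule hR) (m : M) :
    x ⊗ₜ[T.Alam A lam] (c • m) = c • (x ⊗ₜ[T.Alam A lam] m) := by
  rw [← algebraMap_smul (T.Alam A lam) c m, ← TensorProduct.smul_tmul, algebraMap_Alam_smul,
    TensorProduct.smul_tmul']

/-- The multiples of the generator by elements of `A_lam`. -/
noncomputable def AlamGen : T.Alam A lam →ₗ[T.Alam A lam] WeylBimodule hR :=
  LinearMap.toSpanSingleton _ _ (bimoduleGen hR)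

theorem AlamGen_mk (s : T.cartanAlg A) :
    AlamGen hR (T.AlamMk A lam s) = (s : U k (g ⊗[k] A)) • bimoduleGen hR := by
  have h := AlamMk_smul hR s 1
  rwa [one_smul, one_mul] at h

/-- By construction `A_λ` is the quotient by the annihilator of the generator. -/
theorem AlamGen_injective : Function.Injective (AlamGen hR) := by
  rw [injective_iff_map_eq_zero]
  intro a ha
  obtain ⟨s, rfl⟩ := T.AlamMk_surjective A lam a
  rw [AlamGen_mk] at ha
  exact Ideal.Quotient.eq_zero_iff_mem.2 ha

/-- The lower weight spaces form a submodule for the right action. -/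
noncomputable def lowerSubmodule (f : Module.Dual k T.h →+ ℝ) :
    Submodule (T.Alam A lam) (WeylBimodule hR) where
  carrier := {x | x ∈ lowerPart f lam (T.weyl A lam)}
  add_mem' ha hb := (lowerPart f lam (T.weyl A lam)).add_mem ha hb
  zero_mem' := (lowerPart f lam (T.weyl A lam)).zero_mem
  smul_mem' a x hx := by
    suffices h : lowerPart f lam (T.weyl A lam) ≤ (lowerPart f lam (T.weyl A lam)).comap
      ((rightActAlam hR a).restrictScalars k) from h hx
    exact iSup₂_le fun μ hμ m hm => Submodule.mem_iSup_of_mem μ (Submodule.mem_iSup_of_mem hμ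
      (map_mem_wt_of_linear (rightActAlam hR a) hm))

/-- The multiples of the generator have weight `λ`, while the lower part involves only weights of
smaller `f`-value, so the sum is direct. -/
theorem isCompl_AlamGen {f : Module.Dual k T.h →+ ℝ} (hf : IsRegular f) :
    IsCompl (LinearMap.range (AlamGen hR)) (lowerSubmodule hR f) := by
  have hrange : ∀ x : WeylBimodule hR, x ∈ weylTop T A lam ↔ x ∈ LinearMap.range (AlamGen hR) := by
    intro x
    constructor
    · rintro ⟨s, hs, rfl⟩
      exact ⟨_, AlamGen_mk hR ⟨s, hs⟩⟩
    · rintro ⟨a, rfl⟩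
      obtain ⟨s, rfl⟩ := T.AlamMk_surjective A lam a
      exact ⟨s, s.2, (AlamGen_mk hR s).symm⟩
  constructor
  · rw [Submodule.disjoint_def]
    intro x hx hx'
    have h1 := weylTop_le_wt ((hrange x).2 hx)
    exact mem_of_mem_sup_wt (A := ⊥) (S := {μ | f μ < f lam})
      (B := lowerPart f lam (T.weyl A lam)) bot_le (lt_irrefl (f lam)) le_rfl h1
      (Submodule.mem_sup_right hx')
  · rw [codisjoint_iff, eq_top_iff]
    intro x _
    have hx : (show T.weyl A lam from x) ∈ weylTop T A lam ⊔ lowerPart f lam (T.weyl A lam) := by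
      rw [weyl_eq_top_sup_lower hf]; trivial
    obtain ⟨a, ha, b, hb, rfl⟩ := Submodule.mem_sup.1 hx
    exact Submodule.mem_sup.2 ⟨a, (hrange a).1 ha, b, hb, rfl⟩

/-- The generator spans a free direct summand of `W` over `A_λ`; this keeps `m ↦ w ⊗ m` injective
for arbitrary `M`, without flatness. -/
theorem exists_retraction : ∃ q : WeylBimodule hR →ₗ[T.Alam A lam] T.Alam A lam,
    q (bimoduleGen hR) = 1 := by
  obtain ⟨f, hf⟩ := T.exists_isRegular
  refine ⟨LinearMap.ofIsCompl (isCompl_AlamGen hR hf)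
    (LinearEquiv.ofInjective _ (AlamGen_injective hR)).symm.toLinearMap 0, ?_⟩
  have h1 : AlamGen hR 1 = bimoduleGen hR := one_smul _ _
  rw [← h1]
  refine (LinearMap.ofIsCompl_apply_left _ ⟨AlamGen hR 1, LinearMap.mem_range_self _ 1⟩).trans ?_
  exact (LinearEquiv.ofInjective _ (AlamGen_injective hR)).symm_apply_apply 1

end RightAction

/-! ### The unit -/

section Unit

variable (hA : T.AnnActsTrivially A lam) (hR : T.RightActionWellDefined A lam)
  (hW : ∀ M : SuperMod k (T.Alam A lam), T.catC A lam (weylTensor hR M))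

theorem gen_tmul_mem (M : SuperMod k (T.Alam A lam)) (m : M) :
    (show weylTensor hR M from bimoduleGen hR ⊗ₜ[T.Alam A lam] m) ∈
      T.weightSpace (weylTensor hR M) lam :=
  map_mem_wt_of_linear (tensorRight hR M m) weylGen_mem_wt

theorem weylParity_gen : weylParity hR (bimoduleGen hR) = bimoduleGen hR := parity_weylGen

/-- The homomorphism `M → (W_A(lam) ⊗ M)_lam`, `m ↦ w_lam ⊗ m`. -/
noncomputable def unitHom (M : SuperMod k (T.Alam A lam)) :
    M ⟶ (weightFunctor hA).obj ((weylFunctor hR hW).obj M) where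
  toLinearMap :=
    { toFun := fun m => (⟨_, gen_tmul_mem hR M m⟩ : T.weightSpace (weylTensor hR M) lam)
      map_add' := fun m n => Subtype.ext (TensorProduct.tmul_add _ _ _)
      map_smul' := fun a m => by
        obtain ⟨s, rfl⟩ := T.AlamMk_surjective A lam a
        refine Subtype.ext ?_
        change bimoduleGen hR ⊗ₜ[T.Alam A lam] (T.AlamMk A lam s • m) =
          ((s : U k (g ⊗[k] A)) • bimoduleGen hR) ⊗ₜ[T.Alam A lam] m
        rw [← TensorProduct.smul_tmul, ← AlamGen_mk]
        rfl }
  map_mem := by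
    intro i m hm
    refine (Z2Grading.mem_ofInvolution _ (weylTensorParity_invol hR M)).2 ?_
    change weylTensorParity hR M (bimoduleGen hR ⊗ₜ m) = sgn k i 1 • (bimoduleGen hR ⊗ₜ m)
    rw [weylTensorParity_tmul, weylParity_gen,
      show AlamParity M m = sgn k i 1 • m from M.grading.parity_of_mem hm, tmul_smul_base]

/-- Injectivity comes from tensoring the retraction with `M`. For surjectivity, `W ⊗ M` is `w ⊗ M`
plus vectors of lower weights, so a vector of weight `λ` lies in `w ⊗ M`. -/
theorem unitHom_bijective (M : SuperMod k (T.Alam A lam)) :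
    Function.Bijective (SuperMod.Hom.toLinearMap (unitHom hA hR hW M)) := by
  constructor
  · obtain ⟨q, hq⟩ := exists_retraction hR
    intro m n h
    have h1 : bimoduleGen hR ⊗ₜ[T.Alam A lam] m = bimoduleGen hR ⊗ₜ[T.Alam A lam] n :=
      congrArg Subtype.val h
    have h2 := congrArg (fun t => TensorProduct.lid _ M (LinearMap.rTensor M q t)) h1
    simpa only [LinearMap.rTensor_tmul, hq, TensorProduct.lid_tmul, one_smul] using h2
  · obtain ⟨f, hf⟩ := T.exists_isRegular
    rintro ⟨t, ht⟩
    let R : Submodule k (weylTensor hR M) :=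
      { carrier := {t | ∃ m : M, bimoduleGen hR ⊗ₜ[T.Alam A lam] m = t}
        add_mem' := by
          rintro _ _ ⟨m, rfl⟩ ⟨n, rfl⟩
          exact ⟨m + n, TensorProduct.tmul_add _ _ _⟩
        zero_mem' := ⟨0, TensorProduct.tmul_zero _ _⟩
        smul_mem' := by
          rintro c _ ⟨m, rfl⟩
          exact ⟨c • m, tmul_smul_base hR c _ m⟩ }
    have hR' : R ≤ wt (act T.h (weylTensor hR M)) lam := by
      rintro _ ⟨m, rfl⟩
      exact gen_tmul_mem hR M m
    have htop : R ⊔ lowerPart f lam (weylTensor hR M) = ⊤ := by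
      rw [eq_top_iff]
      intro t h0
      clear h0
      change WeylBimodule hR ⊗[T.Alam A lam] M at t
      induction t with
      | zero => exact zero_mem _
      | add s t hs ht => exact add_mem hs ht
      | tmul x m =>
        have hx : (show T.weyl A lam from x) ∈ weylTop T A lam ⊔ lowerPart f lam (T.weyl A lam) := by
          rw [weyl_eq_top_sup_lower hf]; trivial
        obtain ⟨_, ⟨s, hs, rfl⟩, b, hb, rfl⟩ := Submodule.mem_sup.1 hx
        change tensorRight hR M m (s • T.weylGen A lam + b) ∈ _
        rw [map_add]
        -- For `s ∈ U(h ⊗ A)`, the tensor `s w ⊗ m` equals `w ⊗ s m`; the component `b` contributes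
        -- only lower weights.
        refine Submodule.add_mem_sup ⟨T.AlamMk A lam ⟨s, hs⟩ • m, ?_⟩ ?_
        · rw [← TensorProduct.smul_tmul]
          exact congrArg (· ⊗ₜ[T.Alam A lam] m) (AlamGen_mk hR ⟨s, hs⟩)
        · suffices h : lowerPart f lam (T.weyl A lam) ≤ (lowerPart f lam (weylTensor hR M)).comap
            ((tensorRight hR M m).restrictScalars k) from h hb
          exact iSup₂_le fun μ hμ m' hm => Submodule.mem_iSup_of_mem μ
            (Submodule.mem_iSup_of_mem hμ (map_mem_wt_of_linear (tensorRight hR M m) hm))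
    obtain ⟨m, hm⟩ : t ∈ R := mem_of_mem_sup_wt (S := {μ | f μ < f lam}) hR' (lt_irrefl (f lam))
      (B := lowerPart f lam (weylTensor hR M)) le_rfl ht (htop.ge (Submodule.mem_top (x := t)))
    exact ⟨m, Subtype.ext hm⟩

/-- The composite of the Weyl functor and the weight space functor is isomorphic to the identity. -/
noncomputable def unitIso :
    weylFunctor hR hW ⋙ weightFunctor hA ≅ 𝟭 (SuperMod k (T.Alam A lam)) :=
  (NatIso.ofComponents (F := 𝟭 (SuperMod k (T.Alam A lam)))
    (fun M => SuperMod.isoOfBijective _ (unitHom_bijective hA hR hW M)) fun _ => rfl).symm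

/-! ### The adjunction -/

/-- The map `Hom(W_A(lam) ⊗ M, N) → Hom(M, N_lam)`. -/
noncomputable def homMap {M : SuperMod k (T.Alam A lam)} {N : (T.catC A lam).FullSubcategory}
    (f : (weylFunctor hR hW).obj M ⟶ N) : M ⟶ (weightFunctor hA).obj N :=
  unitHom hA hR hW M ≫ (weightFunctor hA).map f

/-- The vectors `w ⊗ m` generate `W ⊗ M` over `U(g ⊗ A)`. -/
theorem homMap_injective (M : SuperMod k (T.Alam A lam)) (N : (T.catC A lam).FullSubcategory) :
    Function.Injective (homMap hA hR hW : ((weylFunctor hR hW).obj M ⟶ N) → _) := by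
  intro f f' h
  apply ObjectProperty.hom_ext
  apply SuperMod.Hom.ext
  refine LinearMap.ext fun t => ?_
  change WeylBimodule hR ⊗[T.Alam A lam] M at t
  induction t with
  | zero => exact (map_zero _).trans (map_zero _).symm
  | add s t hs ht => exact (map_add _ _ _).trans ((congrArg₂ (· + ·) hs ht).trans (map_add _ _ _).symm)
  | tmul x m =>
    obtain ⟨u, rfl⟩ := bimodule_generated hR x
    have h1 := congrArg (fun φ => (SuperMod.Hom.toLinearMap φ m : T.weightSpace N.obj lam).1) h
    have h2 : SuperMod.Hom.toLinearMap f.hom (bimoduleGen hR ⊗ₜ[T.Alam A lam] m :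
        WeylBimodule hR ⊗[T.Alam A lam] M) = SuperMod.Hom.toLinearMap f'.hom
        (bimoduleGen hR ⊗ₜ[T.Alam A lam] m : WeylBimodule hR ⊗[T.Alam A lam] M) := h1
    exact (map_smul (SuperMod.Hom.toLinearMap f.hom) u _).trans
      ((congrArg (u • ·) h2).trans (map_smul (SuperMod.Hom.toLinearMap f'.hom) u _).symm)

/-- Each `v m` determines a homomorphism `W → N` by the universal property. Additivity in `m` and
compatibility with `A_λ` can be checked on the vectors `u w`. -/
theorem exists_tensorLift [IsAlgClosed k] [FiniteDimensional k T.r] (hr : IsReductive k T.r)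
    {M : SuperMod k (T.Alam A lam)} {N : SuperMod k (U k (g ⊗[k] A))} (hN : T.catC A lam N)
    (v : M → N) (hv : ∀ m, v m ∈ T.weightSpace N lam) (hv_add : ∀ m m', v (m + m') = v m + v m')
    (hv_smul : ∀ (s : T.cartanAlg A) m,
      v (T.AlamMk A lam s • m) = (s : U k (g ⊗[k] A)) • v m) :
    ∃ Φ : WeylBimodule hR ⊗[T.Alam A lam] M →ₗ[U k (g ⊗[k] A)] N,
      ∀ (u : U k (g ⊗[k] A)) m, Φ ((u • bimoduleGen hR) ⊗ₜ m) = u • v m := by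
  choose φ hφ using fun m => exists_weylLift hr hN (hv m)
  have hφ' : ∀ m (u : U k (g ⊗[k] A)), φ m (u • T.weylGen A lam) = u • v m := fun m u => by
    rw [map_smul, hφ]
  let ψ : M →+ WeylBimodule hR →+ N := AddMonoidHom.mk' (fun m => (φ m).toAddMonoidHom) (by
    intro m m'
    refine AddMonoidHom.ext fun x => ?_
    obtain ⟨u, rfl⟩ := T.weyl_generated A lam x
    exact (hφ' _ u).trans ((congrArg (u • ·) (hv_add m m')).trans ((smul_add _ _ _).trans
      (congrArg₂ (· + ·) (hφ' m u).symm (hφ' m' u).symm))))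
  have hψ : ∀ m (u : U k (g ⊗[k] A)), ψ m (u • bimoduleGen hR) = u • v m := hφ'
  clear_value ψ
  -- The map is balanced because `(u s) v(m) = u v(s m)`.
  let Φ : WeylBimodule hR ⊗[T.Alam A lam] M →+ N := TensorProduct.liftAddHom ψ.flip (by
    intro a x m
    obtain ⟨s, rfl⟩ := T.AlamMk_surjective A lam a
    obtain ⟨u, rfl⟩ := bimodule_generated hR x
    rw [AlamMk_smul, AddMonoidHom.flip_apply, AddMonoidHom.flip_apply, hψ, hψ, hv_smul, mul_smul])
  have hΦ : ∀ (u : U k (g ⊗[k] A)) m, Φ ((u • bimoduleGen hR) ⊗ₜ m) = u • v m :=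
    fun u m => hψ m u
  clear_value Φ
  refine ⟨{ toFun := Φ, map_add' := map_add Φ, map_smul' := fun u t => ?_ }, hΦ⟩
  rw [RingHom.id_apply]
  induction t with
  | zero => rw [smul_zero, map_zero, smul_zero]
  | add s t hs ht => rw [smul_add, map_add, hs, ht, map_add, smul_add]
  | tmul x m =>
    obtain ⟨u', rfl⟩ := bimodule_generated hR x
    rw [TensorProduct.smul_tmul', ← mul_smul, hΦ, hΦ, mul_smul]

theorem weightModule_parity (N : (T.catC A lam).FullSubcategory)
    (n : weightModule hA N) :
    ((weightModule hA N).grading.parity n : T.weightSpace N.obj lam).1 =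
      N.obj.grading.parity (n : T.weightSpace N.obj lam).1 := by
  obtain ⟨a, ha, b, hb, rfl⟩ := (weightModule hA N).grading.exists_add n
  rw [map_add, Z2Grading.parity_of_mem _ ha, Z2Grading.parity_of_mem _ hb]
  refine Eq.trans ?_ (map_add N.obj.grading.parity (a : T.weightSpace N.obj lam).1
    (b : T.weightSpace N.obj lam).1).symm
  rw [N.obj.grading.parity_of_mem (show (a : T.weightSpace N.obj lam).1 ∈ N.obj.grading.gr 0 from ha),
    N.obj.grading.parity_of_mem (show (b : T.weightSpace N.obj lam).1 ∈ N.obj.grading.gr 1 from hb)]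
  rfl

theorem tensorLift_parity {M : SuperMod k (T.Alam A lam)} {N : SuperMod k (U k (g ⊗[k] A))}
    {v : M → N} (hv : ∀ m, v (M.grading.parity m) = N.grading.parity (v m))
    {Φ : WeylBimodule hR ⊗[T.Alam A lam] M →ₗ[U k (g ⊗[k] A)] N}
    (hΦ : ∀ (u : U k (g ⊗[k] A)) m, Φ ((u • bimoduleGen hR) ⊗ₜ m) = u • v m)
    (t : WeylBimodule hR ⊗[T.Alam A lam] M) :
    N.grading.parity (Φ t) = Φ (weylTensorParity hR M t) := by
  induction t with
  | zero => simp only [map_zero]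
  | add s t hs ht => simp only [map_add, hs, ht]
  | tmul x m =>
    obtain ⟨u, rfl⟩ := bimodule_generated hR x
    have h1 : weylParity hR (u • bimoduleGen hR) = U.σ k (g ⊗[k] A) u • bimoduleGen hR :=
      ((T.weyl A lam).parity_smul u (T.weylGen A lam)).trans
        (by rw [U.parity_eq_σ, parity_weylGen]; rfl)
    rw [weylTensorParity_tmul, hΦ, N.parity_smul, U.parity_eq_σ, ← hv, h1, hΦ]
    rfl

theorem homMap_surjective [IsAlgClosed k] [FiniteDimensional k T.r] (hr : IsReductive k T.r)
    (M : SuperMod k (T.Alam A lam)) (N : (T.catC A lam).FullSubcategory) :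
    Function.Surjective (homMap hA hR hW : ((weylFunctor hR hW).obj M ⟶ N) → _) := by
  intro h
  obtain ⟨Φ, hΦ⟩ := exists_tensorLift hR hr N.property
    (fun m => (SuperMod.Hom.toLinearMap h m : T.weightSpace N.obj lam).1)
    (fun m => (SuperMod.Hom.toLinearMap h m : T.weightSpace N.obj lam).2)
    (fun m m' => congrArg Subtype.val (map_add (SuperMod.Hom.toLinearMap h) m m'))
    (fun s m => congrArg Subtype.val (map_smul (SuperMod.Hom.toLinearMap h) (T.AlamMk A lam s) m))
  have hpar := tensorLift_parity hR (fun m => (congrArg Subtype.val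
    (SuperMod.Hom.parity_apply h m).symm).trans (weightModule_parity hA N _)) hΦ
  refine ⟨ObjectProperty.homMk (SuperMod.homOfParity (M := weylTensor hR M) Φ fun t =>
    (hpar t).trans (congrArg Φ (Z2Grading.parity_ofInvolution _ (weylTensorParity_invol hR M) t).symm)),
    SuperMod.Hom.ext (LinearMap.ext fun m => Subtype.ext ?_)⟩
  · have h1 := hΦ 1 m
    rw [one_smul, one_smul] at h1
    exact h1

/-- The Weyl functor is left adjoint to the weight space functor. -/
noncomputable def weylAdjunction [IsAlgClosed k] [FiniteDimensional k T.r] (hr : IsReductive k T.r) :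
    weylFunctor hR hW ⊣ weightFunctor hA :=
  Adjunction.mkOfHomEquiv
    { homEquiv := fun M N => Equiv.ofBijective (homMap hA hR hW)
        ⟨homMap_injective hA hR hW M N, homMap_surjective hA hR hW hr M N⟩
      homEquiv_naturality_left_symm := fun {M' M N} f h => by
        apply (Equiv.ofBijective (homMap hA hR hW)
          ⟨homMap_injective hA hR hW M' N, homMap_surjective hA hR hW hr M' N⟩).injective
        rw [Equiv.apply_symm_apply]
        have h1 := (Equiv.ofBijective (homMap hA hR hW)
          ⟨homMap_injective hA hR hW M N, homMap_surjective hA hR hW hr M N⟩).apply_symm_apply h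
        nth_rewrite 1 [← h1]
        rfl
      homEquiv_naturality_right := fun f h => rfl }

/-! ### Projective modules -/

/-- The cokernel of `f` is an image of `N`, so it stays in the category and can be used to test `f`
there. -/
theorem surjective_of_epi [IsAlgClosed k] [FiniteDimensional k T.r] (hr : IsReductive k T.r)
    {M N : (T.catC A lam).FullSubcategory} (f : M ⟶ N) [Epi f] :
    Function.Surjective (SuperMod.Hom.toLinearMap f.hom) := by
  refine SuperMod.surjective_of_comp_eq f.hom fun h => ?_
  have hQ : T.catC A lam (SuperMod.coker f.hom) := by
    refine catC_of_images hr fun P hP => ?_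
    rw [eq_top_iff]
    intro q _
    obtain ⟨n, rfl⟩ := Submodule.mkQ_surjective _ q
    exact hP N.obj N.property (SuperMod.cokerProj f.hom).toLinearMap n
  let Q : (T.catC A lam).FullSubcategory := ⟨_, hQ⟩
  let p : N ⟶ Q := ObjectProperty.homMk (SuperMod.cokerProj f.hom)
  let z : N ⟶ Q := ObjectProperty.homMk (SuperMod.zeroHom _ _)
  have h1 : f ≫ p = f ≫ z := ObjectProperty.hom_ext _ h
  exact congrArg (fun φ : N ⟶ Q => φ.hom) ((cancel_epi f).1 h1)

/-- `M` is a sum of weight spaces, so vectors of weight `λ` lift along surjections to vectors of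
weight `λ`. -/
theorem weightFunctor_preservesEpimorphisms [IsAlgClosed k] [FiniteDimensional k T.r]
    (hr : IsReductive k T.r) : (weightFunctor hA).PreservesEpimorphisms where
  preserves {M N} f _ := by
    refine SuperMod.epi_of_surjective _ ?_
    rintro ⟨n, hn⟩
    obtain ⟨m, rfl⟩ := surjective_of_epi hr f n
    obtain ⟨v, hv, e⟩ := ((catC_iff hr).1 M.property).2.1.exists_lift (ρ' := act T.h N.obj)
      (φ := (SuperMod.Hom.toLinearMap f.hom).restrictScalars k)
      (fun y m => map_lie_of_linear (SuperMod.Hom.toLinearMap f.hom) (y : T.r) m) hn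
    exact ⟨(⟨v, hv⟩ : T.weightSpace M.obj lam), Subtype.ext e⟩

/-- A graded module whose underlying module is projective is a projective object. -/
theorem projective_of_module (M : SuperMod k (T.Alam A lam))
    (hM : Module.Projective (T.Alam A lam) M) : Projective M where
  factors {E X} f e _ := by
    obtain ⟨φ, hφ⟩ := Module.projective_lifting_property (SuperMod.Hom.toLinearMap e)
      (SuperMod.Hom.toLinearMap f) (SuperMod.surjective_of_epi e)
    -- The lift `φ` need not be even; averaging it with its conjugate by the parity operators makes
    -- it even. The result still lifts `f`, because `e` and `f` commute with parity.
    let ψ : M →ₗ[T.Alam A lam] E :=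
      algebraMap k (T.Alam A lam) (2 : k)⁻¹ • (φ + AlamParity E ∘ₗ φ ∘ₗ AlamParity M)
    have hψ : ∀ m, ψ m = (2 : k)⁻¹ • (φ m + E.grading.parity (φ (M.grading.parity m))) := fun m =>
      algebraMap_smul (T.Alam A lam) (2 : k)⁻¹ _
    have hφ' : ∀ m, SuperMod.Hom.toLinearMap e (φ m) = SuperMod.Hom.toLinearMap f m :=
      LinearMap.congr_fun hφ
    refine ⟨SuperMod.homOfParity ψ fun m => ?_, SuperMod.Hom.ext (LinearMap.ext fun m => ?_)⟩
    · rw [hψ, hψ, map_smul, map_add, Z2Grading.parity_parity, Z2Grading.parity_parity, add_comm]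
    · change SuperMod.Hom.toLinearMap e (ψ m) = SuperMod.Hom.toLinearMap f m
      rw [hψ, LinearMap.map_smul_of_tower, map_add, ← SuperMod.Hom.parity_apply, hφ', hφ',
        ← SuperMod.Hom.parity_apply, Z2Grading.parity_parity, ← two_smul k, smul_smul,
        inv_mul_cancel₀ two_ne_zero, one_smul]

end Unit

end TriangularDecomposition

end SuperWeyl

theorem propositionA1 {k g A : Type u} [Field k] [IsAlgClosed k] [CharZero k]
    [AddCommGroup g] [Module k g] [SuperWeyl.LieSuperalgebra k g] [CommRing A] [Algebra k A]
    (T : SuperWeyl.TriangularDecomposition k g) (hT : SuperWeyl.IsReductivePart T.r)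
    (hC1 : T.C1) (lam : Module.Dual k T.h) (hlam : lam ∈ T.dominantWeights) :
    ∃ (hA : T.AnnActsTrivially A lam) (hR : T.RightActionWellDefined A lam)
      (hW : ∀ M : SuperWeyl.SuperMod k (T.Alam A lam),
        T.catC A lam (SuperWeyl.TriangularDecomposition.weylTensor hR M)),
      Nonempty (SuperWeyl.TriangularDecomposition.weylFunctor hR hW ⋙
        SuperWeyl.TriangularDecomposition.weightFunctor hA ≅
          𝟭 (SuperWeyl.SuperMod k (T.Alam A lam))) ∧
      Nonempty (SuperWeyl.TriangularDecomposition.weylFunctor hR hW ⊣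
        SuperWeyl.TriangularDecomposition.weightFunctor hA) ∧
      (SuperWeyl.TriangularDecomposition.weylFunctor hR hW).Full ∧
      (SuperWeyl.TriangularDecomposition.weylFunctor hR hW).Faithful ∧
      ∀ M : SuperWeyl.SuperMod k (T.Alam A lam), Module.Projective (T.Alam A lam) M →
        Projective ((SuperWeyl.TriangularDecomposition.weylFunctor hR hW).obj M) := by
  have : FiniteDimensional k g := hT.finiteDimensional
  have : FiniteDimensional k T.r := FiniteDimensional.of_injective T.inclR T.inclR_injective
  have hr : SuperWeyl.IsReductive k T.r := hT.isSeparated.isReductive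
  have hA : T.AnnActsTrivially A lam := SuperWeyl.TriangularDecomposition.annActsTrivially hr
  have hR : T.RightActionWellDefined A lam :=
    SuperWeyl.TriangularDecomposition.rightActionWellDefined hr hlam
  have hW : ∀ M : SuperWeyl.SuperMod k (T.Alam A lam),
      T.catC A lam (SuperWeyl.TriangularDecomposition.weylTensor hR M) :=
    SuperWeyl.TriangularDecomposition.weylTensor_mem_catC hr hlam hR
  let adj := SuperWeyl.TriangularDecomposition.weylAdjunction hA hR hW hr
  let e := SuperWeyl.TriangularDecomposition.unitIso hA hR hW
  -- Any isomorphism of the composite with the identity makes the unit invertible, whence full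
  -- faithfulness of the left adjoint.
  have ff := adj.fullyFaithfulLOfCompIsoId e
  -- A left adjoint preserves projective objects when its right adjoint preserves epimorphisms.
  have := SuperWeyl.TriangularDecomposition.weightFunctor_preservesEpimorphisms hA hr
  exact ⟨hA, hR, hW, ⟨e⟩, ⟨adj⟩, ff.full, ff.faithful, fun M hM => adj.map_projective M
    (SuperWeyl.TriangularDecomposition.projective_of_module M hM)⟩
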